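/- Let $d\ge 2$. A channel is a completely positive trace-preserving linear map between operator spaces of finite-dimensional Hilbert spaces; for a matrix $U$ write $\mathcal U(\rho)=U\rho U^\dagger$. Let $W\in U(d)$ be a fixed unitary and let $\theta(C)=WC^TW^\dagger$ (so $\theta$ is unitarily equivalent to the transpose; $W=I$ gives the transpose itself). The input-output inversion $\Theta$ is the linear map sending the map with Kraus operators $(C_i)$ to the map with Kraus operators $(\theta(C_i))$, and the quantum time flip $\mathcal F$ is the linear map sending the map on $\mathbb C^d$ with Kraus operators $(C_i)$ to the map on $\mathbb C^d\otimes\mathbb C^2$ with Kraus operators $C_i\otimes|0\rangle\langle 0|+\theta(C_i)\otimes|1\rangle\langle 1|$. A bipartite channel is no-signalling if it is of the form $\sum_j c_j\,\mathcal A_j\otimes\mathcal B_j$ with $c_j\in\mathbb R$ and channels $\mathcal A_j,\mathcal B_j$. A two-slot supermap (possibly with indefinite causal order) is a linear map $\mathcal S$ from linear maps $L(H_{A_i}\otimes H_{B_i})\to L(H_{A_o}\otimes H_{B_o})$ to linear maps $L(H_{C_i})\to L(H_{C_o})$ that sends no-signalling channels to channels and such that $(\mathcal S\otimes\mathcal I_{D_iD_o})(\mathcal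 M)$ is a channel for all finite-dimensional systems $D_i,D_o$ and every channel $\mathcal M$ from $A_iB_iD_i$ to $A_oB_oD_o$ for which $\rho\mapsto \mathrm{Tr}_{D_o}[\mathcal M(\rho\otimes\sigma)]$ is no-signalling for every state $\sigma$ of $D_i$. Here $H_{A_i},H_{A_o},H_{B_i},H_{B_o}$ are all $\mathbb C^d$. Used forward, $\mathcal S$ gives $\mathcal S_{\rm fwd}(\mathcal A,\mathcal B)=\mathcal S(\mathcal A\otimes\mathcal B)$; used backward, it gives $\mathcal S_{\rm bwd}(\mathcal A,\mathcal B)=\mathcal S(\Theta(\mathcal A)\otimes\Theta(\mathcal B))$. Theorem. (1) There are no $p\in[0,1]$, forward $\mathcal S_{\rm fwd}$ and backward $\mathcal S_{\rm bwd}$, arising from two such supermaps with output maps on $\mathbb C^d\otimes\mathbb C^2$, such that $$\mathcal F(\mathcal U)=p\,\mathcal S_{\rm fwd}(\mathcal U,\mathcal U)+(1-p)\,\mathcal S_{\rm bwd}(\mathcal U,\mathcal U)\quad\text{for all } U\in U(d).$$ (2) For every such supermap $\mathcal S$ with output maps on $\mathbb C^d$, let $D_U$ be the Choi operator of $\mathcal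 S(\mathcal U\otimes\mathcal U)$ and let $E_U$ be the Choi operator of the unitary channel $\rho\mapsto U^T\rho\,\overline U$, where the Choi operator of $\mathcal M$ is $\sum_{m,n}\mathcal M(|m\rangle\langle n|)\otimes|m\rangle\langle n|$. Then the average fidelity $F=\int \mathrm{Tr}[D_UE_U]/d^2\,dU$ over the normalized Haar measure of $U(d)$ satisfies $F\le 6/d^2$ if $d>2$ and $F\le 5/6$ if $d=2$. -/

import Mathlib

open scoped Kronecker ComplexOrder
open MeasureTheory

set_option linter.unusedSectionVars false

namespace TimeFlip

/-- Linear maps from the operators on `ℂ^a` to the operators on `ℂ^b`. -/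
abbrev OpMap (a b : Type) := Matrix a a ℂ →ₗ[ℂ] Matrix b b ℂ

section Channels

variable {a b c e : Type} [Fintype a] [DecidableEq a] [Fintype b] [DecidableEq b]
  [Fintype c] [DecidableEq c] [Fintype e] [DecidableEq e]

/-- The map `ρ ↦ A ρ B†`. -/
def sandwich (A B : Matrix b a ℂ) : OpMap a b where
  toFun X := A * X * B.conjTranspose
  map_add' X Y := by rw [Matrix.mul_add, Matrix.add_mul]
  map_smul' r X := by simp

theorem sandwich_apply (A B : Matrix b a ℂ) (X : Matrix a a ℂ) :
    sandwich A B X = A * X * B.conjTranspose := rfl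

/-- The map `ρ ↦ K ρ K†`. For a unitary `K` this is the unitary channel of `K`. -/
def conjBy (K : Matrix b a ℂ) : OpMap a b := sandwich K K

/-- The map `ρ ↦ ∑ i, K i ρ (K i)†` with Kraus operators `K`. -/
def krausMap {ι : Type} [Fintype ι] (K : ι → Matrix b a ℂ) : OpMap a b :=
  ∑ i, conjBy (K i)

/-- The block `X_{mn}` of an operator `X = ∑ m n, X_{mn} ⊗ |m⟩⟨n|` on `ℂ^a ⊗ ℂ^c`. -/
def block (m n : c) : Matrix (a × c) (a × c) ℂ →ₗ[ℂ] Matrix a a ℂ where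
  toFun X := Matrix.of fun i j => X (i, m) (j, n)
  map_add' _ _ := rfl
  map_smul' _ _ := rfl

theorem block_apply (m n : c) (X : Matrix (a × c) (a × c) ℂ) (i j : a) :
    block m n X i j = X (i, m) (j, n) := rfl

/-- The tensor product `Φ ⊗ Ψ`, which maps `∑ m n, X_{mn} ⊗ |m⟩⟨n|` to
`∑ m n, Φ(X_{mn}) ⊗ Ψ(|m⟩⟨n|)`; see `tensorMap_kronecker`. -/
def tensorMap (Φ : OpMap a b) (Ψ : OpMap c e) : OpMap (a × c) (b × e) where
  toFun X := Matrix.of fun p q => ∑ m, ∑ n,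
    Φ (block m n X) p.1 q.1 *
      Ψ (Matrix.single m n 1) p.2 q.2
  map_add' X Y := by
    ext p q
    simp [add_mul, Finset.sum_add_distrib]
  map_smul' r X := by
    ext p q
    simp [Finset.mul_sum, mul_assoc]

theorem tensorMap_apply (Φ : OpMap a b) (Ψ : OpMap c e) (X : Matrix (a × c) (a × c) ℂ)
    (p q : b × e) : tensorMap Φ Ψ X p q =
      ∑ m, ∑ n, Φ (block m n X) p.1 q.1 * Ψ (Matrix.single m n 1) p.2 q.2 := rfl

theorem tensorMap_kronecker (Φ : OpMap a b) (Ψ : OpMap c e) (X : Matrix a a ℂ)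
    (Y : Matrix c c ℂ) : tensorMap Φ Ψ (X ⊗ₖ Y) = Φ X ⊗ₖ Ψ Y := by
  have h : ∀ m n, block m n (X ⊗ₖ Y) = Y m n • X := by
    intro m n
    ext i j
    simp [block_apply, mul_comm]
  ext p q
  have hY : Ψ Y = ∑ m, ∑ n, Y m n • Ψ (Matrix.single m n 1) := by
    conv_lhs => rw [Matrix.matrix_eq_sum_single Y]
    simp only [map_sum]
    refine Finset.sum_congr rfl fun m _ => Finset.sum_congr rfl fun n _ => ?_
    rw [← map_smul, Matrix.smul_single, smul_eq_mul, mul_one]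
  rw [hY]
  simp only [tensorMap_apply, h, map_smul,
    Matrix.smul_apply, smul_eq_mul, Matrix.kroneckerMap_apply, Matrix.sum_apply, Finset.mul_sum]
  refine Finset.sum_congr rfl fun m _ => Finset.sum_congr rfl fun n _ => ?_
  ring

/-- Complete positivity: `Φ ⊗ id_k` maps positive operators to positive operators, for all `k`. -/
def IsCP (Φ : OpMap a b) : Prop :=
  ∀ (k : ℕ) (X : Matrix (a × Fin k) (a × Fin k) ℂ), X.PosSemidef →
    (tensorMap Φ (LinearMap.id : OpMap (Fin k) (Fin k)) X).PosSemidef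

/-- Quantum channels: completely positive trace-preserving maps. -/
def IsChannel (Φ : OpMap a b) : Prop :=
  IsCP Φ ∧ ∀ X, (Φ X).trace = X.trace

/-- Density matrices. -/
def IsDensity (σ : Matrix a a ℂ) : Prop :=
  σ.PosSemidef ∧ σ.trace = 1

/-- The Choi operator `∑ m n, Φ(|m⟩⟨n|) ⊗ |m⟩⟨n|`. -/
def choi (Φ : OpMap a b) : Matrix (b × a) (b × a) ℂ :=
  Matrix.of fun p q => Φ (Matrix.single p.2 q.2 1) p.1 q.1

/-- The reduced map `ρ ↦ Tr_e [M (ρ ⊗ σ)]`. -/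
def reduced (M : OpMap (a × c) (b × e)) (σ : Matrix c c ℂ) : OpMap a b where
  toFun ρ := Matrix.of fun i j => ∑ k, M (ρ ⊗ₖ σ) (i, k) (j, k)
  map_add' X Y := by
    ext i j
    simp [Matrix.add_kronecker, Finset.sum_add_distrib]
  map_smul' r X := by
    ext i j
    simp [Matrix.smul_kronecker, Finset.mul_sum]

end Channels

section Supermaps

variable {Ai Ao Bi Bo Ci Co Di Do : Type}
  [Fintype Ai] [DecidableEq Ai] [Fintype Ao] [DecidableEq Ao]
  [Fintype Bi] [DecidableEq Bi] [Fintype Bo] [DecidableEq Bo]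
  [Fintype Ci] [DecidableEq Ci] [Fintype Co] [DecidableEq Co]
  [Fintype Di] [DecidableEq Di] [Fintype Do] [DecidableEq Do]

/-- No-signalling channels for the bipartition `Ai → Ao | Bi → Bo`: the channels that are
real linear combinations of products of channels. -/
def IsNoSignalling (N : OpMap (Ai × Bi) (Ao × Bo)) : Prop :=
  IsChannel N ∧ ∃ (r : ℕ) (t : Fin r → ℝ) (A : Fin r → OpMap Ai Ao) (B : Fin r → OpMap Bi Bo),
    (∀ j, IsChannel (A j)) ∧ (∀ j, IsChannel (B j)) ∧
      N = ∑ j, (t j : ℂ) • tensorMap (A j) (B j)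

/-- The component of `M` that takes an operator `X` to the `(k', l')` block of
`M (X ⊗ |k⟩⟨l|)`. -/
def component (M : OpMap (Ai × Di) (Ao × Do)) (k l : Di) (k' l' : Do) : OpMap Ai Ao where
  toFun X := block k' l' (M (X ⊗ₖ Matrix.single k l 1))
  map_add' X Y := by simp [Matrix.add_kronecker]
  map_smul' r X := by simp [Matrix.smul_kronecker]

/-- The local action `(S ⊗ I_{Di Do}) (M)` of a linear map `S` between spaces of maps. It is
linear in `M`, and on products it is given by `localAction_tensorMap`. -/
def localAction (S : OpMap Ai Ao →ₗ[ℂ] OpMap Ci Co) (M : OpMap (Ai × Di) (Ao × Do)) :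
    OpMap (Ci × Di) (Co × Do) where
  toFun Y := Matrix.of fun p q => ∑ k, ∑ l,
    S (component M k l p.2 q.2) (block k l Y) p.1 q.1
  map_add' X Y := by
    ext p q
    simp [Finset.sum_add_distrib]
  map_smul' r X := by
    ext p q
    simp [Finset.mul_sum]

theorem localAction_apply (S : OpMap Ai Ao →ₗ[ℂ] OpMap Ci Co) (M : OpMap (Ai × Di) (Ao × Do))
    (Y : Matrix (Ci × Di) (Ci × Di) ℂ) (p q : Co × Do) : localAction S M Y p q =
      ∑ k, ∑ l, S (component M k l p.2 q.2) (block k l Y) p.1 q.1 := rfl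

theorem localAction_tensorMap (S : OpMap Ai Ao →ₗ[ℂ] OpMap Ci Co) (Φ : OpMap Ai Ao)
    (Ψ : OpMap Di Do) : localAction S (tensorMap Φ Ψ) = tensorMap (S Φ) Ψ := by
  have h : ∀ k l k' l', component (tensorMap Φ Ψ) k l k' l' =
      Ψ (Matrix.single k l 1) k' l' • Φ := by
    intro k l k' l'
    refine LinearMap.ext fun X => ?_
    ext i j
    change block k' l' (tensorMap Φ Ψ (X ⊗ₖ Matrix.single k l 1)) i j = _
    rw [tensorMap_kronecker, block_apply, LinearMap.smul_apply, Matrix.smul_apply, smul_eq_mul,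
      Matrix.kroneckerMap_apply, mul_comm]
  refine LinearMap.ext fun Y => ?_
  ext p q
  simp only [localAction_apply, tensorMap_apply, h, map_smul, LinearMap.smul_apply,
    Matrix.smul_apply, smul_eq_mul, mul_comm]

/-- Two-slot quantum supermaps, possibly with indefinite causal order: linear maps that send
no-signalling channels to channels, also when they act locally on an extension. -/
def IsSupermap (S : OpMap (Ai × Bi) (Ao × Bo) →ₗ[ℂ] OpMap Ci Co) : Prop :=
  (∀ N, IsNoSignalling N → IsChannel (S N)) ∧
  ∀ (m n : ℕ) (M : OpMap ((Ai × Bi) × Fin m) ((Ao × Bo) × Fin n)), IsChannel M →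
    (∀ σ, IsDensity σ → IsNoSignalling (reduced M σ)) → IsChannel (localAction S M)

end Supermaps

section Inversion

variable {a b a' b' : Type} [Fintype a] [DecidableEq a] [Fintype b] [DecidableEq b]
  [Fintype a'] [DecidableEq a'] [Fintype b'] [DecidableEq b']

/-- The transformation of maps induced by a linear transformation `G` of Kraus operators: if
`M` has Kraus operators `K i`, then the result has Kraus operators `G (K i)`; see
`liftKraus_krausMap`. Here `M = ∑ M(|m⟩⟨n|)_{ij} |i⟩⟨m| · (|j⟩⟨n|)†`. -/
def liftKraus (G : Matrix b a ℂ →ₗ[ℂ] Matrix b' a' ℂ) : OpMap a b →ₗ[ℂ] OpMap a' b' where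
  toFun M := ∑ i, ∑ m, ∑ j, ∑ n, M (Matrix.single m n 1) i j •
    sandwich (G (Matrix.single i m 1)) (G (Matrix.single j n 1))
  map_add' M N := by
    simp only [LinearMap.add_apply, Matrix.add_apply, add_smul, Finset.sum_add_distrib]
  map_smul' r M := by
    simp only [LinearMap.smul_apply, Matrix.smul_apply, smul_eq_mul, mul_smul, Finset.smul_sum,
      RingHom.id_apply]

theorem liftKraus_apply (G : Matrix b a ℂ →ₗ[ℂ] Matrix b' a' ℂ) (M : OpMap a b) :
    liftKraus G M = ∑ i, ∑ m, ∑ j, ∑ n, M (Matrix.single m n 1) i j •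
      sandwich (G (Matrix.single i m 1)) (G (Matrix.single j n 1)) := rfl

theorem liftKraus_conjBy (G : Matrix b a ℂ →ₗ[ℂ] Matrix b' a' ℂ) (K : Matrix b a ℂ) :
    liftKraus G (conjBy K) = conjBy (G K) := by
  have hK : G K = ∑ i, ∑ m, K i m • G (Matrix.single i m 1) := by
    conv_lhs => rw [Matrix.matrix_eq_sum_single K]
    simp only [map_sum]
    refine Finset.sum_congr rfl fun m _ => Finset.sum_congr rfl fun n _ => ?_
    rw [← map_smul, Matrix.smul_single, smul_eq_mul, mul_one]
  have hK' : (G K).conjTranspose =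
      ∑ j, ∑ n, star (K j n) • (G (Matrix.single j n 1)).conjTranspose := by
    simp only [hK, Matrix.conjTranspose_sum, Matrix.conjTranspose_smul]
  have h : ∀ m n i j, conjBy K (Matrix.single m n 1) i j = star (K j n) * K i m := by
    intro m n i j
    simp [conjBy, sandwich_apply, Matrix.mul_apply, Matrix.single_apply, ite_and, mul_comm]
  refine LinearMap.ext fun X => ?_
  simp only [conjBy, sandwich_apply, liftKraus_apply, LinearMap.sum_apply,
    LinearMap.smul_apply, hK'] at h ⊢
  rw [hK]
  simp only [h, Matrix.sum_mul, Matrix.mul_sum, Matrix.smul_mul, Matrix.mul_smul,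
    Finset.smul_sum, smul_smul]
  calc _ = _ := Finset.sum_congr rfl fun i _ => Finset.sum_comm
    _ = _ := Finset.sum_comm
    _ = _ := Finset.sum_congr rfl fun j _ =>
      (Finset.sum_congr rfl fun i _ => Finset.sum_comm).trans Finset.sum_comm

theorem liftKraus_krausMap {ι : Type} [Fintype ι] (G : Matrix b a ℂ →ₗ[ℂ] Matrix b' a' ℂ)
    (K : ι → Matrix b a ℂ) : liftKraus G (krausMap K) = krausMap fun i => G (K i) := by
  simp only [krausMap, map_sum, liftKraus_conjBy]

variable {d : ℕ}

/-- The transformation `θ (C) = W Cᵀ W†` of Kraus operators, unitarily equivalent to the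
transpose. -/
def theta (W : Matrix a a ℂ) : Matrix a a ℂ →ₗ[ℂ] Matrix a a ℂ where
  toFun C := W * C.transpose * W.conjTranspose
  map_add' X Y := by simp [Matrix.mul_add, Matrix.add_mul]
  map_smul' r X := by simp

/-- The input-output inversion `Θ` of maps, with Kraus operators `θ (C_i)`. -/
def inversion (W : Matrix a a ℂ) : OpMap a a →ₗ[ℂ] OpMap a a :=
  liftKraus (theta W)

/-- The controlled Kraus operator `C ⊗ |0⟩⟨0| + θ (C) ⊗ |1⟩⟨1|`. -/
def flipOp (W : Matrix a a ℂ) :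
    Matrix a a ℂ →ₗ[ℂ] Matrix (a × Fin 2) (a × Fin 2) ℂ where
  toFun C := C ⊗ₖ Matrix.single 0 0 1 + theta W C ⊗ₖ Matrix.single 1 1 1
  map_add' X Y := by
    simp only [map_add, Matrix.add_kronecker]
    abel
  map_smul' r X := by
    simp only [map_smul, Matrix.smul_kronecker, RingHom.id_apply, smul_add]

/-- The quantum time flip, with Kraus operators `C_i ⊗ |0⟩⟨0| + θ (C_i) ⊗ |1⟩⟨1|`. -/
def timeFlip (W : Matrix a a ℂ) : OpMap a a →ₗ[ℂ] OpMap (a × Fin 2) (a × Fin 2) :=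
  liftKraus (flipOp W)

variable {Ci Co : Type} [Fintype Ci] [DecidableEq Ci] [Fintype Co] [DecidableEq Co]

/-- Use of a pair of maps in the forward direction. -/
def forward (S : OpMap (a × a) (a × a) →ₗ[ℂ] OpMap Ci Co) (A B : OpMap a a) : OpMap Ci Co :=
  S (tensorMap A B)

/-- Use of a pair of maps in the backward direction. -/
def backward (W : Matrix a a ℂ) (S : OpMap (a × a) (a × a) →ₗ[ℂ] OpMap Ci Co)
    (A B : OpMap a a) : OpMap Ci Co :=
  S (tensorMap (inversion W A) (inversion W B))

/-- The Choi fidelity `Tr [D_U E_U] / d ^ 2`, where `D_U` is the Choi operator of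
`S (U ⊗ U)` and `E_U` is the Choi operator of the unitary channel of `Uᵀ`. -/
noncomputable def transposeFidelity
    (S : OpMap (Fin d × Fin d) (Fin d × Fin d) →ₗ[ℂ] OpMap (Fin d) (Fin d))
    (U : Matrix (Fin d) (Fin d) ℂ) : ℝ :=
  ((choi (forward S (conjBy U) (conjBy U)) * choi (conjBy U.transpose)).trace).re / (d : ℝ) ^ 2

end Inversion

end TimeFlip

set_option linter.unusedSimpArgs false

namespace TimeFlip

open Matrix

/-! ### Choi operators, Kraus operators and channels. -/

section ChannelTheory


variable {a b c e : Type} [Fintype a] [DecidableEq a] [Fintype b] [DecidableEq b]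
  [Fintype c] [DecidableEq c] [Fintype e] [DecidableEq e]

/-! The fidelity bound is weak duality for a semidefinite program. Let `J = superChoi S` and let
`T_U = Ū ⊗ Ū ⊗ U` (`tripleRep`). The Choi fidelity is a quadratic form in the entries of `T_U`, so
its Haar average is `Tr[J M] / d²`, where `M` (`tripleMoment`) averages the rank-one operators of
the vectorized `T_U`. The supermap axioms enter through two facts: `J ≥ 0`, and `Tr[J (N ⊗ 1)] = d`
for every symmetric Choi operator `N` of a channel from `A_i B_i C_i` to `A_o B_o` that is
no-signalling for each fixed state of `C_i`. Hence `M ≤ t (N ⊗ 1)` implies `F ≤ t / d`.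

To bound `M`, three copies of `ℂ^d` are split under `T_U` into the traceless symmetric tensors, the
traceless antisymmetric tensors (zero if `d = 2`) and two copies of `Ū`, with projections `Q₁`,
`Q₂`, `A`, `B`. Invariant operators are scalar on the first two parts. The two equivalent copies are
decoupled by `(A + B) X (A + B) ≤ 2 (A X A + B X B)` for `X ≥ 0`. The result is `momentBound`, a
combination of `Q ⊗ Q` over the four projections (`posSemidef_momentBound_sub`). The required form
of Schur's lemma is proved by hand, from commutation with diagonal phases, permutations and
reflections in coordinate planes.

If `d > 2`, enlarging the second factor of each `Q ⊗ Q` to the identity gives a certificate with `t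
= (1 + 1 + 2 + 2) / d`. The same choice for `d = 2` would only give `5/4`. There the certificate
also uses a multiple of `(SWAP - 1/d) ⊗ SWAP` between the outputs and inputs of the slots. It is
compatible with no-signalling because `SWAP - 1/d` is a sum of products of traceless operators. It
brings `t` down to `5/3`.

For the no-go statement, fixing the control of the time flip and undoing `W` leaves the exact task
`U ↦ Uᵀ`. A unitary channel is a mixture only of channels having fidelity one with it, so for `p >
0` the forward supermap would transpose every unitary perfectly, against the bound. For `p = 0` the
other control value exchanges `U` with `θ(U)`, and the backward supermap plays the same role. -/

open scoped MatrixOrder in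
theorem exists_conjTranspose_mul_self {M : Matrix a a ℂ} (hM : M.PosSemidef) :
    ∃ B : Matrix a a ℂ, M = Bᴴ * B := by
  obtain ⟨B, hB⟩ :=
    CStarAlgebra.nonneg_iff_eq_star_mul_self.mp (Matrix.nonneg_iff_posSemidef.mpr hM)
  exact ⟨B, hB⟩

theorem tensorMap_id_apply (Φ : OpMap a b) (X : Matrix (a × c) (a × c) ℂ) (p q : b × c) :
    tensorMap Φ (LinearMap.id : OpMap c c) X p q = Φ (block p.2 q.2 X) p.1 q.1 := by
  rw [tensorMap_apply, Finset.sum_eq_single p.2, Finset.sum_eq_single q.2]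
  · simp
  · intro n _ hn
    simp [Matrix.single_apply, hn]
  · simp
  · intro m _ hm
    simp [Matrix.single_apply, hm]
  · simp

theorem block_tensorMap_id (Φ : OpMap a b) (X : Matrix (a × c) (a × c) ℂ) (m n : c) :
    block m n (tensorMap Φ (LinearMap.id : OpMap c c) X) = Φ (block m n X) := by
  ext i j
  rw [block_apply, tensorMap_id_apply]

theorem tensorMap_comp_id (Φ : OpMap b e) (Ψ : OpMap a b) :
    tensorMap (Φ ∘ₗ Ψ) (LinearMap.id : OpMap c c) =
      tensorMap Φ (LinearMap.id : OpMap c c) ∘ₗ tensorMap Ψ (LinearMap.id : OpMap c c) := by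
  refine LinearMap.ext fun X => ?_
  ext p q
  rw [LinearMap.comp_apply, tensorMap_id_apply, tensorMap_id_apply, block_tensorMap_id,
    LinearMap.comp_apply]

theorem choi_apply (Φ : OpMap a b) (p q : b × a) :
    choi Φ p q = Φ (Matrix.single p.2 q.2 1) p.1 q.1 := rfl

theorem apply_eq_sum_choi (Φ : OpMap a b) (X : Matrix a a ℂ) (i j : b) :
    Φ X i j = ∑ m, ∑ n, X m n * choi Φ (i, m) (j, n) := by
  conv_lhs => rw [Matrix.matrix_eq_sum_single X]
  simp only [map_sum, Matrix.sum_apply, choi_apply]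
  refine Finset.sum_congr rfl fun m _ => Finset.sum_congr rfl fun n _ => ?_
  rw [← smul_eq_mul, ← Matrix.smul_apply, ← map_smul, Matrix.smul_single, smul_eq_mul, mul_one]

theorem ext_choi {Φ Ψ : OpMap a b} (h : choi Φ = choi Ψ) : Φ = Ψ := by
  refine LinearMap.ext fun X => ?_
  ext i j
  rw [apply_eq_sum_choi, apply_eq_sum_choi, h]

theorem IsCP.comp {Φ : OpMap b e} {Ψ : OpMap a b} (hΦ : IsCP Φ) (hΨ : IsCP Ψ) :
    IsCP (Φ ∘ₗ Ψ) := by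
  intro k X hX
  rw [tensorMap_comp_id]
  exact hΦ k _ (hΨ k X hX)

theorem IsChannel.comp {Φ : OpMap b e} {Ψ : OpMap a b} (hΦ : IsChannel Φ) (hΨ : IsChannel Ψ) :
    IsChannel (Φ ∘ₗ Ψ) :=
  ⟨hΦ.1.comp hΨ.1, fun X => by rw [LinearMap.comp_apply, hΦ.2, hΨ.2]⟩

theorem tensorMap_conjBy_id (K : Matrix b a ℂ) (X : Matrix (a × c) (a × c) ℂ) :
    tensorMap (conjBy K) (LinearMap.id : OpMap c c) X =
      (K ⊗ₖ (1 : Matrix c c ℂ)) * X * (K ⊗ₖ (1 : Matrix c c ℂ))ᴴ := by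
  ext p q
  rw [tensorMap_id_apply]
  simp [conjBy, sandwich_apply, Matrix.mul_apply, Fintype.sum_prod_type, Matrix.one_apply,
    block_apply, apply_ite (starRingEnd ℂ)]

theorem krausMap_apply {ι : Type} [Fintype ι] (K : ι → Matrix b a ℂ) (X : Matrix a a ℂ) :
    krausMap K X = ∑ i, K i * X * (K i)ᴴ := by
  simp [krausMap, conjBy, sandwich_apply]

theorem isCP_krausMap {ι : Type} [Fintype ι] (K : ι → Matrix b a ℂ) : IsCP (krausMap K) := by
  intro k X hX
  have : tensorMap (krausMap K) (LinearMap.id : OpMap (Fin k) (Fin k)) X =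
      ∑ i, tensorMap (conjBy (K i)) (LinearMap.id : OpMap (Fin k) (Fin k)) X := by
    ext p q
    simp only [tensorMap_id_apply, krausMap, LinearMap.sum_apply, Matrix.sum_apply]
  rw [this]
  refine Matrix.posSemidef_sum _ fun i _ => ?_
  rw [tensorMap_conjBy_id]
  exact hX.mul_mul_conjTranspose_same _

theorem isChannel_krausMap {ι : Type} [Fintype ι] (K : ι → Matrix b a ℂ)
    (h : ∑ i, (K i)ᴴ * K i = 1) : IsChannel (krausMap K) := by
  refine ⟨isCP_krausMap K, fun X => ?_⟩
  rw [krausMap_apply, Matrix.trace_sum]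
  have : ∀ i, (K i * X * (K i)ᴴ).trace = ((K i)ᴴ * K i * X).trace := fun i => by
    rw [Matrix.trace_mul_comm, Matrix.mul_assoc]
  simp only [this]
  rw [← Matrix.trace_sum, ← Finset.sum_mul, h, Matrix.one_mul]

theorem conjBy_eq_krausMap (K : Matrix b a ℂ) : conjBy K = krausMap fun _ : Unit => K := by
  simp [krausMap]

theorem isChannel_conjBy {K : Matrix b a ℂ} (h : Kᴴ * K = 1) : IsChannel (conjBy K) := by
  rw [conjBy_eq_krausMap]
  exact isChannel_krausMap _ (by simpa using h)

/-- The Choi operator is the image of an unnormalized maximally entangled projector. The enumeration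
`f` is needed because complete positivity is tested on ancillas `Fin k` only. -/
theorem IsCP.choi_posSemidef {Φ : OpMap a b} (h : IsCP Φ) : (choi Φ).PosSemidef := by
  let f := Fintype.equivFin a
  let v : a × Fin (Fintype.card a) → ℂ := fun p => if f p.1 = p.2 then 1 else 0
  have hv := h _ _ (Matrix.posSemidef_vecMulVec_self_star v)
  have : choi Φ = (tensorMap Φ (LinearMap.id : OpMap (Fin (Fintype.card a)) _)
      (Matrix.vecMulVec v (star v))).submatrix (fun p => (p.1, f p.2)) (fun p => (p.1, f p.2)) := by
    ext p q
    have hb : block (f p.2) (f q.2) (Matrix.vecMulVec v (star v)) =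
        Matrix.single p.2 q.2 1 := by
      ext i j
      simp only [block_apply, Matrix.vecMulVec_apply, v, Matrix.single_apply, Pi.star_apply,
        EmbeddingLike.apply_eq_iff_eq, eq_comm (a := p.2), eq_comm (a := q.2)]
      split_ifs <;> simp_all
    rw [Matrix.submatrix_apply, tensorMap_id_apply, choi_apply]
    simp only [hb]
  rw [this]
  exact hv.submatrix _

/-- In a factorization `B† B` of the Choi operator, the conjugated rows of `B`, reshaped to
matrices, are Kraus operators. -/
theorem isCP_of_choi_posSemidef {Φ : OpMap a b} (h : (choi Φ).PosSemidef) : IsCP Φ := by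
  obtain ⟨B, hB⟩ := exists_conjTranspose_mul_self h
  have : Φ = krausMap fun κ : b × a => Matrix.of fun i m => star (B κ (i, m)) := by
    refine LinearMap.ext fun X => ?_
    ext i j
    rw [apply_eq_sum_choi, krausMap_apply, hB]
    simp only [Matrix.sum_apply, Matrix.mul_apply, Matrix.conjTranspose_apply, Matrix.of_apply,
      star_star, Finset.mul_sum, Finset.sum_mul]
    rw [Finset.sum_comm]
    conv_lhs => enter [2, n]; rw [Finset.sum_comm]
    rw [Finset.sum_comm]
    refine Finset.sum_congr rfl fun κ _ => Finset.sum_congr rfl fun n _ =>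
      Finset.sum_congr rfl fun m _ => ?_
    ring
  rw [this]
  exact isCP_krausMap _

theorem isCP_iff_choi_posSemidef {Φ : OpMap a b} : IsCP Φ ↔ (choi Φ).PosSemidef :=
  ⟨IsCP.choi_posSemidef, isCP_of_choi_posSemidef⟩

theorem block_single (m n : c) (p q : a × c) :
    block m n (Matrix.single p q (1 : ℂ)) =
      (if p.2 = m ∧ q.2 = n then 1 else 0 : ℂ) • Matrix.single p.1 q.1 1 := by
  ext i j
  simp only [block_apply, Matrix.single_apply, Matrix.smul_apply, smul_eq_mul, Prod.ext_iff]
  split_ifs <;> simp_all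

theorem choi_tensorMap (Φ : OpMap a b) (Ψ : OpMap c e) :
    choi (tensorMap Φ Ψ) = (choi Φ ⊗ₖ choi Ψ).submatrix
      (fun p => ((p.1.1, p.2.1), (p.1.2, p.2.2))) (fun p => ((p.1.1, p.2.1), (p.1.2, p.2.2))) := by
  ext p q
  simp only [choi_apply, tensorMap_apply, block_single, map_smul, Matrix.smul_apply, smul_eq_mul,
    ite_and, ite_mul, one_mul, zero_mul, Finset.sum_ite_irrel, Finset.sum_const_zero,
    Finset.sum_ite_eq, Finset.mem_univ, if_true, Matrix.submatrix_apply,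
    Matrix.kroneckerMap_apply]

theorem isChannel_tensorMap {Φ : OpMap a b} {Ψ : OpMap c e} (hΦ : IsChannel Φ)
    (hΨ : IsChannel Ψ) : IsChannel (tensorMap Φ Ψ) := by
  constructor
  · rw [isCP_iff_choi_posSemidef, choi_tensorMap]
    exact (hΦ.1.choi_posSemidef.kronecker hΨ.1.choi_posSemidef).submatrix _
  · intro X
    have h1 : (tensorMap Φ Ψ X).trace = ∑ m, ∑ n, (Φ (block m n X)).trace *
        (Ψ (Matrix.single m n 1)).trace := by
      simp only [Matrix.trace, Matrix.diag_apply, tensorMap_apply, Fintype.sum_prod_type,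
        Finset.sum_mul_sum]
      conv_lhs => enter [2, x]; rw [Finset.sum_comm]; enter [2, m]; rw [Finset.sum_comm]
      rw [Finset.sum_comm]
      refine Finset.sum_congr rfl fun m _ => ?_
      rw [Finset.sum_comm]
    rw [h1]
    simp only [hΦ.2, hΨ.2]
    simp only [Matrix.trace, Matrix.diag_apply, block_apply, Fintype.sum_prod_type,
      Matrix.single_apply]
    rw [Finset.sum_comm]
    simp only [ite_and, mul_ite, mul_one, mul_zero, Finset.sum_ite_eq, Finset.sum_ite_eq',
      Finset.mem_univ, if_true]
    exact Finset.sum_comm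

theorem isChannel_id : IsChannel (LinearMap.id : OpMap a a) := by
  have : (LinearMap.id : OpMap a a) = conjBy 1 := by
    refine LinearMap.ext fun X => ?_
    simp [conjBy, sandwich_apply]
  rw [this]
  exact isChannel_conjBy (by simp)

theorem isNoSignalling_tensorMap {Φ : OpMap a b} {Ψ : OpMap c e} (hΦ : IsChannel Φ)
    (hΨ : IsChannel Ψ) : IsNoSignalling (tensorMap Φ Ψ) :=
  ⟨isChannel_tensorMap hΦ hΨ, 1, fun _ => 1, fun _ => Φ, fun _ => Ψ, fun _ => hΦ, fun _ => hΨ,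
    by simp⟩

/-- With `σ = B† B`, the Choi operator of the reduced map is a sum of congruences of `choi M`, one
for each row of `B` and each basis vector of the traced-out system. -/
theorem isChannel_reduced {M : OpMap (a × c) (b × e)} (hM : IsChannel M) {σ : Matrix c c ℂ}
    (hσ : IsDensity σ) : IsChannel (reduced M σ) := by
  constructor
  · obtain ⟨B, hB⟩ := exists_conjTranspose_mul_self hσ.1
    rw [isCP_iff_choi_posSemidef]
    let V : c → e → Matrix (b × a) ((b × e) × (a × c)) ℂ := fun κ k =>
      Matrix.of fun p q => if p.1 = q.1.1 ∧ k = q.1.2 ∧ p.2 = q.2.1 then star (B κ q.2.2) else 0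
    have : choi (reduced M σ) = ∑ κ, ∑ k, V κ k * choi M * (V κ k)ᴴ := by
      ext ⟨i, m⟩ ⟨j, n⟩
      change ∑ k, M (Matrix.single m n 1 ⊗ₖ σ) (i, k) (j, k) = _
      simp only [Matrix.sum_apply]
      rw [Finset.sum_comm]
      refine Finset.sum_congr rfl fun k _ => ?_
      rw [apply_eq_sum_choi]
      simp only [hB, V, Matrix.mul_apply, Fintype.sum_prod_type, Matrix.of_apply,
        Matrix.conjTranspose_apply, Matrix.kroneckerMap_apply, Matrix.single_apply, ite_and,
        ite_mul, zero_mul, one_mul, mul_ite, mul_zero, Finset.sum_ite_eq, Finset.sum_ite_eq',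
        Finset.mem_univ, if_true, apply_ite star, star_star, star_zero, Finset.sum_const_zero,
        Finset.sum_mul, Finset.mul_sum]
      simp only [Finset.sum_ite_irrel, Finset.sum_const_zero, Finset.sum_ite_eq, Finset.mem_univ,
        if_true]
      rw [Finset.sum_comm]
      conv_lhs => enter [2, n]; rw [Finset.sum_comm]
      rw [Finset.sum_comm]
      refine Finset.sum_congr rfl fun κ _ => Finset.sum_congr rfl fun n _ =>
        Finset.sum_congr rfl fun m _ => ?_
      ring
    rw [this]
    exact Matrix.posSemidef_sum _ fun κ _ => Matrix.posSemidef_sum _ fun k _ =>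
      hM.1.choi_posSemidef.mul_mul_conjTranspose_same _
  · intro X
    have h : (reduced M σ X).trace = (M (X ⊗ₖ σ)).trace := by
      simp only [Matrix.trace, Matrix.diag_apply, Fintype.sum_prod_type]
      rfl
    rw [h, hM.2, Matrix.trace_kronecker, hσ.2, mul_one]

end ChannelTheory

/-! ### The Choi operator of a supermap: positivity and normalization. -/

section Supermaps


variable {a b c e : Type} [Fintype a] [DecidableEq a] [Fintype b] [DecidableEq b]
  [Fintype c] [DecidableEq c] [Fintype e] [DecidableEq e]

/-- The map `ρ ↦ Tr[K ρ] Y`. -/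
def measurePrepare (K : Matrix a a ℂ) (Y : Matrix b b ℂ) : OpMap a b where
  toFun X := (K * X).trace • Y
  map_add' X X' := by rw [Matrix.mul_add, Matrix.trace_add, add_smul]
  map_smul' r X := by simp [smul_smul]

theorem measurePrepare_apply (K : Matrix a a ℂ) (Y : Matrix b b ℂ) (X : Matrix a a ℂ) :
    measurePrepare K Y X = (K * X).trace • Y := rfl

theorem choi_measurePrepare (K : Matrix a a ℂ) (Y : Matrix b b ℂ) :
    choi (measurePrepare K Y) = Y ⊗ₖ K.transpose := by
  ext p q
  simp [choi_apply, measurePrepare_apply, Matrix.trace_mul_single, mul_comm]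

theorem tensorMap_measurePrepare (K : Matrix a a ℂ) (Y : Matrix b b ℂ) (K' : Matrix c c ℂ)
    (Y' : Matrix e e ℂ) : tensorMap (measurePrepare K Y) (measurePrepare K' Y') =
      measurePrepare (K ⊗ₖ K') (Y ⊗ₖ Y') := by
  apply ext_choi
  rw [choi_tensorMap, choi_measurePrepare, choi_measurePrepare, choi_measurePrepare]
  ext p q
  simp only [Matrix.submatrix_apply, Matrix.kroneckerMap_apply, Matrix.transpose_apply]
  ring

variable (a b) in
/-- The completely depolarizing channel. -/
noncomputable def depolarizing : OpMap a b :=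
  measurePrepare 1 ((Fintype.card b : ℂ)⁻¹ • 1)

theorem isChannel_depolarizing [Nonempty b] : IsChannel (depolarizing a b) := by
  constructor
  · rw [isCP_iff_choi_posSemidef, depolarizing, choi_measurePrepare, Matrix.transpose_one]
    refine (Matrix.PosSemidef.one.smul ?_).kronecker Matrix.PosSemidef.one
    exact inv_nonneg.mpr (Nat.cast_nonneg _)
  · intro X
    simp [depolarizing, measurePrepare_apply]

/-- The Choi operator of a linear transformation of maps. -/
def superChoi (S : OpMap a b →ₗ[ℂ] OpMap c e) : Matrix ((b × c) × (a × e)) ((b × c) × (a × e)) ℂ :=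
  Matrix.of fun x y => S (sandwich (Matrix.single x.1.1 x.2.1 1) (Matrix.single y.1.1 y.2.1 1))
    (Matrix.single x.1.2 y.1.2 1) x.2.2 y.2.2

theorem superChoi_apply (S : OpMap a b →ₗ[ℂ] OpMap c e) (x y : (b × c) × (a × e)) :
    superChoi S x y =
      S (sandwich (Matrix.single x.1.1 x.2.1 1) (Matrix.single y.1.1 y.2.1 1))
        (Matrix.single x.1.2 y.1.2 1) x.2.2 y.2.2 := rfl

theorem choi_sandwich_single (i j : b) (m n : a) (p q : b × a) :
    choi (sandwich (Matrix.single i m 1) (Matrix.single j n 1)) p q =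
      if p = (i, m) ∧ q = (j, n) then 1 else 0 := by
  obtain ⟨i', m'⟩ := p
  obtain ⟨j', n'⟩ := q
  simp only [choi_apply, sandwich_apply, Matrix.conjTranspose_single, star_one, Prod.mk.injEq]
  by_cases h1 : m' = m
  · by_cases h2 : n' = n
    · subst h1 h2
      simp [Matrix.single_apply, eq_comm]
    · have : (Matrix.single m' n' (1 : ℂ)) * Matrix.single n j (1 : ℂ) = 0 :=
        Matrix.single_mul_single_of_ne _ _ _ _ h2 _
      rw [Matrix.mul_assoc, this]
      simp [h2]
  · have : (Matrix.single i m (1 : ℂ)) * Matrix.single m' n' (1 : ℂ) = 0 :=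
      Matrix.single_mul_single_of_ne _ _ _ _ (Ne.symm h1) _
    rw [this]
    simp [h1]

theorem eq_sum_choi_smul_sandwich (N : OpMap a b) :
    N = ∑ p, ∑ q, choi N p q • sandwich (Matrix.single p.1 p.2 1) (Matrix.single q.1 q.2 1) := by
  apply ext_choi
  ext p q
  have h : ∀ (f : (b × a) → (b × a) → OpMap a b),
      choi (∑ p, ∑ q, f p q) p q = ∑ p', ∑ q', choi (f p' q') p q := by
    intro f
    simp only [choi_apply, LinearMap.sum_apply, Matrix.sum_apply]
  have h' : ∀ (z : ℂ) (f : OpMap a b), choi (z • f) p q = z * choi f p q := fun z f => rfl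
  simp only [h, h', choi_sandwich_single, ite_and, mul_ite, mul_one, mul_zero, Prod.mk.eta,
    Finset.sum_ite_irrel, Finset.sum_const_zero, Finset.sum_ite_eq, Finset.mem_univ, if_true]

theorem choi_superMap (S : OpMap a b →ₗ[ℂ] OpMap c e) (N : OpMap a b) (k l : c) (i j : e) :
    S N (Matrix.single k l 1) i j = ∑ p : b × a, ∑ q : b × a,
      choi N p q * superChoi S ((p.1, k), (p.2, i)) ((q.1, l), (q.2, j)) := by
  conv_lhs => rw [eq_sum_choi_smul_sandwich N]
  simp only [map_sum, map_smul, LinearMap.sum_apply, LinearMap.smul_apply, Matrix.sum_apply,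
    Matrix.smul_apply, smul_eq_mul, superChoi_apply]

variable {Ai Ao Bi Bo Ci Co : Type}
  [Fintype Ai] [DecidableEq Ai] [Fintype Ao] [DecidableEq Ao]
  [Fintype Bi] [DecidableEq Bi] [Fintype Bo] [DecidableEq Bo]
  [Fintype Ci] [DecidableEq Ci] [Fintype Co] [DecidableEq Co]

/-- The isometry, up to normalization, that prepares a maximally entangled state on two copies of
`b` and sends its input to the second output together with one of the copies. -/
def entangleKraus {n : ℕ} (f : b × a ≃ Fin n) (s : ℂ) : Matrix (b × Fin n) (a × Fin 1) ℂ :=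
  Matrix.of fun p q => if p.2 = f (p.1, q.1) then s else 0

theorem conjBy_entangleKraus_apply {n : ℕ} (f : b × a ≃ Fin n) {s : ℂ} (hs : star s = s)
    (X : Matrix a a ℂ) (σ : Matrix (Fin 1) (Fin 1) ℂ) (i j : b) (κ κ' : b × a) :
    conjBy (entangleKraus f s) (X ⊗ₖ σ) (i, f κ) (j, f κ') =
      if i = κ.1 ∧ j = κ'.1 then s * s * (X κ.2 κ'.2 * σ 0 0) else 0 := by
  obtain ⟨β, α⟩ := κ
  obtain ⟨β', α'⟩ := κ'
  simp only [conjBy, sandwich_apply, Matrix.mul_apply, Fintype.sum_prod_type, entangleKraus,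
    Matrix.of_apply, Matrix.conjTranspose_apply, Finset.univ_unique, Fin.default_eq_zero,
    Finset.sum_singleton, Matrix.kroneckerMap_apply, EmbeddingLike.apply_eq_iff_eq,
    Prod.mk.injEq, apply_ite star, hs, star_zero, ite_and, ite_mul, zero_mul, mul_ite,
    mul_zero, Finset.sum_ite_irrel, Finset.sum_const_zero, Finset.sum_ite_eq, Finset.mem_univ,
    if_true, eq_comm (a := β), eq_comm (a := β')]
  split_ifs
  · ring
  all_goals rfl

theorem isChannel_conjBy_entangleKraus {n : ℕ} [Nonempty b] (f : b × a ≃ Fin n) {s : ℂ}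
    (hs : star s = s) (hs2 : s * s = (Fintype.card b : ℂ)⁻¹) :
    IsChannel (conjBy (entangleKraus f s)) := by
  refine isChannel_conjBy ?_
  have hb : (Fintype.card b : ℂ) ≠ 0 := Nat.cast_ne_zero.mpr Fintype.card_ne_zero
  ext ⟨p, p'⟩ ⟨q, q'⟩
  rw [Matrix.mul_apply, Fintype.sum_prod_type]
  simp only [entangleKraus, Matrix.conjTranspose_apply, Matrix.of_apply, apply_ite star, hs,
    star_zero, ite_mul, zero_mul, Finset.sum_ite_eq', Finset.mem_univ, if_true, mul_ite, mul_zero,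
    EmbeddingLike.apply_eq_iff_eq, Prod.mk.injEq, true_and, hs2]
  by_cases h : p = q
  · subst h
    obtain rfl : p' = q' := Subsingleton.elim _ _
    rw [Matrix.one_apply_eq]
    simp only [if_true, Finset.sum_const, Finset.card_univ, nsmul_eq_mul]
    exact mul_inv_cancel₀ hb
  · rw [Matrix.one_apply_ne (by simp [h])]
    simp [h, Ne.symm h]

/-- A single isometric channel has all elementary maps as components, so the local action on it sees
every entry of `superChoi`. -/
theorem component_conjBy_entangleKraus {n : ℕ} (f : b × a ≃ Fin n) {s : ℂ}
    (hs : star s = s) (κ κ' : b × a) :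
    component (conjBy (entangleKraus f s)) 0 0 (f κ) (f κ') = (s * s) •
      sandwich (Matrix.single κ.1 κ.2 1) (Matrix.single κ'.1 κ'.2 1) := by
  refine LinearMap.ext fun X => ?_
  ext i j
  refine (conjBy_entangleKraus_apply f hs X (Matrix.single 0 0 1) i j κ κ').trans ?_
  rw [LinearMap.smul_apply, Matrix.smul_apply, apply_eq_sum_choi]
  simp only [choi_sandwich_single, Prod.ext_iff, ite_and, mul_ite, mul_one, mul_zero,
    Finset.sum_ite_irrel, Finset.sum_const_zero, Finset.sum_ite_eq, Finset.sum_ite_eq',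
    Finset.mem_univ, if_true, smul_eq_mul, Matrix.single_apply_same]

/-- What remains is half of a maximally entangled state, whatever the input. This makes the
isometric channel admissible in the second clause of `IsSupermap`. -/
theorem reduced_conjBy_entangleKraus {n : ℕ} (f : b × a ≃ Fin n) {s : ℂ}
    (hs : star s = s) (hs2 : s * s = (Fintype.card b : ℂ)⁻¹) {σ : Matrix (Fin 1) (Fin 1) ℂ}
    (hσ : σ.trace = 1) : reduced (conjBy (entangleKraus f s)) σ = depolarizing a b := by
  have hσ1 : σ 0 0 = 1 := by simpa [Matrix.trace] using hσ
  refine LinearMap.ext fun X => ?_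
  ext i j
  change ∑ k, conjBy (entangleKraus f s) (X ⊗ₖ σ) (i, k) (j, k) = _
  rw [← Equiv.sum_comp f, depolarizing, measurePrepare_apply]
  simp only [conjBy_entangleKraus_apply f hs, hσ1, mul_one, Fintype.sum_prod_type, ite_and,
    Finset.sum_ite_irrel, Finset.sum_const_zero, Finset.sum_ite_eq, Finset.mem_univ, if_true]
  rw [← Finset.mul_sum, hs2]
  simp only [Matrix.one_mul, Matrix.smul_apply, smul_eq_mul, Matrix.one_apply, eq_comm (a := j)]
  split_ifs
  · simp only [Matrix.trace, Matrix.diag_apply]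
    ring
  · simp

theorem depolarizing_prod :
    depolarizing (a × c) (b × e) = tensorMap (depolarizing a b) (depolarizing c e) := by
  rw [depolarizing, depolarizing, depolarizing, tensorMap_measurePrepare]
  simp [Matrix.smul_kronecker, Matrix.kronecker_smul, smul_smul, mul_comm]

/-- Up to a positive factor, `superChoi S` is a submatrix of the Choi operator of the channel that
the local action produces from `entangleKraus`. -/
theorem IsSupermap.superChoi_posSemidef [Nonempty Ao] [Nonempty Bo]
    {S : OpMap (Ai × Bi) (Ao × Bo) →ₗ[ℂ] OpMap Ci Co} (hS : IsSupermap S) :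
    (superChoi S).PosSemidef := by
  have hD : (0 : ℝ) < Fintype.card (Ao × Bo) := Nat.cast_pos.mpr Fintype.card_pos
  obtain ⟨f⟩ : Nonempty ((Ao × Bo) × (Ai × Bi) ≃ Fin (Fintype.card ((Ao × Bo) × (Ai × Bi)))) :=
    ⟨Fintype.equivFin _⟩
  obtain ⟨s, hs, hs2⟩ : ∃ s : ℂ, star s = s ∧ s * s = (Fintype.card (Ao × Bo) : ℂ)⁻¹ := by
    refine ⟨((Real.sqrt (Fintype.card (Ao × Bo)))⁻¹ : ℝ), Complex.conj_ofReal _, ?_⟩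
    rw [← Complex.ofReal_mul, ← mul_inv, Real.mul_self_sqrt hD.le, Complex.ofReal_inv,
      Complex.ofReal_natCast]
  have hred : ∀ σ, IsDensity σ → IsNoSignalling (reduced (conjBy (entangleKraus f s)) σ) := by
    intro σ hσ
    rw [reduced_conjBy_entangleKraus f hs hs2 hσ.2, depolarizing_prod]
    exact isNoSignalling_tensorMap isChannel_depolarizing isChannel_depolarizing
  have hP := (hS.2 1 _ _ (isChannel_conjBy_entangleKraus f hs hs2) hred).1.choi_posSemidef
  have key : superChoi S = (Fintype.card (Ao × Bo) : ℂ) •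
      (choi (localAction S (conjBy (entangleKraus f s)))).submatrix
      (fun x => ((x.2.2, f (x.1.1, x.2.1)), (x.1.2, 0)))
      (fun x => ((x.2.2, f (x.1.1, x.2.1)), (x.1.2, 0))) := by
    ext x y
    rw [Matrix.smul_apply, Matrix.submatrix_apply, choi_apply, localAction_apply]
    simp only [Finset.univ_unique, Fin.default_eq_zero, Finset.sum_singleton,
      component_conjBy_entangleKraus f hs, block_single, map_smul, LinearMap.smul_apply,
      Matrix.smul_apply, smul_eq_mul, and_self, if_true, one_mul, hs2]
    rw [mul_inv_cancel_left₀ (by exact_mod_cast hD.ne'), superChoi_apply]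
  rw [key]
  exact (hP.submatrix _).smul (Nat.cast_nonneg _)

/-- The map with two input systems and a trivial second output whose Choi operator is `N`. -/
def slotMap {m : ℕ} (N : Matrix ((b × Fin m) × a) ((b × Fin m) × a) ℂ) :
    OpMap (a × Fin m) (b × Fin 1) where
  toFun X := Matrix.of fun p q => ∑ u, ∑ v, X u v * N ((p.1, u.2), u.1) ((q.1, v.2), v.1)
  map_add' X Y := by
    ext p q
    simp [add_mul, Finset.sum_add_distrib]
  map_smul' r X := by
    ext p q
    simp [Finset.mul_sum, mul_assoc]

theorem slotMap_apply {m : ℕ} (N : Matrix ((b × Fin m) × a) ((b × Fin m) × a) ℂ)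
    (X : Matrix (a × Fin m) (a × Fin m) ℂ) (p q : b × Fin 1) : slotMap N X p q =
      ∑ u, ∑ v, X u v * N ((p.1, u.2), u.1) ((q.1, v.2), v.1) := rfl

theorem choi_slotMap {m : ℕ} (N : Matrix ((b × Fin m) × a) ((b × Fin m) × a) ℂ) :
    choi (slotMap N) = N.submatrix (fun p => ((p.1.1, p.2.2), p.2.1))
      (fun p => ((p.1.1, p.2.2), p.2.1)) := by
  ext p q
  rw [choi_apply, slotMap_apply]
  simp only [Matrix.single_apply, ite_and, ite_mul, one_mul, zero_mul, Finset.sum_ite_irrel,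
    Finset.sum_const_zero, Finset.sum_ite_eq, Finset.mem_univ, if_true, Matrix.submatrix_apply]

theorem isChannel_slotMap {m : ℕ} {N : Matrix ((b × Fin m) × a) ((b × Fin m) × a) ℂ}
    (hN : N.PosSemidef)
    (hN1 : ∀ k l α α', ∑ i, N ((i, k), α) ((i, l), α') = if k = l ∧ α = α' then 1 else 0) :
    IsChannel (slotMap N) := by
  constructor
  · rw [isCP_iff_choi_posSemidef, choi_slotMap]
    exact hN.submatrix _
  · intro X
    have : (slotMap N X).trace = ∑ u, ∑ v, X u v * ∑ i, N ((i, u.2), u.1) ((i, v.2), v.1) := by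
      simp only [Matrix.trace, Matrix.diag_apply, slotMap_apply, Finset.mul_sum,
        Fintype.sum_prod_type (α₂ := Fin 1), Finset.univ_unique, Finset.sum_singleton]
      rw [Finset.sum_comm]
      refine Finset.sum_congr rfl fun u _ => ?_
      rw [Finset.sum_comm]
    rw [this]
    simp only [hN1, Matrix.trace, Matrix.diag_apply]
    refine Finset.sum_congr rfl fun u _ => ?_
    rw [Finset.sum_eq_single u]
    · simp
    · intro v _ hv
      rw [if_neg, mul_zero]
      rintro ⟨h1, h2⟩
      exact hv (Prod.ext h2.symm h1.symm)
    · simp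

theorem sum_prod_rearrange (f : (b × c) × a → ℂ) :
    ∑ u, f u = ∑ k, ∑ p : b × a, f ((p.1, k), p.2) := by
  simp only [Fintype.sum_prod_type]
  exact Finset.sum_comm

/-- Normalization of the Choi operator of a supermap. -/
theorem IsSupermap.sum_superChoi {m : ℕ}
    {S : OpMap (Ai × Bi) (Ao × Bo) →ₗ[ℂ] OpMap (Fin m) Co} (hS : IsSupermap S)
    {N : Matrix (((Ao × Bo) × Fin m) × (Ai × Bi)) (((Ao × Bo) × Fin m) × (Ai × Bi)) ℂ}
    (hN : IsChannel (slotMap N))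
    (hN' : ∀ σ, IsDensity σ → IsNoSignalling (reduced (slotMap N) σ)) :
    ∑ u, ∑ v, ∑ i, N u v * superChoi S (u.1, (u.2, i)) (v.1, (v.2, i)) = m := by
  have h := (hS.2 m 1 (slotMap N) hN hN').2
  -- The ancilla `D_i` is a second copy of `C_i`, and the image of the maximally entangled vector on
  -- the two is traced. Its blocks are matrix units, so the block `(k, l)` of `N` meets the input
  -- `|k⟩⟨l|`; trace preservation gives the value `m`.
  let v : Fin m × Fin m → ℂ := fun p => if p.1 = p.2 then 1 else 0
  specialize h (Matrix.vecMulVec v (star v))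
  have hb : ∀ k l, block k l (Matrix.vecMulVec v (star v)) = Matrix.single k l 1 := by
    intro k l
    ext i j
    simp only [block_apply, Matrix.vecMulVec_apply, v, Matrix.single_apply, Pi.star_apply,
      eq_comm (a := k), eq_comm (a := l)]
    split_ifs <;> simp_all
  have hc : ∀ k l p q, choi (component (slotMap N) k l 0 0) p q =
      N ((p.1, k), p.2) ((q.1, l), q.2) := by
    intro k l p q
    have := congrFun (congrFun (choi_slotMap N) ((p.1, 0), (p.2, k))) ((q.1, 0), (q.2, l))
    rw [choi_apply, Matrix.submatrix_apply] at this
    rw [← this, choi_apply]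
    change slotMap N _ _ _ = _
    simp [Matrix.single_kronecker_single]
  have ht : (Matrix.vecMulVec v (star v)).trace = m := by
    simp [Matrix.trace, Matrix.vecMulVec_apply, v, Fintype.sum_prod_type]
  rw [ht] at h
  rw [← h, Matrix.trace]
  simp only [Matrix.diag_apply, localAction_apply, hb, choi_superMap]
  have h1 : ∀ i : Co × Fin 1, i.2 = 0 := fun i => Subsingleton.elim _ _
  have h3 : ∀ F : Co → ℂ, ∑ i : Co × Fin 1, F i.1 = ∑ i, F i := by
    intro F
    simp [Fintype.sum_prod_type]
  have h2 : ∀ F : ((Ao × Bo) × Fin m) × (Ai × Bi) → ((Ao × Bo) × Fin m) × (Ai × Bi) → Co → ℂ,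
      ∑ u, ∑ v, ∑ i, F u v i = ∑ i, ∑ u, ∑ v, F u v i := by
    intro F
    rw [Finset.sum_comm (γ := Co)]
    refine Finset.sum_congr rfl fun u _ => ?_
    rw [Finset.sum_comm]
  simp only [h1, hc]
  rw [h2, h3 (fun i => ∑ k, ∑ l, ∑ p : (Ao × Bo) × (Ai × Bi), ∑ q : (Ao × Bo) × (Ai × Bi),
    N ((p.1, k), p.2) ((q.1, l), q.2) * superChoi S ((p.1, k), (p.2, i)) ((q.1, l), (q.2, i)))]
  refine Finset.sum_congr rfl fun i _ => ?_
  rw [sum_prod_rearrange]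
  refine Finset.sum_congr rfl fun k _ => ?_
  symm
  rw [Finset.sum_comm]
  exact Finset.sum_congr rfl fun p _ => 
    (sum_prod_rearrange fun v => N ((p.1, k), p.2) v *
      superChoi S ((p.1, k), (p.2, i)) (v.1, (v.2, i))).symm

end Supermaps

/-! ### The linear span of products of channels. -/

section NoSignalling


variable {a b c e : Type} [Fintype a] [DecidableEq a] [Fintype b] [DecidableEq b]
  [Fintype c] [DecidableEq c] [Fintype e] [DecidableEq e]

open scoped Matrix.Norms.L2Operator MatrixOrder in
theorem exists_posSemidef_add_smul_one {H : Matrix a a ℂ} (hH : H.IsHermitian) :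
    ∃ s : ℝ, 0 ≤ s ∧ ∀ r : ℝ, s ≤ r → (H + (r : ℂ) • 1).PosSemidef := by
  refine ⟨‖H‖, norm_nonneg _, fun r hr => ?_⟩
  have h := (show IsSelfAdjoint H from hH).neg_algebraMap_norm_le_self
  rw [Matrix.le_iff, sub_neg_eq_add] at h
  have h2 : ((((r - ‖H‖ : ℝ) : ℂ)) • (1 : Matrix a a ℂ)).PosSemidef :=
    Matrix.PosSemidef.one.smul (by exact_mod_cast sub_nonneg.mpr hr)
  have e : H + (r : ℂ) • 1 =
      H + algebraMap ℝ (Matrix a a ℂ) ‖H‖ + ((r - ‖H‖ : ℝ) : ℂ) • 1 := by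
    rw [Algebra.algebraMap_eq_smul_one, add_assoc]
    congr 1
    ext i j
    simp only [Matrix.add_apply, Matrix.smul_apply, Complex.real_smul, smul_eq_mul]
    push_cast
    ring
  rw [e]
  exact h.add h2

theorem choi_add (Φ Ψ : OpMap a b) : choi (Φ + Ψ) = choi Φ + choi Ψ := rfl

theorem choi_smul (z : ℂ) (Φ : OpMap a b) : choi (z • Φ) = z • choi Φ := rfl

/-- A large multiple of the depolarizing channel makes the Choi operator positive. Since `Φ`
rescales all traces by the same factor, the sum is a multiple of a channel. -/
theorem mem_span_isChannel [Nonempty b] {Φ : OpMap a b} (hΦ : (choi Φ).IsHermitian) {t : ℝ}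
    (ht : ∀ X, (Φ X).trace = t * X.trace) : Φ ∈ Submodule.span ℂ {Ψ : OpMap a b | IsChannel Ψ} := by
  obtain ⟨s, hs, h⟩ := exists_posSemidef_add_smul_one hΦ
  have hb : (0 : ℝ) < Fintype.card b := Nat.cast_pos.mpr Fintype.card_pos
  have hb1 : (Fintype.card b : ℂ) ≠ 0 := by exact_mod_cast hb.ne'
  -- The part `s` gives positivity, and `|t| + 1` keeps the trace factor `t + u` positive. The
  -- factor `Fintype.card b` in `u` cancels the normalization of the depolarizing Choi operator.
  let r : ℝ := s + |t| + 1
  let u : ℝ := r * Fintype.card b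
  have hr : s ≤ r := by simp only [r]; linarith [abs_nonneg t]
  have hu : 0 < t + u := by
    have h1 : (1 : ℝ) ≤ Fintype.card b := by exact_mod_cast Fintype.card_pos (α := b)
    have h2 : r ≤ u := le_mul_of_one_le_right (hs.trans hr) h1
    have h3 := neg_abs_le t
    simp only [r] at h2
    linarith
  have hu' : ((t + u : ℝ) : ℂ) ≠ 0 := by exact_mod_cast hu.ne'
  let Ψ : OpMap a b := ((t + u : ℝ) : ℂ)⁻¹ • (Φ + (u : ℂ) • depolarizing a b)
  have hΨ : IsChannel Ψ := by
    constructor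
    · rw [isCP_iff_choi_posSemidef, choi_smul, choi_add, choi_smul, depolarizing,
        choi_measurePrepare]
      refine Matrix.PosSemidef.smul ?_ (by rw [← Complex.ofReal_inv]; exact_mod_cast (inv_pos.mpr hu).le)
      convert h r hr using 2
      rw [Matrix.transpose_one, Matrix.smul_kronecker, Matrix.one_kronecker_one, smul_smul]
      congr 1
      simp only [u]
      push_cast
      field_simp
    · intro X
      simp only [Ψ, LinearMap.smul_apply, LinearMap.add_apply, Matrix.trace_smul, Matrix.trace_add,
        ht, isChannel_depolarizing.2, smul_eq_mul]
      rw [← add_mul, ← Complex.ofReal_add, inv_mul_cancel_left₀ hu']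
  have : Φ = ((t + u : ℝ) : ℂ) • Ψ - (u : ℂ) • depolarizing a b := by
    simp only [Ψ]
    rw [smul_inv_smul₀ hu', add_sub_cancel_right]
  rw [this]
  exact Submodule.sub_mem _ (Submodule.smul_mem _ _ (Submodule.subset_span hΨ))
    (Submodule.smul_mem _ _ (Submodule.subset_span isChannel_depolarizing))

theorem isHermitian_choi_measurePrepare {K : Matrix a a ℂ} {Y : Matrix b b ℂ}
    (hK : K.IsHermitian) (hY : Y.IsHermitian) : (choi (measurePrepare K Y)).IsHermitian := by
  rw [choi_measurePrepare]
  rw [Matrix.IsHermitian, Matrix.conjTranspose_kronecker, hY.eq, hK.transpose.eq]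

theorem measurePrepare_add_right (K : Matrix a a ℂ) (Y Y' : Matrix b b ℂ) :
    measurePrepare K (Y + Y') = measurePrepare K Y + measurePrepare K Y' :=
  LinearMap.ext fun X => by simp [measurePrepare_apply]

theorem measurePrepare_smul_right (K : Matrix a a ℂ) (z : ℂ) (Y : Matrix b b ℂ) :
    measurePrepare K (z • Y) = z • measurePrepare K Y :=
  LinearMap.ext fun X => by
    rw [LinearMap.smul_apply, measurePrepare_apply, measurePrepare_apply, smul_comm]

theorem measurePrepare_add_left (K K' : Matrix a a ℂ) (Y : Matrix b b ℂ) :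
    measurePrepare (K + K') Y = measurePrepare K Y + measurePrepare K' Y :=
  LinearMap.ext fun X => by
    simp [measurePrepare_apply, Matrix.add_mul, Matrix.trace_add, add_smul]

theorem measurePrepare_smul_left (K : Matrix a a ℂ) (z : ℂ) (Y : Matrix b b ℂ) :
    measurePrepare (z • K) Y = z • measurePrepare K Y :=
  LinearMap.ext fun X => by simp [measurePrepare_apply, smul_smul]

theorem eq_hermitian_add_I_smul (Y : Matrix a a ℂ) : ∃ H H' : Matrix a a ℂ,
    H.IsHermitian ∧ H'.IsHermitian ∧ Y = H + Complex.I • H' ∧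
      (Y.trace = 0 → H.trace = 0 ∧ H'.trace = 0) := by
  refine ⟨(2 : ℂ)⁻¹ • (Y + Yᴴ), (2 * Complex.I)⁻¹ • (Y - Yᴴ), ?_, ?_, ?_, ?_⟩
  · simp [Matrix.IsHermitian, Matrix.conjTranspose_smul, add_comm]
  · simp only [Matrix.IsHermitian, Matrix.conjTranspose_smul, Matrix.conjTranspose_sub,
      Matrix.conjTranspose_conjTranspose]
    rw [← neg_sub Y Yᴴ, smul_neg, ← neg_smul]
    congr 1
    simp
  · rw [smul_smul, smul_add, smul_sub]
    have : Complex.I * (2 * Complex.I)⁻¹ = (2 : ℂ)⁻¹ := by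
      field_simp
    rw [this, add_add_sub_cancel, ← add_smul]
    norm_num
  · intro h
    simp [Matrix.trace_add, Matrix.trace_sub, Matrix.trace_conjTranspose, h]

/-- The output trace is `Tr[K X] Tr Y`. It is proportional to `Tr X` in either case: if `K = 1`, or
with factor zero if `Y` is traceless. -/
theorem measurePrepare_mem_span_of_isHermitian [Nonempty b] {K : Matrix a a ℂ} {Y : Matrix b b ℂ}
    (hK : K.IsHermitian) (hY : Y.IsHermitian) (h : K = 1 ∨ Y.trace = 0) :
    measurePrepare K Y ∈ Submodule.span ℂ {Ψ : OpMap a b | IsChannel Ψ} := by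
  refine mem_span_isChannel (isHermitian_choi_measurePrepare hK hY) (t := Y.trace.re) fun X => ?_
  have hre : (Y.trace.re : ℂ) = Y.trace := by
    rw [← Complex.conj_eq_iff_re]
    conv_rhs => rw [← hY.eq]
    rw [Matrix.trace_conjTranspose]
    rfl
  rw [hre, measurePrepare_apply, Matrix.trace_smul, smul_eq_mul]
  rcases h with rfl | h
  · rw [Matrix.one_mul, mul_comm]
  · rw [h, mul_zero, zero_mul]

theorem measurePrepare_one_mem_span [Nonempty b] (Y : Matrix b b ℂ) :
    measurePrepare 1 Y ∈ Submodule.span ℂ {Ψ : OpMap a b | IsChannel Ψ} := by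
  obtain ⟨H, H', hH, hH', rfl, -⟩ := eq_hermitian_add_I_smul Y
  rw [measurePrepare_add_right, measurePrepare_smul_right]
  exact Submodule.add_mem _
    (measurePrepare_mem_span_of_isHermitian Matrix.isHermitian_one hH (Or.inl rfl))
    (Submodule.smul_mem _ _
      (measurePrepare_mem_span_of_isHermitian Matrix.isHermitian_one hH' (Or.inl rfl)))

theorem measurePrepare_mem_span [Nonempty b] (K : Matrix a a ℂ) {Y : Matrix b b ℂ}
    (hY : Y.trace = 0) :
    measurePrepare K Y ∈ Submodule.span ℂ {Ψ : OpMap a b | IsChannel Ψ} := by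
  obtain ⟨H, H', hH, hH', rfl, h⟩ := eq_hermitian_add_I_smul Y
  obtain ⟨G, G', hG, hG', rfl, -⟩ := eq_hermitian_add_I_smul K
  obtain ⟨h, h'⟩ := h hY
  rw [measurePrepare_add_right, measurePrepare_smul_right, measurePrepare_add_left,
    measurePrepare_add_left, measurePrepare_smul_left, measurePrepare_smul_left]
  refine Submodule.add_mem _ (Submodule.add_mem _ ?_ (Submodule.smul_mem _ _ ?_))
    (Submodule.smul_mem _ _ (Submodule.add_mem _ ?_ (Submodule.smul_mem _ _ ?_)))
  · exact measurePrepare_mem_span_of_isHermitian hG hH (Or.inr h)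
  · exact measurePrepare_mem_span_of_isHermitian hG' hH (Or.inr h)
  · exact measurePrepare_mem_span_of_isHermitian hG hH' (Or.inr h')
  · exact measurePrepare_mem_span_of_isHermitian hG' hH' (Or.inr h')

variable (a b c e) in
/-- The complex span of the products of channels. -/
def productSpan : Submodule ℂ (OpMap (a × c) (b × e)) :=
  Submodule.span ℂ {T | ∃ (Φ : OpMap a b) (Ψ : OpMap c e), IsChannel Φ ∧ IsChannel Ψ ∧
    T = tensorMap Φ Ψ}

theorem tensorMap_mem_productSpan {Φ : OpMap a b} {Ψ : OpMap c e}
    (hΦ : Φ ∈ Submodule.span ℂ {Ψ : OpMap a b | IsChannel Ψ})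
    (hΨ : Ψ ∈ Submodule.span ℂ {Ψ : OpMap c e | IsChannel Ψ}) :
    tensorMap Φ Ψ ∈ productSpan a b c e := by
  induction hΦ using Submodule.span_induction with
  | zero =>
    have : tensorMap (0 : OpMap a b) Ψ = 0 := by
      refine LinearMap.ext fun X => ?_
      ext p q
      simp [tensorMap_apply]
    rw [this]
    exact Submodule.zero_mem _
  | add x y _ _ hx hy =>
    have : tensorMap (x + y) Ψ = tensorMap x Ψ + tensorMap y Ψ := by
      refine LinearMap.ext fun X => ?_
      ext p q
      simp [tensorMap_apply, add_mul, Finset.sum_add_distrib]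
    rw [this]
    exact Submodule.add_mem _ hx hy
  | smul z x _ hx =>
    have : tensorMap (z • x) Ψ = z • tensorMap x Ψ := by
      refine LinearMap.ext fun X => ?_
      ext p q
      simp [tensorMap_apply, Finset.mul_sum, mul_assoc]
    rw [this]
    exact Submodule.smul_mem _ _ hx
  | mem Φ hΦ =>
    induction hΨ using Submodule.span_induction with
    | zero =>
      have : tensorMap Φ (0 : OpMap c e) = 0 := by
        refine LinearMap.ext fun X => ?_
        ext p q
        simp [tensorMap_apply]
      rw [this]
      exact Submodule.zero_mem _
    | add x y _ _ hx hy =>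
      have : tensorMap Φ (x + y) = tensorMap Φ x + tensorMap Φ y := by
        refine LinearMap.ext fun X => ?_
        ext p q
        simp [tensorMap_apply, mul_add, Finset.sum_add_distrib]
      rw [this]
      exact Submodule.add_mem _ hx hy
    | smul z x _ hx =>
      have : tensorMap Φ (z • x) = z • tensorMap Φ x := by
        refine LinearMap.ext fun X => ?_
        ext p q
        simp [tensorMap_apply, Finset.mul_sum, mul_left_comm]
      rw [this]
      exact Submodule.smul_mem _ _ hx
    | mem Ψ hΨ => exact Submodule.subset_span ⟨Φ, Ψ, hΦ, hΨ, rfl⟩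

/-- Choi operators of channels are Hermitian, so averaging a complex expansion with its adjoint
replaces each coefficient by its real part. -/
theorem isNoSignalling_of_mem_productSpan {N : OpMap (a × c) (b × e)} (hN : IsChannel N)
    (h : N ∈ productSpan a b c e) : IsNoSignalling N := by
  refine ⟨hN, ?_⟩
  obtain ⟨r, z, g, hg⟩ := Submodule.mem_span_set'.mp h
  choose A B hA hB hAB using fun j => (g j).2
  refine ⟨r, fun j => (z j).re, A, B, hA, hB, ?_⟩
  apply ext_choi
  have hsum : ∀ w : Fin r → ℂ, choi (∑ j, w j • tensorMap (A j) (B j)) =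
      ∑ j, w j • choi (tensorMap (A j) (B j)) := by
    intro w
    ext p q
    simp only [choi_apply, LinearMap.sum_apply, LinearMap.smul_apply, Matrix.sum_apply,
      Matrix.smul_apply]
  have h1 : choi N = ∑ j, z j • choi (tensorMap (A j) (B j)) := by
    rw [← hsum, ← hg]
    simp only [hAB]
  have h2 : choi N = ∑ j, star (z j) • choi (tensorMap (A j) (B j)) := by
    have := hN.1.choi_posSemidef.isHermitian.eq
    rw [← this, h1, Matrix.conjTranspose_sum]
    refine Finset.sum_congr rfl fun j _ => ?_
    rw [Matrix.conjTranspose_smul,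
      (isChannel_tensorMap (hA j) (hB j)).1.choi_posSemidef.isHermitian.eq]
  have h3 : choi N = (2 : ℂ)⁻¹ • (choi N + choi N) := by
    rw [← two_smul ℂ, smul_smul]
    norm_num
  rw [h3, hsum]
  conv_lhs => enter [2, 1]; rw [h1]
  rw [h2, ← Finset.sum_add_distrib, Finset.smul_sum]
  refine Finset.sum_congr rfl fun j _ => ?_
  rw [← add_smul, smul_smul]
  congr 1
  have := Complex.add_conj (z j)
  rw [show star (z j) = (starRingEnd ℂ) (z j) from rfl, this]
  push_cast
  ring

theorem measurePrepare_sum_right {ι : Type} [Fintype ι] (K : Matrix a a ℂ)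
    (Y : ι → Matrix b b ℂ) : measurePrepare K (∑ i, Y i) = ∑ i, measurePrepare K (Y i) :=
  LinearMap.ext fun X => by simp [measurePrepare_apply, Finset.smul_sum]

theorem measurePrepare_sum_left {ι : Type} [Fintype ι] (K : ι → Matrix a a ℂ)
    (Y : Matrix b b ℂ) : measurePrepare (∑ i, K i) Y = ∑ i, measurePrepare (K i) Y :=
  LinearMap.ext fun X => by
    simp [measurePrepare_apply, Finset.sum_smul, Finset.sum_mul, Matrix.trace_sum]

theorem measurePrepare_one_mem_productSpan [Nonempty b] [Nonempty e]
    (Y : Matrix (b × e) (b × e) ℂ) : measurePrepare 1 Y ∈ productSpan a b c e := by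
  rw [Matrix.matrix_eq_sum_single Y]
  simp only [measurePrepare_sum_right]
  refine Submodule.sum_mem _ fun p _ => Submodule.sum_mem _ fun q _ => ?_
  have : Matrix.single p q (Y p q) =
      Y p q • (Matrix.single p.1 q.1 (1 : ℂ) ⊗ₖ Matrix.single p.2 q.2 (1 : ℂ)) := by
    rw [Matrix.single_kronecker_single, Matrix.smul_single, smul_eq_mul, mul_one, mul_one]
  rw [this, measurePrepare_smul_right, ← Matrix.one_kronecker_one, ← tensorMap_measurePrepare]
  exact Submodule.smul_mem _ _ (tensorMap_mem_productSpan (measurePrepare_one_mem_span _)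
    (measurePrepare_one_mem_span _))

variable (a) in
/-- The operator that exchanges two copies of `ℂ^a`. -/
def swapOp : Matrix (a × a) (a × a) ℂ :=
  Matrix.of fun p q => if p.1 = q.2 ∧ p.2 = q.1 then 1 else 0

theorem swapOp_eq_sum : swapOp a =
    ∑ i, ∑ j, Matrix.single i j (1 : ℂ) ⊗ₖ Matrix.single j i (1 : ℂ) := by
  ext p q
  simp only [swapOp, Matrix.of_apply, Matrix.sum_apply, Matrix.kroneckerMap_apply,
    Matrix.single_apply, ite_and, mul_ite, mul_one, mul_zero, ite_mul, one_mul, zero_mul,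
    Finset.sum_ite_irrel, Finset.sum_const_zero, Finset.sum_ite_eq, Finset.sum_ite_eq',
    Finset.mem_univ, if_true]
  split_ifs <;> simp_all

/-- The point of this form is that every tensor factor on the right is traceless. -/
theorem swapOp_sub_eq_sum [Nonempty a] : swapOp a - (Fintype.card a : ℂ)⁻¹ • 1 =
    ∑ i : a, ∑ j : a,
      (Matrix.single i j (1 : ℂ) - ((if i = j then 1 else 0) * (Fintype.card a : ℂ)⁻¹) • 1) ⊗ₖ
        (Matrix.single j i (1 : ℂ) - ((if i = j then 1 else 0) * (Fintype.card a : ℂ)⁻¹) • 1) := by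
  have hd : (Fintype.card a : ℂ) ≠ 0 := Nat.cast_ne_zero.mpr Fintype.card_ne_zero
  rw [swapOp_eq_sum]
  ext p q
  simp only [Matrix.sub_apply, Matrix.sum_apply, Matrix.kroneckerMap_apply, Matrix.smul_apply,
    smul_eq_mul, sub_mul, mul_sub, Finset.sum_sub_distrib, ite_mul, mul_ite, one_mul, zero_mul,
    mul_zero, mul_one, Finset.sum_ite_eq, Finset.mem_univ, if_true]
  have h1 : ∀ x y : a, ∑ i, Matrix.single i i (1 : ℂ) x y = if x = y then 1 else 0 := by
    intro x y
    simp only [Matrix.single_apply, ite_and, Finset.sum_ite_eq', Finset.mem_univ, if_true]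
  have h2 : (1 : Matrix (a × a) (a × a) ℂ) p q =
      (1 : Matrix a a ℂ) p.1 q.1 * (1 : Matrix a a ℂ) p.2 q.2 := by
    rw [← Matrix.one_kronecker_one, Matrix.kroneckerMap_apply]
  simp only [← Finset.sum_mul, ← Finset.mul_sum, h1, h2, Finset.sum_const, Finset.card_univ,
    nsmul_eq_mul]
  simp only [Matrix.one_apply]
  field_simp
  ring

/-- Preparing a traceless operator puts a local map in the span of channels whatever it measures.
Thus the swap on the inputs may be correlated with the traceless part of the swap on the outputs. -/
theorem measurePrepare_swapOp_mem_productSpan [Nonempty a] :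
    measurePrepare (swapOp a) (swapOp a - (Fintype.card a : ℂ)⁻¹ • 1) ∈ productSpan a a a a := by
  have hd : (Fintype.card a : ℂ) ≠ 0 := Nat.cast_ne_zero.mpr Fintype.card_ne_zero
  rw [swapOp_sub_eq_sum]
  conv in (measurePrepare (swapOp a) _) => rw [swapOp_eq_sum]
  simp only [measurePrepare_sum_right, measurePrepare_sum_left]
  refine Submodule.sum_mem _ fun i _ => Submodule.sum_mem _ fun j _ =>
    Submodule.sum_mem _ fun k _ => Submodule.sum_mem _ fun l _ => ?_
  rw [← tensorMap_measurePrepare]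
  refine tensorMap_mem_productSpan (measurePrepare_mem_span _ ?_) (measurePrepare_mem_span _ ?_)
  · by_cases h : i = j
    · subst h
      simp [Matrix.trace_sub, hd]
    · simp [Matrix.trace_sub, h, Matrix.trace_single_eq_of_ne]
  · by_cases h : i = j
    · subst h
      simp [Matrix.trace_sub, hd]
    · simp [Matrix.trace_sub, h, Matrix.trace_single_eq_of_ne, Ne.symm h]

end NoSignalling

/-! ### Symmetric, antisymmetric and trace parts of three copies. -/

section TripleAlgebra


variable (a : Type) [Fintype a] [DecidableEq a]

/-- The exchange of the first two of three copies of `ℂ^a`. -/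
def swap₁₂ : Matrix ((a × a) × a) ((a × a) × a) ℂ :=
  swapOp a ⊗ₖ 1

/-- The embedding `v ↦ ∑ m, |m⟩ ⊗ v ⊗ |m⟩`. -/
def pairEmb : Matrix ((a × a) × a) a ℂ :=
  Matrix.of fun p m => if p.1.1 = p.2 ∧ p.1.2 = m then 1 else 0

/-- The projection on the symmetric (`ε = 1`) or antisymmetric (`ε = -1`) part in the first two
of three copies of `ℂ^a`. -/
noncomputable def symProj (ε : ℂ) : Matrix ((a × a) × a) ((a × a) × a) ℂ :=
  (2 : ℂ)⁻¹ • (1 + ε • swap₁₂ a)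

/-- The (anti)symmetrized embedding of `ℂ^a` into three copies. -/
noncomputable def symEmb (ε : ℂ) : Matrix ((a × a) × a) a ℂ :=
  symProj a ε * pairEmb a

/-- The projection on the range of `symEmb`. -/
noncomputable def defProj (ε : ℂ) : Matrix ((a × a) × a) ((a × a) × a) ℂ :=
  (2 / (Fintype.card a + ε)) • (symEmb a ε * (symEmb a ε)ᵀ)

/-- The projection on the traceless (anti)symmetric tensors. -/
noncomputable def tracelessProj (ε : ℂ) : Matrix ((a × a) × a) ((a × a) × a) ℂ :=
  symProj a ε - defProj a ε

variable {a}

theorem swapOp_apply (p q : a × a) : swapOp a p q = if p.1 = q.2 ∧ p.2 = q.1 then 1 else 0 := rfl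

theorem swapOp_mul_apply {n : Type} (X : Matrix (a × a) n ℂ) (p : a × a) (q : n) :
    (swapOp a * X) p q = X (p.2, p.1) q := by
  simp [Matrix.mul_apply, swapOp_apply, Fintype.sum_prod_type, ite_and]

theorem swapOp_mul_self : swapOp a * swapOp a = 1 := by
  ext p q
  rw [swapOp_mul_apply, swapOp_apply, Matrix.one_apply]
  simp only [Prod.ext_iff, and_comm]

theorem transpose_swapOp : (swapOp a)ᵀ = swapOp a := by
  ext p q
  simp only [Matrix.transpose_apply, swapOp_apply, and_comm, eq_comm]

theorem swap₁₂_mul_self : swap₁₂ a * swap₁₂ a = 1 := by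
  rw [swap₁₂, ← Matrix.mul_kronecker_mul, swapOp_mul_self, Matrix.one_mul,
    Matrix.one_kronecker_one]

theorem transpose_swap₁₂ : (swap₁₂ a)ᵀ = swap₁₂ a := by
  rw [swap₁₂, ← Matrix.kroneckerMap_transpose, transpose_swapOp, Matrix.transpose_one]

theorem swap₁₂_apply (p q : (a × a) × a) : swap₁₂ a p q =
    if p = ((q.1.2, q.1.1), q.2) then 1 else 0 := by
  simp only [swap₁₂, Matrix.kroneckerMap_apply, swapOp_apply, Matrix.one_apply, Prod.ext_iff]
  split_ifs <;> simp_all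

theorem swap₁₂_mul_apply {n : Type} (X : Matrix ((a × a) × a) n ℂ) (p : (a × a) × a) (q : n) :
    (swap₁₂ a * X) p q = X ((p.1.2, p.1.1), p.2) q := by
  rw [← transpose_swap₁₂]
  simp [Matrix.mul_apply, swap₁₂_apply]

theorem mul_swap₁₂_apply {n : Type} (X : Matrix n ((a × a) × a) ℂ) (q : n) (p : (a × a) × a) :
    (X * swap₁₂ a) q p = X q ((p.1.2, p.1.1), p.2) := by
  simp [Matrix.mul_apply, swap₁₂_apply]

theorem transpose_pairEmb_mul_pairEmb :
    (pairEmb a)ᵀ * pairEmb a = (Fintype.card a : ℂ) • 1 := by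
  ext m n
  simp only [Matrix.mul_apply, pairEmb, Fintype.sum_prod_type, ite_and, Matrix.one_apply,
    Matrix.transpose_apply, Matrix.of_apply, mul_ite, mul_one, mul_zero, Finset.sum_ite_irrel,
    Finset.sum_const_zero, Finset.sum_ite_eq, Finset.sum_ite_eq', Finset.mem_univ, if_true,
    Finset.sum_const, Finset.card_univ, nsmul_eq_mul, Matrix.smul_apply, smul_eq_mul,
    eq_comm (a := m)]
  split_ifs <;> simp

theorem transpose_pairEmb_mul_swap₁₂_mul_pairEmb :
    (pairEmb a)ᵀ * (swap₁₂ a * pairEmb a) = 1 := by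
  ext m n
  rw [Matrix.mul_apply]
  simp only [swap₁₂_mul_apply]
  simp [pairEmb, Fintype.sum_prod_type, ite_and, Matrix.one_apply, eq_comm]

theorem transpose_symProj (ε : ℂ) : (symProj a ε)ᵀ = symProj a ε := by
  simp [symProj, transpose_swap₁₂]

theorem symProj_mul_self {ε : ℂ} (hε : ε * ε = 1) : symProj a ε * symProj a ε = symProj a ε := by
  simp only [symProj, Matrix.smul_mul, Matrix.mul_smul, Matrix.mul_add, Matrix.add_mul,
    swap₁₂_mul_self, Matrix.mul_one, Matrix.one_mul]
  ext p q
  simp only [Matrix.add_apply, Matrix.smul_apply, smul_eq_mul, Matrix.zero_apply]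
  linear_combination (1 / 4 : ℂ) * (1 : Matrix ((a × a) × a) ((a × a) × a) ℂ) p q * hε

theorem symProj_mul_symProj_neg {ε : ℂ} (hε : ε * ε = 1) : symProj a ε * symProj a (-ε) = 0 := by
  simp only [symProj, Matrix.smul_mul, Matrix.mul_smul, Matrix.mul_add, Matrix.add_mul,
    swap₁₂_mul_self, Matrix.mul_one, Matrix.one_mul]
  ext p q
  simp only [Matrix.add_apply, Matrix.smul_apply, smul_eq_mul, Matrix.zero_apply]
  linear_combination (-1 / 4 : ℂ) * (1 : Matrix ((a × a) × a) ((a × a) × a) ℂ) p q * hε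

theorem symProj_neg_mul_symProj {ε : ℂ} (hε : ε * ε = 1) : symProj a (-ε) * symProj a ε = 0 := by
  have := symProj_mul_symProj_neg (a := a) (ε := -ε) (by simpa using hε)
  rwa [neg_neg] at this

theorem symProj_mul_symEmb {ε : ℂ} (hε : ε * ε = 1) : symProj a ε * symEmb a ε = symEmb a ε := by
  rw [symEmb, ← Matrix.mul_assoc, symProj_mul_self hε]

theorem symProj_neg_mul_symEmb {ε : ℂ} (hε : ε * ε = 1) : symProj a (-ε) * symEmb a ε = 0 := by
  rw [symEmb, ← Matrix.mul_assoc, symProj_neg_mul_symProj hε, Matrix.zero_mul]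

/-- Thus `symEmb` is a multiple of an isometry, which explains the factor `2 / (d + ε)` in
`defProj`. -/
theorem transpose_symEmb_mul_symEmb {ε : ℂ} (hε : ε * ε = 1) :
    (symEmb a ε)ᵀ * symEmb a ε = ((Fintype.card a + ε) / 2) • 1 := by
  rw [symEmb, Matrix.transpose_mul, transpose_symProj, Matrix.mul_assoc,
    ← Matrix.mul_assoc (symProj a ε), symProj_mul_self hε, symProj, Matrix.smul_mul,
    Matrix.mul_smul, Matrix.add_mul, Matrix.mul_add, Matrix.one_mul, Matrix.smul_mul,
    Matrix.mul_smul, transpose_pairEmb_mul_pairEmb, transpose_pairEmb_mul_swap₁₂_mul_pairEmb]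
  module

theorem transpose_defProj (ε : ℂ) : (defProj a ε)ᵀ = defProj a ε := by
  simp [defProj]

theorem transpose_tracelessProj (ε : ℂ) : (tracelessProj a ε)ᵀ = tracelessProj a ε := by
  simp [tracelessProj, transpose_defProj, transpose_symProj]

theorem symProj_mul_defProj {ε : ℂ} (hε : ε * ε = 1) :
    symProj a ε * defProj a ε = defProj a ε := by
  rw [defProj, Matrix.mul_smul, ← Matrix.mul_assoc, symProj_mul_symEmb hε]

theorem defProj_mul_symProj {ε : ℂ} (hε : ε * ε = 1) :
    defProj a ε * symProj a ε = defProj a ε := by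
  have := congrArg Matrix.transpose (symProj_mul_defProj (a := a) hε)
  rwa [Matrix.transpose_mul, transpose_symProj, transpose_defProj] at this

theorem symProj_neg_mul_defProj {ε : ℂ} (hε : ε * ε = 1) :
    symProj a (-ε) * defProj a ε = 0 := by
  rw [defProj, Matrix.mul_smul, ← Matrix.mul_assoc, symProj_neg_mul_symEmb hε, Matrix.zero_mul,
    smul_zero]

theorem defProj_mul_symProj_neg {ε : ℂ} (hε : ε * ε = 1) :
    defProj a ε * symProj a (-ε) = 0 := by
  have := congrArg Matrix.transpose (symProj_neg_mul_defProj (a := a) hε)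
  rwa [Matrix.transpose_mul, transpose_symProj, transpose_defProj, Matrix.transpose_zero] at this

theorem defProj_mul_self {ε : ℂ} (hε : ε * ε = 1) (h0 : (Fintype.card a + ε : ℂ) ≠ 0) :
    defProj a ε * defProj a ε = defProj a ε := by
  rw [defProj, Matrix.smul_mul, Matrix.mul_smul, Matrix.mul_assoc,
    ← Matrix.mul_assoc (symEmb a ε)ᵀ, transpose_symEmb_mul_symEmb hε, Matrix.smul_mul,
    Matrix.one_mul, Matrix.mul_smul, smul_smul, smul_smul]
  congr 1
  field_simp

theorem defProj_mul_defProj_neg {ε : ℂ} (hε : ε * ε = 1) :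
    defProj a ε * defProj a (-ε) = 0 := by
  rw [← defProj_mul_symProj hε, Matrix.mul_assoc, ← symProj_mul_defProj (ε := -ε) (by simpa using hε),
    ← Matrix.mul_assoc (symProj a ε), symProj_mul_symProj_neg hε, Matrix.zero_mul, Matrix.mul_zero]

theorem tracelessProj_mul_self {ε : ℂ} (hε : ε * ε = 1) (h0 : (Fintype.card a + ε : ℂ) ≠ 0) :
    tracelessProj a ε * tracelessProj a ε = tracelessProj a ε := by
  simp only [tracelessProj, Matrix.mul_sub, Matrix.sub_mul, symProj_mul_self hε,
    symProj_mul_defProj hε, defProj_mul_symProj hε, defProj_mul_self hε h0]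
  simp

theorem tracelessProj_mul_defProj {ε : ℂ} (hε : ε * ε = 1) (h0 : (Fintype.card a + ε : ℂ) ≠ 0) :
    tracelessProj a ε * defProj a ε = 0 := by
  simp only [tracelessProj, Matrix.sub_mul, symProj_mul_defProj hε, defProj_mul_self hε h0, sub_self]

theorem tracelessProj_mul_defProj_neg {ε : ℂ} (hε : ε * ε = 1) :
    tracelessProj a ε * defProj a (-ε) = 0 := by
  have := symProj_neg_mul_defProj (a := a) (ε := -ε) (by simpa using hε)
  rw [neg_neg] at this
  simp only [tracelessProj, Matrix.sub_mul, defProj_mul_defProj_neg hε, this, sub_self]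

theorem tracelessProj_mul_tracelessProj_neg {ε : ℂ} (hε : ε * ε = 1) :
    tracelessProj a ε * tracelessProj a (-ε) = 0 := by
  have := symProj_neg_mul_defProj (a := a) (ε := -ε) (by simpa using hε)
  rw [neg_neg] at this
  rw [tracelessProj, tracelessProj, Matrix.sub_mul, Matrix.mul_sub, Matrix.mul_sub,
    symProj_mul_symProj_neg hε, this, defProj_mul_symProj_neg hε, defProj_mul_defProj_neg hε]
  simp

theorem sum_proj_eq_one (ε : ℂ) :
    tracelessProj a ε + tracelessProj a (-ε) + defProj a ε + defProj a (-ε) = 1 := by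
  have : symProj a ε + symProj a (-ε) = 1 := by
    simp only [symProj]
    module
  rw [← this]
  simp only [tracelessProj]
  abel

theorem conjTranspose_swap₁₂ : (swap₁₂ a)ᴴ = swap₁₂ a := by
  rw [Matrix.conjTranspose, transpose_swap₁₂]
  ext p q
  simp [swap₁₂_apply, apply_ite]

theorem conjTranspose_pairEmb : (pairEmb a)ᴴ = (pairEmb a)ᵀ := by
  ext p q
  simp [pairEmb, apply_ite]

theorem conjTranspose_symProj {ε : ℂ} (hs : star ε = ε) : (symProj a ε)ᴴ = symProj a ε := by
  simp [symProj, Matrix.conjTranspose_smul, conjTranspose_swap₁₂, hs]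

theorem conjTranspose_symEmb {ε : ℂ} (hs : star ε = ε) : (symEmb a ε)ᴴ = (symEmb a ε)ᵀ := by
  rw [symEmb, Matrix.conjTranspose_mul, Matrix.transpose_mul, transpose_symProj,
    conjTranspose_symProj hs, conjTranspose_pairEmb]

theorem conjTranspose_defProj {ε : ℂ} (hs : star ε = ε) : (defProj a ε)ᴴ = defProj a ε := by
  have h : ((symEmb a ε)ᵀ)ᴴ = symEmb a ε := by
    rw [← conjTranspose_symEmb hs, Matrix.conjTranspose_conjTranspose]
  rw [defProj, Matrix.conjTranspose_smul, Matrix.conjTranspose_mul, h, conjTranspose_symEmb hs]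
  congr 1
  rw [star_div₀, star_add, hs]
  simp

theorem conjTranspose_tracelessProj {ε : ℂ} (hs : star ε = ε) :
    (tracelessProj a ε)ᴴ = tracelessProj a ε := by
  rw [tracelessProj, Matrix.conjTranspose_sub, conjTranspose_defProj hs, conjTranspose_symProj hs]

theorem posSemidef_of_isIdempotent {n : Type} [Fintype n] {Q : Matrix n n ℂ} (h : Qᴴ = Q)
    (h2 : Q * Q = Q) : Q.PosSemidef := by
  have := Matrix.posSemidef_conjTranspose_mul_self Q
  rwa [h, h2] at this

theorem trace_swap₁₂ : (swap₁₂ a).trace = (Fintype.card a : ℂ) ^ 2 := by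
  have : (swapOp a).trace = Fintype.card a := by
    simp [Matrix.trace, swapOp_apply, Fintype.sum_prod_type, ite_and]
  rw [swap₁₂, Matrix.trace_kronecker, this, Matrix.trace_one, sq]

theorem trace_symProj (ε : ℂ) : (symProj a ε).trace =
    (Fintype.card a : ℂ) ^ 2 * (Fintype.card a + ε) / 2 := by
  simp only [symProj, Matrix.trace_smul, Matrix.trace_add, trace_swap₁₂, Matrix.trace_one,
    Fintype.card_prod, smul_eq_mul]
  push_cast
  ring

theorem trace_defProj {ε : ℂ} (hε : ε * ε = 1) (h0 : (Fintype.card a + ε : ℂ) ≠ 0) :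
    (defProj a ε).trace = Fintype.card a := by
  rw [defProj, Matrix.trace_smul, Matrix.trace_mul_comm, transpose_symEmb_mul_symEmb hε,
    Matrix.trace_smul, Matrix.trace_one, smul_eq_mul, smul_eq_mul]
  field_simp

/-- For `ε = -1` the value vanishes at `d = 2`. This is why dimension two is treated separately. -/
theorem trace_tracelessProj {ε : ℂ} (hε : ε * ε = 1) (h0 : (Fintype.card a + ε : ℂ) ≠ 0) :
    (tracelessProj a ε).trace =
      (Fintype.card a : ℂ) ^ 2 * (Fintype.card a + ε) / 2 - Fintype.card a := by
  rw [tracelessProj, Matrix.trace_sub, trace_symProj, trace_defProj hε h0]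

end TripleAlgebra

/-! ### The representation `Ū ⊗ Ū ⊗ U` and its invariant projections. -/

section TripleRep


variable {a : Type} [Fintype a] [DecidableEq a]

/-- The representation `U ↦ Ū ⊗ Ū ⊗ U`. -/
def tripleRep (U : Matrix a a ℂ) : Matrix ((a × a) × a) ((a × a) × a) ℂ :=
  (U.map star ⊗ₖ U.map star) ⊗ₖ U

theorem tripleRep_apply (U : Matrix a a ℂ) (p q : (a × a) × a) :
    tripleRep U p q = star (U p.1.1 q.1.1) * star (U p.1.2 q.1.2) * U p.2 q.2 := rfl

theorem map_star_mul (U V : Matrix a a ℂ) : (U * V).map star = U.map star * V.map star := by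
  ext i j
  simp [Matrix.mul_apply]

theorem tripleRep_mul (U V : Matrix a a ℂ) : tripleRep (U * V) = tripleRep U * tripleRep V := by
  rw [tripleRep, map_star_mul, Matrix.mul_kronecker_mul, Matrix.mul_kronecker_mul]
  rfl

theorem tripleRep_one : tripleRep (1 : Matrix a a ℂ) = 1 := by
  have : (1 : Matrix a a ℂ).map star = 1 := Matrix.map_one _ (star_zero _) (star_one _)
  rw [tripleRep, this, Matrix.one_kronecker_one, Matrix.one_kronecker_one]

theorem conjTranspose_tripleRep (U : Matrix a a ℂ) : (tripleRep U)ᴴ = tripleRep Uᴴ := by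
  ext p q
  simp [tripleRep_apply]

theorem tripleRep_mul_swap₁₂ (U : Matrix a a ℂ) :
    tripleRep U * swap₁₂ a = swap₁₂ a * tripleRep U := by
  ext p q
  rw [mul_swap₁₂_apply, swap₁₂_mul_apply, tripleRep_apply, tripleRep_apply]
  ring

theorem tripleRep_mul_symProj (U : Matrix a a ℂ) (ε : ℂ) :
    tripleRep U * symProj a ε = symProj a ε * tripleRep U := by
  simp [symProj, Matrix.mul_add, Matrix.add_mul, tripleRep_mul_swap₁₂]

/-- By unitarity `∑ |m⟩ ⊗ |m⟩` is fixed by `Ū ⊗ U`, which leaves one factor `Ū`. Both ranges of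
`symEmb` are therefore copies of `Ū`. -/
theorem tripleRep_mul_pairEmb {U : Matrix a a ℂ} (hU : U ∈ Matrix.unitaryGroup a ℂ) :
    tripleRep U * pairEmb a = pairEmb a * U.map star := by
  have hU' := Matrix.mem_unitaryGroup_iff.mp hU
  ext ⟨⟨i, j⟩, k⟩ m
  have h : ∑ n, U k n * star (U i n) = if k = i then 1 else 0 := by
    have := congrFun (congrFun hU' k) i
    rwa [Matrix.mul_apply, Matrix.one_apply] at this
  have h1 : (tripleRep U * pairEmb a) ((i, j), k) m =
      (∑ n, U k n * star (U i n)) * star (U j m) := by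
    simp only [Matrix.mul_apply, tripleRep_apply, pairEmb, Matrix.of_apply,
      Fintype.sum_prod_type, ite_and, mul_ite, mul_one, mul_zero, Finset.sum_ite_irrel,
      Finset.sum_const_zero, Finset.sum_ite_eq, Finset.sum_ite_eq', Finset.mem_univ, if_true,
      Finset.sum_mul]
    refine Finset.sum_congr rfl fun n _ => ?_
    ring
  rw [h1, h]
  simp [Matrix.mul_apply, pairEmb, ite_and, eq_comm]

theorem tripleRep_mul_symEmb {U : Matrix a a ℂ} (hU : U ∈ Matrix.unitaryGroup a ℂ) (ε : ℂ) :
    tripleRep U * symEmb a ε = symEmb a ε * U.map star := by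
  rw [symEmb, ← Matrix.mul_assoc, tripleRep_mul_symProj, Matrix.mul_assoc,
    tripleRep_mul_pairEmb hU, Matrix.mul_assoc]

theorem transpose_symEmb_mul_tripleRep {U : Matrix a a ℂ} (hU : U ∈ Matrix.unitaryGroup a ℂ)
    {ε : ℂ} (hs : star ε = ε) :
    (symEmb a ε)ᵀ * tripleRep U = U.map star * (symEmb a ε)ᵀ := by
  have h := congrArg Matrix.conjTranspose
    (tripleRep_mul_symEmb (U := Uᴴ) (Unitary.star_mem hU) ε)
  rw [Matrix.conjTranspose_mul, Matrix.conjTranspose_mul, conjTranspose_tripleRep,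
    conjTranspose_symEmb hs, Matrix.conjTranspose_conjTranspose] at h
  rw [h]
  congr 1
  ext i j
  simp

theorem tripleRep_mul_defProj {U : Matrix a a ℂ} (hU : U ∈ Matrix.unitaryGroup a ℂ)
    {ε : ℂ} (hs : star ε = ε) : tripleRep U * defProj a ε = defProj a ε * tripleRep U := by
  rw [defProj, Matrix.mul_smul, Matrix.smul_mul, ← Matrix.mul_assoc, tripleRep_mul_symEmb hU,
    Matrix.mul_assoc, Matrix.mul_assoc, transpose_symEmb_mul_tripleRep hU hs]

theorem tripleRep_mul_tracelessProj {U : Matrix a a ℂ} (hU : U ∈ Matrix.unitaryGroup a ℂ)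
    {ε : ℂ} (hs : star ε = ε) :
    tripleRep U * tracelessProj a ε = tracelessProj a ε * tripleRep U := by
  rw [tracelessProj, Matrix.mul_sub, Matrix.sub_mul, tripleRep_mul_symProj,
    tripleRep_mul_defProj hU hs]

end TripleRep

/-! ### Constraints from diagonal phases and permutations. -/

section Commutant


variable {a : Type} [Fintype a] [DecidableEq a]

/-- Operators on three copies of `ℂ^a` that commute with `Ū ⊗ Ū ⊗ U` for all unitary `U`. -/
def IsTripleInvariant (X : Matrix ((a × a) × a) ((a × a) × a) ℂ) : Prop :=
  ∀ U ∈ Matrix.unitaryGroup a ℂ, tripleRep U * X = X * tripleRep U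

theorem IsTripleInvariant.conjTranspose {X : Matrix ((a × a) × a) ((a × a) × a) ℂ}
    (hX : IsTripleInvariant X) : IsTripleInvariant Xᴴ := by
  intro U hU
  have h := congrArg Matrix.conjTranspose (hX Uᴴ (Unitary.star_mem hU))
  rw [Matrix.conjTranspose_mul, Matrix.conjTranspose_mul, conjTranspose_tripleRep,
    Matrix.conjTranspose_conjTranspose] at h
  exact h.symm

theorem IsTripleInvariant.sub_smul_one {X : Matrix ((a × a) × a) ((a × a) × a) ℂ}
    (hX : IsTripleInvariant X) (x : ℂ) : IsTripleInvariant (X - x • 1) := by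
  intro U hU
  rw [Matrix.mul_sub, Matrix.sub_mul, hX U hU]
  simp

/-- The diagonal unitary with entry `I` at `p` and `1` elsewhere. -/
noncomputable def phase (p : a) : Matrix a a ℂ :=
  Matrix.diagonal fun m => if m = p then Complex.I else 1

theorem phase_mem (p : a) : phase p ∈ Matrix.unitaryGroup a ℂ := by
  rw [Matrix.mem_unitaryGroup_iff, phase, Matrix.star_eq_conjTranspose,
    Matrix.diagonal_conjTranspose, Matrix.diagonal_mul_diagonal, ← Matrix.diagonal_one]
  congr 1
  ext m
  simp only [Pi.star_apply]
  split_ifs <;> simp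

/-- The permutation matrix of `σ`. -/
def permU (σ : Equiv.Perm a) : Matrix a a ℂ :=
  Matrix.of fun m p => if m = σ p then 1 else 0

theorem permU_mem (σ : Equiv.Perm a) : permU σ ∈ Matrix.unitaryGroup a ℂ := by
  rw [Matrix.mem_unitaryGroup_iff', Matrix.star_eq_conjTranspose]
  ext p q
  simp only [Matrix.mul_apply, permU, Matrix.conjTranspose_apply, Matrix.of_apply, apply_ite star,
    star_one, star_zero, ite_mul, one_mul, zero_mul, Finset.sum_ite_eq', Finset.mem_univ, if_true,
    EmbeddingLike.apply_eq_iff_eq, Matrix.one_apply]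

theorem IsTripleInvariant.apply_perm {X : Matrix ((a × a) × a) ((a × a) × a) ℂ}
    (hX : IsTripleInvariant X) (σ : Equiv.Perm a) (x y z x' y' z' : a) :
    X ((σ x, σ y), σ z) ((σ x', σ y'), σ z') = X ((x, y), z) ((x', y'), z') := by
  have h := congrFun (congrFun (hX _ (permU_mem σ)) ((σ x, σ y), σ z)) ((x', y'), z')
  simpa [Matrix.mul_apply, tripleRep_apply, permU, Fintype.sum_prod_type, apply_ite] using h.symm

/-- The scalar by which `phase p` acts on a basis tensor. -/
noncomputable def phaseWeight (p : a) (l : (a × a) × a) : ℂ :=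
  (if l.1.1 = p then -Complex.I else 1) * (if l.1.2 = p then -Complex.I else 1) *
    (if l.2 = p then Complex.I else 1)

theorem IsTripleInvariant.eq_zero_of_phaseWeight_ne
    {X : Matrix ((a × a) × a) ((a × a) × a) ℂ} (hX : IsTripleInvariant X) (p : a)
    {l l' : (a × a) × a} (h : phaseWeight p l ≠ phaseWeight p l') : X l l' = 0 := by
  have hd : tripleRep (phase p) = Matrix.diagonal (phaseWeight p) := by
    ext l l'
    simp only [tripleRep_apply, phase, Matrix.diagonal_apply, phaseWeight, Prod.ext_iff]
    split_ifs <;> simp_all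
  have h1 := congrFun (congrFun (hX _ (phase_mem p)) l) l'
  rw [hd, Matrix.diagonal_mul, Matrix.mul_diagonal, mul_comm] at h1
  by_contra h2
  exact h (mul_left_cancel₀ h2 h1)

/-- A phase `I`, unlike a sign, distinguishes conjugated from unconjugated slots: `-1` occurs only
for two conjugated slots, `I` only for the unconjugated slot alone. -/
theorem phase_mul_eq_neg_one {P Q R : Prop} [Decidable P] [Decidable Q] [Decidable R]
    (h : (if P then -Complex.I else 1) * (if Q then -Complex.I else 1) *
      (if R then Complex.I else 1) = -1) : P ∧ Q ∧ ¬R := by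
  split_ifs at h <;> simp_all [Complex.ext_iff] <;> norm_num at h

theorem phase_mul_eq_I {P Q R : Prop} [Decidable P] [Decidable Q] [Decidable R]
    (h : (if P then -Complex.I else 1) * (if Q then -Complex.I else 1) *
      (if R then Complex.I else 1) = Complex.I) : ¬P ∧ ¬Q ∧ R := by
  split_ifs at h <;> simp_all [Complex.ext_iff] <;> norm_num at h

theorem phase_mul_eq_neg_I {P Q R : Prop} [Decidable P] [Decidable Q] [Decidable R]
    (h : (if P then -Complex.I else 1) * (if Q then -Complex.I else 1) *
      (if R then Complex.I else 1) = -Complex.I) :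
    (P ∧ Q ∧ R) ∨ (P ∧ ¬Q ∧ ¬R) ∨ (¬P ∧ Q ∧ ¬R) := by
  split_ifs at h <;> simp_all [Complex.ext_iff] <;> norm_num at h

/-- The weights at `i` and at `k` already determine the basis tensor. -/
theorem IsTripleInvariant.apply_self_self {X : Matrix ((a × a) × a) ((a × a) × a) ℂ}
    (hX : IsTripleInvariant X) {i k : a} (hik : i ≠ k) {l : (a × a) × a}
    (hl : l ≠ ((i, i), k)) : X l ((i, i), k) = 0 := by
  obtain ⟨⟨x, y⟩, z⟩ := l
  by_contra h
  have h1 : phaseWeight i ((x, y), z) = phaseWeight i ((i, i), k) := by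
    by_contra h1
    exact h (hX.eq_zero_of_phaseWeight_ne i h1)
  have h2 : phaseWeight k ((x, y), z) = phaseWeight k ((i, i), k) := by
    by_contra h2
    exact h (hX.eq_zero_of_phaseWeight_ne k h2)
  simp only [phaseWeight, if_true, if_neg hik, if_neg hik.symm] at h1 h2
  obtain ⟨hx, hy, -⟩ := phase_mul_eq_neg_one (h1.trans (by simp))
  obtain ⟨-, -, hz⟩ := phase_mul_eq_I (h2.trans (by simp))
  exact hl (by rw [hx, hy, hz])

/-- Phases cannot see the order of the two conjugated slots, so exactly two rows remain possible. -/
theorem IsTripleInvariant.apply_distinct {X : Matrix ((a × a) × a) ((a × a) × a) ℂ}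
    (hX : IsTripleInvariant X) {i j k : a} (hij : i ≠ j) (hik : i ≠ k) (hjk : j ≠ k)
    {l : (a × a) × a} (hl : l ≠ ((i, j), k)) (hl' : l ≠ ((j, i), k)) :
    X l ((i, j), k) = 0 := by
  obtain ⟨⟨x, y⟩, z⟩ := l
  by_contra h
  have h0 : ∀ p, phaseWeight p ((x, y), z) = phaseWeight p ((i, j), k) := by
    intro p
    by_contra h1
    exact h (hX.eq_zero_of_phaseWeight_ne p h1)
  have h1 := h0 i
  have h2 := h0 j
  have h3 := h0 k
  simp only [phaseWeight, if_true, if_neg hik, if_neg hik.symm, if_neg hij, if_neg hij.symm,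
    if_neg hjk, if_neg hjk.symm] at h1 h2 h3
  have h1 := phase_mul_eq_neg_I (h1.trans (by simp))
  have h2 := phase_mul_eq_neg_I (h2.trans (by simp))
  obtain ⟨-, -, hz⟩ := phase_mul_eq_I (h3.trans (by simp))
  simp only [ne_eq, Prod.mk.injEq] at hl hl'
  grind

end Commutant

/-! ### Schur's lemma from plane reflections. -/

section Rotations


variable {a : Type} [Fintype a] [DecidableEq a]

/-- The reflection `e_i ↦ s (e_i + η e_j)`, `e_j ↦ s (e_i - η e_j)`; it is unitary for
`s ^ 2 = 1 / 2` and `η ^ 2 = 1`. -/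
def mixU (s η : ℂ) (i j : a) : Matrix a a ℂ :=
  Matrix.of fun m p => if p = i then s * ((if m = i then 1 else 0) + η * (if m = j then 1 else 0))
    else if p = j then s * ((if m = i then 1 else 0) - η * (if m = j then 1 else 0))
    else if m = p then 1 else 0

theorem star_mixU {s η : ℂ} (hs : star s = s) (hη : star η = η) (i j m p : a) :
    star (mixU s η i j m p) = mixU s η i j m p := by
  simp only [mixU, Matrix.of_apply, apply_ite star, star_mul', star_add, star_sub, hs, hη,
    star_one, star_zero]

theorem sum_mul_mixU_left (s η : ℂ) (i j : a) (f : a → ℂ) :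
    ∑ m, f m * mixU s η i j m i = s * (f i + η * f j) := by
  simp only [mixU, Matrix.of_apply, if_true, mul_add, Finset.sum_add_distrib, mul_ite, mul_one,
    mul_zero, Finset.sum_ite_eq', Finset.mem_univ]
  ring

theorem sum_mul_mixU_right (s η : ℂ) {i j : a} (hij : i ≠ j) (f : a → ℂ) :
    ∑ m, f m * mixU s η i j m j = s * (f i - η * f j) := by
  simp only [mixU, Matrix.of_apply, if_neg hij.symm, if_true, mul_sub, Finset.sum_sub_distrib,
    mul_ite, mul_one, mul_zero, Finset.sum_ite_eq', Finset.mem_univ]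
  ring

theorem sum_mul_mixU_other (s η : ℂ) {i j k : a} (hik : k ≠ i) (hjk : k ≠ j) (f : a → ℂ) :
    ∑ m, f m * mixU s η i j m k = f k := by
  simp only [mixU, Matrix.of_apply, if_neg hik, if_neg hjk, mul_ite, mul_one, mul_zero,
    Finset.sum_ite_eq', Finset.mem_univ, if_true]

theorem mixU_mem {s η : ℂ} (hs : star s = s) (hη : star η = η) (hs2 : s * s = 1 / 2)
    (hη2 : η * η = 1) {i j : a} (hij : i ≠ j) : mixU s η i j ∈ Matrix.unitaryGroup a ℂ := by
  rw [Matrix.mem_unitaryGroup_iff', Matrix.star_eq_conjTranspose]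
  ext p q
  simp only [Matrix.mul_apply, Matrix.conjTranspose_apply, star_mixU hs hη]
  have hi : ∀ p, mixU s η i j i p = if p = i then s else if p = j then s else 0 := by
    intro p
    simp only [mixU, Matrix.of_apply, if_true, if_neg hij]
    split_ifs <;> simp_all
  have hj : ∀ p, mixU s η i j j p = if p = i then s * η else if p = j then -(s * η) else 0 := by
    intro p
    simp only [mixU, Matrix.of_apply, if_true, if_neg hij.symm]
    split_ifs <;> simp_all
  by_cases hq : q = i
  · subst hq
    rw [sum_mul_mixU_left, hi, hj, Matrix.one_apply]
    split_ifs
    · linear_combination 2 * hs2 + s * s * hη2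
    · linear_combination -s * s * hη2
    · ring
  · by_cases hq' : q = j
    · subst hq'
      rw [sum_mul_mixU_right s η hij, hi, hj, Matrix.one_apply]
      split_ifs
      · simp_all
      · linear_combination -s * s * hη2
      · linear_combination 2 * hs2 + s * s * hη2
      · ring
    · rw [sum_mul_mixU_other s η hq hq', Matrix.one_apply]
      simp only [mixU, Matrix.of_apply, if_neg hq, if_neg hq', mul_zero, add_zero, sub_zero]
      by_cases hpq : p = q
      · subst hpq
        simp [hq, hq']
      · simp [hpq, Ne.symm hpq]

theorem exists_mix_scalar : ∃ s : ℂ, star s = s ∧ s * s = 1 / 2 ∧ s ≠ 0 := by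
  refine ⟨((Real.sqrt 2)⁻¹ : ℝ), Complex.conj_ofReal _, ?_, ?_⟩
  · rw [← Complex.ofReal_mul, ← mul_inv, Real.mul_self_sqrt (by norm_num)]
    norm_num
  · simp

/-- If an invariant operator kills a basis tensor, it kills the reflected tensor too. The reflection
is real, so its conjugates disappear from the expansion. -/
theorem IsTripleInvariant.sum_mixU {Z : Matrix ((a × a) × a) ((a × a) × a) ℂ}
    (hZ : IsTripleInvariant Z) {s η : ℂ} (hs : star s = s) (hη : star η = η)
    (hs2 : s * s = 1 / 2) (hη2 : η * η = 1) {i j : a} (hij : i ≠ j) {p q r : a}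
    (h : ∀ l, Z l ((p, q), r) = 0) (l : (a × a) × a) :
    ∑ x, (∑ y, (∑ z, Z l ((x, y), z) * mixU s η i j z r) * mixU s η i j y q) *
      mixU s η i j x p = 0 := by
  have h1 := congrFun (congrFun (hZ _ (mixU_mem hs hη hs2 hη2 hij)) l) ((p, q), r)
  rw [Matrix.mul_apply, Matrix.mul_apply] at h1
  simp only [h, mul_zero, Finset.sum_const_zero, tripleRep_apply, star_mixU hs hη,
    Fintype.sum_prod_type] at h1
  rw [h1]
  simp only [Finset.sum_mul]
  refine Finset.sum_congr rfl fun x _ => Finset.sum_congr rfl fun y _ =>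
    Finset.sum_congr rfl fun z _ => ?_
  ring

/-- A row of `Z` is a symmetric form vanishing on `e_i ⊗ e_i ⊗ e_k`. Reflecting these tensors yields
enough zeros to make the row factor through the contraction with the third slot. -/
theorem IsTripleInvariant.exists_of_symm {Z : Matrix ((a × a) × a) ((a × a) × a) ℂ}
    (hZ : IsTripleInvariant Z) (hsymm : ∀ l i j k, Z l ((i, j), k) = Z l ((j, i), k))
    (h0 : ∀ l i k, i ≠ k → Z l ((i, i), k) = 0) (l : (a × a) × a) :
    ∃ t : a → ℂ, ∀ i j k, Z l ((i, j), k) =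
      (if j = k then t i else 0) + (if i = k then t j else 0) := by
  obtain ⟨s, hs, hs2, hs0⟩ := exists_mix_scalar
  have h1 : ∀ i j k, i ≠ j → i ≠ k → j ≠ k → Z l ((i, j), k) = 0 := by
    intro i j k hij hik hjk
    have := hZ.sum_mixU (η := 1) hs (star_one _) hs2 (by norm_num) hij (fun l => h0 l i k hik) l
    simp only [sum_mul_mixU_left, sum_mul_mixU_other s 1 hik.symm hjk.symm] at this
    rw [h0 l i k hik, h0 l j k hjk, hsymm l j i k] at this
    have h2 : (2 * (s * s)) * Z l ((i, j), k) = 0 := by linear_combination this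
    rw [hs2] at h2
    simpa using h2
  have h2 : ∀ i j, i ≠ j → Z l ((i, i), i) = 2 * Z l ((i, j), j) := by
    intro i j hij
    -- The reflected tensor is `(e_i + η e_j) ⊗ (e_i + η e_j) ⊗ (e_i - η e_j)`. Averaging over `η =
    -- ±1` keeps its even terms, and `h0` removes the one at `(j, j, i)`.
    have e1 := hZ.sum_mixU (η := 1) hs (star_one _) hs2 (by norm_num) hij
      (fun l => h0 l i j hij) l
    have e2 := hZ.sum_mixU (η := -1) hs (by simp) hs2 (by norm_num) hij
      (fun l => h0 l i j hij) l
    simp only [sum_mul_mixU_left, sum_mul_mixU_right s _ hij] at e1 e2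
    rw [h0 l i j hij, h0 l j i hij.symm, hsymm l j i i, hsymm l j i j] at e1 e2
    have h3 : (s * (s * s)) * (Z l ((i, i), i) - 2 * Z l ((i, j), j)) = 0 := by
      linear_combination (e1 + e2) / 2
    rw [hs2] at h3
    rcases mul_eq_zero.mp h3 with h4 | h4
    · simp [hs0] at h4
    · linear_combination h4
  refine ⟨fun i => Z l ((i, i), i) / 2, fun i j k => ?_⟩
  dsimp only
  by_cases hjk : j = k
  · subst hjk
    by_cases hij : i = j
    · subst hij
      simp
    · rw [if_pos rfl, if_neg hij, h2 i j hij]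
      ring
  · by_cases hik : i = k
    · subst hik
      rw [if_neg hjk, if_pos rfl, hsymm, h2 j i hjk]
      ring
    · rw [if_neg hjk, if_neg hik]
      by_cases hij : i = j
      · subst hij
        rw [h0 l i k hik, add_zero]
      · rw [h1 i j k hij hik hjk, add_zero]

theorem IsTripleInvariant.exists_of_antisymm [Nontrivial a]
    {Z : Matrix ((a × a) × a) ((a × a) × a) ℂ}
    (hZ : IsTripleInvariant Z) (hsymm : ∀ l i j k, Z l ((i, j), k) = -Z l ((j, i), k))
    (h0 : ∀ l i j k, i ≠ j → i ≠ k → j ≠ k → Z l ((i, j), k) = 0) (l : (a × a) × a) :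
    ∃ t : a → ℂ, ∀ i j k, Z l ((i, j), k) =
      (if j = k then t i else 0) - (if i = k then t j else 0) := by
  obtain ⟨s, hs, hs2, hs0⟩ := exists_mix_scalar
  have h2 : ∀ i j k, i ≠ j → i ≠ k → j ≠ k → Z l ((i, j), j) = Z l ((i, k), k) := by
    intro i j k hij hik hjk
    -- The reflected tensor is `e_i ⊗ (e_j + e_k) ⊗ (e_j - e_k)`; its mixed terms vanish by `h0`.
    have e1 := hZ.sum_mixU (η := 1) hs (star_one _) hs2 (by norm_num) hjk
      (fun l => h0 l i j k hij hik hjk) l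
    simp only [sum_mul_mixU_left, sum_mul_mixU_right s _ hjk, sum_mul_mixU_other s 1 hij hik] at e1
    rw [h0 l i j k hij hik hjk, h0 l i k j hik hij hjk.symm] at e1
    have h3 : (s * s) * (Z l ((i, j), j) - Z l ((i, k), k)) = 0 := by
      linear_combination e1
    rw [hs2] at h3
    rcases mul_eq_zero.mp h3 with h4 | h4
    · norm_num at h4
    · linear_combination h4
  have hii : ∀ i k, Z l ((i, i), k) = 0 := by
    intro i k
    have := hsymm l i i k
    linear_combination this / 2
  -- By `h2` the entry at `(i, j, j)` is the same for all `j ≠ i`, so any choice of such an index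
  -- defines `t i`.
  choose g hg using fun i : a => exists_ne i
  have ht : ∀ i j, i ≠ j → Z l ((i, j), j) = Z l ((i, g i), g i) := by
    intro i j hij
    by_cases h : j = g i
    · rw [← h]
    · exact h2 i j (g i) hij (hg i).symm h
  refine ⟨fun i => Z l ((i, g i), g i), fun i j k => ?_⟩
  dsimp only
  by_cases hij : i = j
  · subst hij
    rw [hii, sub_self]
  · by_cases hjk : j = k
    · subst hjk
      rw [if_pos rfl, if_neg hij, ht i j hij, sub_zero]
    · by_cases hik : i = k
      · subst hik
        rw [if_neg hjk, if_pos rfl, hsymm, ht j i hjk, zero_sub]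
      · rw [if_neg hjk, if_neg hik, h0 l i j k hij hik hjk, sub_zero]

theorem symEmb_apply (ε : ℂ) (i j k m : a) : symEmb a ε ((i, j), k) m = (2 : ℂ)⁻¹ *
    ((if i = k ∧ j = m then 1 else 0) + ε * (if j = k ∧ i = m then 1 else 0)) := by
  rw [symEmb, symProj, Matrix.smul_mul, Matrix.add_mul, Matrix.one_mul, Matrix.smul_mul,
    Matrix.smul_apply, Matrix.add_apply, Matrix.smul_apply, swap₁₂_mul_apply]
  rfl

/-- The hypothesis places each row of `Y * symProj a ε` in the range of `symEmb a ε`. Such rows are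
fixed by `defProj`, hence killed by the traceless projection. -/
theorem mul_tracelessProj_eq_zero {Y : Matrix ((a × a) × a) ((a × a) × a) ℂ} {ε : ℂ}
    (hε : ε * ε = 1) (hD : (Fintype.card a + ε : ℂ) ≠ 0)
    (h : ∀ l, ∃ t : a → ℂ, ∀ i j k, Y l ((i, j), k) + ε * Y l ((j, i), k) =
      (if j = k then t i else 0) + ε * (if i = k then t j else 0)) :
    Y * tracelessProj a ε = 0 := by
  have hP : ∀ l i j k, (Y * symProj a ε) l ((i, j), k) =
      (2 : ℂ)⁻¹ * (Y l ((i, j), k) + ε * Y l ((j, i), k)) := by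
    intro l i j k
    rw [symProj, Matrix.mul_smul, Matrix.mul_add, Matrix.mul_one, Matrix.mul_smul,
      Matrix.smul_apply, Matrix.add_apply, Matrix.smul_apply, mul_swap₁₂_apply]
    rfl
  have hE : Y * symEmb a ε = Y * symProj a ε * pairEmb a := by
    rw [symEmb, Matrix.mul_assoc]
  rw [tracelessProj, Matrix.mul_sub, defProj, Matrix.mul_smul, ← Matrix.mul_assoc, sub_eq_zero]
  ext l ⟨⟨i, j⟩, k⟩
  obtain ⟨t, ht⟩ := h l
  have hE' : ∀ m, (Y * symEmb a ε) l m = 2⁻¹ * (ε * (Fintype.card a + ε)) * t m := by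
    intro m
    rw [hE, Matrix.mul_apply]
    simp only [Fintype.sum_prod_type, hP, ht, pairEmb, Matrix.of_apply, ite_and, mul_ite, mul_one,
      mul_zero, Finset.sum_ite_irrel, Finset.sum_const_zero, Finset.sum_ite_eq,
      Finset.sum_ite_eq', Finset.mem_univ, if_true]
    rw [← Finset.mul_sum, Finset.sum_add_distrib]
    simp only [Finset.sum_ite_eq, Finset.mem_univ, if_true, Finset.sum_const, Finset.card_univ,
      nsmul_eq_mul]
    linear_combination (-2⁻¹ * t m) * hε
  rw [hP, ht, Matrix.smul_apply, Matrix.mul_apply]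
  simp only [hE', Matrix.transpose_apply, symEmb_apply, ite_and, mul_add, mul_ite, mul_one, mul_zero,
    Finset.sum_add_distrib, Finset.sum_ite_irrel, Finset.sum_const_zero, Finset.sum_ite_eq,
    Finset.mem_univ, if_true, smul_eq_mul]
  have h2 : (2 / (Fintype.card a + ε)) * (Fintype.card a + ε : ℂ) = 2 := div_mul_cancel₀ _ hD
  have c : 2 / (Fintype.card a + ε) * (2⁻¹ * (ε * Fintype.card a) + 2⁻¹ * (ε * ε)) = ε := by
    linear_combination (ε / 2) * h2
  have e1 : 2 / (Fintype.card a + ε) *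
      ((2⁻¹ * (ε * Fintype.card a) + 2⁻¹ * (ε * ε)) * t j * 2⁻¹) = 2⁻¹ * (ε * t j) := by
    linear_combination (t j / 2) * c
  have e2 : 2 / (Fintype.card a + ε) *
      ((2⁻¹ * (ε * Fintype.card a) + 2⁻¹ * (ε * ε)) * t i * (2⁻¹ * ε)) = 2⁻¹ * t i := by
    linear_combination (t i * ε / 2) * c + t i / 2 * hε
  rw [e1, e2, add_comm]

theorem IsTripleInvariant.mul_one_add_swap₁₂ {Y : Matrix ((a × a) × a) ((a × a) × a) ℂ}
    (hY : IsTripleInvariant Y) (ε : ℂ) : IsTripleInvariant (Y * (1 + ε • swap₁₂ a)) := by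
  intro U hU
  rw [← Matrix.mul_assoc, hY U hU, Matrix.mul_assoc, Matrix.mul_assoc]
  congr 1
  rw [Matrix.mul_add, Matrix.add_mul, Matrix.mul_smul, tripleRep_mul_swap₁₂, Matrix.mul_one,
    Matrix.one_mul, Matrix.smul_mul]

theorem mul_one_add_swap₁₂_apply (Y : Matrix ((a × a) × a) ((a × a) × a) ℂ) (ε : ℂ)
    (l : (a × a) × a) (i j k : a) : (Y * (1 + ε • swap₁₂ a)) l ((i, j), k) =
      Y l ((i, j), k) + ε * Y l ((j, i), k) := by
  rw [Matrix.mul_add, Matrix.mul_one, Matrix.mul_smul, Matrix.add_apply, Matrix.smul_apply,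
    mul_swap₁₂_apply]
  rfl

theorem exists_perm_pair {i k i' k' : a} (h : i ≠ k) (h' : i' ≠ k') :
    ∃ σ : Equiv.Perm a, σ i = i' ∧ σ k = k' := by
  have hne : Equiv.swap i i' k ≠ i' := fun e =>
    h ((Equiv.swap i i').injective (by rw [Equiv.swap_apply_left, e]))
  refine ⟨(Equiv.swap (Equiv.swap i i' k) k') * Equiv.swap i i', ?_, ?_⟩
  · rw [Equiv.Perm.mul_apply, Equiv.swap_apply_left, Equiv.swap_apply_of_ne_of_ne hne.symm h']
  · rw [Equiv.Perm.mul_apply, Equiv.swap_apply_left]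

theorem exists_perm_triple {i j k i' j' k' : a} (hij : i ≠ j) (hik : i ≠ k) (hjk : j ≠ k)
    (hij' : i' ≠ j') (hik' : i' ≠ k') (hjk' : j' ≠ k') :
    ∃ σ : Equiv.Perm a, σ i = i' ∧ σ j = j' ∧ σ k = k' := by
  obtain ⟨σ, h1, h2⟩ := exists_perm_pair hij hij'
  refine ⟨Equiv.swap (σ k) k' * σ, ?_, ?_, ?_⟩
  · rw [Equiv.Perm.mul_apply, h1, Equiv.swap_apply_of_ne_of_ne _ hik']
    rw [← h1]
    exact fun e => hik (σ.injective e)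
  · rw [Equiv.Perm.mul_apply, h2, Equiv.swap_apply_of_ne_of_ne _ hjk']
    rw [← h2]
    exact fun e => hjk (σ.injective e)
  · rw [Equiv.Perm.mul_apply, Equiv.swap_apply_left]

theorem IsTripleInvariant.apply_perm_symm {X : Matrix ((a × a) × a) ((a × a) × a) ℂ}
    (hX : IsTripleInvariant X) (σ : Equiv.Perm a) (l : (a × a) × a) (x' y' z' : a) :
    X l ((σ x', σ y'), σ z') =
      X ((σ.symm l.1.1, σ.symm l.1.2), σ.symm l.2) ((x', y'), z') := by
  have := hX.apply_perm σ (σ.symm l.1.1) (σ.symm l.1.2) (σ.symm l.2) x' y' z'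
  simpa only [Equiv.apply_symm_apply] using this

/-- By phases, `e_i ⊗ e_i ⊗ e_k` is an eigenvector, and permutations make its eigenvalue `x`
independent of `i ≠ k`. Then `exists_of_symm` applies to the symmetrized `X - x`. -/
theorem IsTripleInvariant.exists_mul_tracelessProj_one [Nontrivial a]
    {X : Matrix ((a × a) × a) ((a × a) × a) ℂ} (hX : IsTripleInvariant X) :
    ∃ x : ℂ, X * tracelessProj a 1 = x • tracelessProj a 1 := by
  obtain ⟨i₀, k₀, h₀⟩ := exists_pair_ne a
  refine ⟨X ((i₀, i₀), k₀) ((i₀, i₀), k₀), ?_⟩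
  set x := X ((i₀, i₀), k₀) ((i₀, i₀), k₀)
  have hY := hX.sub_smul_one x
  have hZ := hY.mul_one_add_swap₁₂ 1
  have h1 : ∀ l, (X - x • 1) l ((i₀, i₀), k₀) = 0 := by
    intro l
    by_cases hl : l = ((i₀, i₀), k₀)
    · subst hl
      simp [x]
    · exact hY.apply_self_self h₀ hl
  have h2 : ∀ l i k, i ≠ k → (X - x • 1) l ((i, i), k) = 0 := by
    intro l i k hik
    obtain ⟨σ, rfl, rfl⟩ := exists_perm_pair h₀ hik
    rw [hY.apply_perm_symm, h1]
  have hD : (Fintype.card a + 1 : ℂ) ≠ 0 := Nat.cast_add_one_ne_zero _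
  have := mul_tracelessProj_eq_zero (Y := X - x • 1) (ε := 1) (by norm_num) hD fun l => by
    obtain ⟨t, ht⟩ := hZ.exists_of_symm
      (by intro l i j k; rw [mul_one_add_swap₁₂_apply, mul_one_add_swap₁₂_apply]; ring)
      (by intro l i k hik; rw [mul_one_add_swap₁₂_apply, h2 l i k hik]; ring) l
    refine ⟨t, fun i j k => ?_⟩
    rw [← mul_one_add_swap₁₂_apply, ht, one_mul]
  rwa [Matrix.sub_mul, Matrix.smul_mul, Matrix.one_mul, sub_eq_zero] at this

theorem IsTripleInvariant.exists_mul_tracelessProj_neg_one [Nontrivial a]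
    {X : Matrix ((a × a) × a) ((a × a) × a) ℂ} (hX : IsTripleInvariant X) :
    ∃ x : ℂ, X * tracelessProj a (-1) = x • tracelessProj a (-1) := by
  obtain ⟨x, hx⟩ : ∃ x : ℂ, ∀ l i j k, i ≠ j → i ≠ k → j ≠ k →
      (X - x • 1) l ((i, j), k) - (X - x • 1) l ((j, i), k) = 0 := by
    by_cases hex : ∃ i j k : a, i ≠ j ∧ i ≠ k ∧ j ≠ k
    · obtain ⟨i₀, j₀, k₀, hij, hik, hjk⟩ := hex
      -- On the two tensors that differ by the exchange of `i₀` and `j₀`, `X` is a symmetric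
      -- two-by-two block with equal diagonal entries. This is its eigenvalue on their difference.
      refine ⟨X ((i₀, j₀), k₀) ((i₀, j₀), k₀) - X ((j₀, i₀), k₀) ((i₀, j₀), k₀), ?_⟩
      set x := X ((i₀, j₀), k₀) ((i₀, j₀), k₀) - X ((j₀, i₀), k₀) ((i₀, j₀), k₀)
      have hY := hX.sub_smul_one x
      have e1 : X ((j₀, i₀), k₀) ((j₀, i₀), k₀) = X ((i₀, j₀), k₀) ((i₀, j₀), k₀) := by
        rw [← hX.apply_perm (Equiv.swap i₀ j₀), Equiv.swap_apply_left, Equiv.swap_apply_right,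
          Equiv.swap_apply_of_ne_of_ne hik.symm hjk.symm]
      have e2 : X ((i₀, j₀), k₀) ((j₀, i₀), k₀) = X ((j₀, i₀), k₀) ((i₀, j₀), k₀) := by
        rw [← hX.apply_perm (Equiv.swap i₀ j₀), Equiv.swap_apply_left, Equiv.swap_apply_right,
          Equiv.swap_apply_of_ne_of_ne hik.symm hjk.symm]
      have h1 : ∀ l, (X - x • 1) l ((i₀, j₀), k₀) - (X - x • 1) l ((j₀, i₀), k₀) = 0 := by
        intro l
        by_cases hl : l = ((i₀, j₀), k₀)
        · subst hl
          simp [x, e2, Matrix.one_apply, hij]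
        · by_cases hl' : l = ((j₀, i₀), k₀)
          · subst hl'
            simp [x, e1, Matrix.one_apply, hij.symm]
          · rw [hY.apply_distinct hij hik hjk hl hl',
              hY.apply_distinct hij.symm hjk hik hl' hl, sub_zero]
      intro l i j k hij' hik' hjk'
      obtain ⟨σ, rfl, rfl, rfl⟩ := exists_perm_triple hij hik hjk hij' hik' hjk'
      rw [hY.apply_perm_symm, hY.apply_perm_symm, h1]
    -- With only two indices the condition is vacuous and any scalar serves.
    · push Not at hex
      exact ⟨0, fun l i j k hij hik hjk => absurd (hex i j k hij hik) hjk⟩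
  refine ⟨x, ?_⟩
  have hY := hX.sub_smul_one x
  have hZ := hY.mul_one_add_swap₁₂ (-1)
  have hD : (Fintype.card a + -1 : ℂ) ≠ 0 := by
    rw [← sub_eq_add_neg, sub_ne_zero]
    exact_mod_cast (Fintype.one_lt_card (α := a)).ne'
  have := mul_tracelessProj_eq_zero (Y := X - x • 1) (ε := -1) (by norm_num) hD fun l => by
    obtain ⟨t, ht⟩ := hZ.exists_of_antisymm
      (by intro l i j k; rw [mul_one_add_swap₁₂_apply, mul_one_add_swap₁₂_apply]; ring)
      (by
        intro l i j k hij hik hjk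
        rw [mul_one_add_swap₁₂_apply]
        linear_combination hx l i j k hij hik hjk) l
    refine ⟨t, fun i j k => ?_⟩
    rw [← mul_one_add_swap₁₂_apply, ht]
    ring
  rwa [Matrix.sub_mul, Matrix.smul_mul, Matrix.one_mul, sub_eq_zero] at this

/-- Phases kill the off-diagonal entries, and transpositions equate the diagonal ones. -/
theorem exists_eq_smul_one_of_commute [Nonempty a] {C : Matrix a a ℂ}
    (hC : ∀ U ∈ Matrix.unitaryGroup a ℂ, U.map star * C = C * U.map star) :
    ∃ c : ℂ, C = c • 1 := by
  obtain ⟨i₀⟩ := ‹Nonempty a›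
  refine ⟨C i₀ i₀, ?_⟩
  ext i j
  rw [Matrix.smul_apply, Matrix.one_apply]
  split_ifs with h
  · subst h
    have h1 := congrFun (congrFun (hC _ (permU_mem (Equiv.swap i₀ i))) i) i₀
    have h2 : ∀ x, (i = Equiv.swap i₀ i x) ↔ x = i₀ := by
      intro x
      constructor
      · intro e
        apply (Equiv.swap i₀ i).injective
        rw [Equiv.swap_apply_left, ← e]
      · rintro rfl
        rw [Equiv.swap_apply_left]
    simp only [Matrix.mul_apply, Matrix.map_apply, permU, Matrix.of_apply, h2] at h1
    simpa [apply_ite] using h1.symm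
  · have h1 := congrFun (congrFun (hC _ (phase_mem i)) i) j
    have h2 : (phase i).map star = Matrix.diagonal fun m => if m = i then -Complex.I else 1 := by
      ext m n
      simp only [phase, Matrix.map_apply, Matrix.diagonal_apply]
      split_ifs <;> simp
    rw [h2, Matrix.diagonal_mul, Matrix.mul_diagonal, if_pos rfl, if_neg (Ne.symm h), mul_one] at h1
    have h3 : (1 + Complex.I) * C i j = 0 := by linear_combination -h1
    rcases mul_eq_zero.mp h3 with h4 | h4
    · simp [Complex.ext_iff] at h4
    · simp [h4]

/-- Pulled back along `symEmb`, an invariant operator commutes with every `Ū`, hence is scalar. -/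
theorem IsTripleInvariant.exists_defProj_mul_mul_defProj [Nonempty a]
    {X : Matrix ((a × a) × a) ((a × a) × a) ℂ} (hX : IsTripleInvariant X) {ε : ℂ}
    (hs : star ε = ε) : ∃ x : ℂ, defProj a ε * X * defProj a ε = x • defProj a ε := by
  obtain ⟨c, hc⟩ := exists_eq_smul_one_of_commute (C := (symEmb a ε)ᵀ * X * symEmb a ε) (by
    intro U hU
    rw [← Matrix.mul_assoc, ← Matrix.mul_assoc, ← transpose_symEmb_mul_tripleRep hU hs,
      Matrix.mul_assoc (symEmb a ε)ᵀ, hX U hU, Matrix.mul_assoc, Matrix.mul_assoc, Matrix.mul_assoc,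
      tripleRep_mul_symEmb hU, ← Matrix.mul_assoc, ← Matrix.mul_assoc])
  refine ⟨2 / (Fintype.card a + ε) * c, ?_⟩
  rw [defProj]
  simp only [Matrix.smul_mul, Matrix.mul_smul]
  rw [show symEmb a ε * (symEmb a ε)ᵀ * X * (symEmb a ε * (symEmb a ε)ᵀ) =
    symEmb a ε * ((symEmb a ε)ᵀ * X * symEmb a ε) * (symEmb a ε)ᵀ by
      simp only [Matrix.mul_assoc], hc]
  simp only [Matrix.smul_mul, Matrix.mul_smul, Matrix.mul_one, smul_smul]
  congr 1
  ring

end Rotations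

/-! ### Block structure of invariant operators. -/

section Pinching


variable {a : Type} [Fintype a] [DecidableEq a]

/-- Projections whose compression turns invariant operators into multiples of the projection. -/
def IsPrimitiveProj (Q : Matrix ((a × a) × a) ((a × a) × a) ℂ) : Prop :=
  Q.PosSemidef ∧ Q * Q = Q ∧ ∀ X, IsTripleInvariant X → ∃ x : ℂ, Q * X * Q = x • Q

theorem IsPrimitiveProj.mul_mul {Q : Matrix ((a × a) × a) ((a × a) × a) ℂ}
    (hQ : IsPrimitiveProj Q) {X : Matrix ((a × a) × a) ((a × a) × a) ℂ}
    (hX : IsTripleInvariant X) : Q * X * Q = ((Q * X).trace / Q.trace) • Q := by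
  obtain ⟨x, hx⟩ := hQ.2.2 X hX
  -- A positive operator of trace zero is zero, so the quotient by zero is harmless. This happens
  -- for the antisymmetric traceless projection at `d = 2`.
  by_cases h : Q.trace = 0
  · rw [hQ.1.trace_eq_zero_iff.mp h]
    simp
  · have := congrArg Matrix.trace hx
    rw [Matrix.trace_mul_cycle, hQ.2.1, Matrix.trace_smul, smul_eq_mul] at this
    rw [hx, this, mul_div_cancel_right₀ _ h]

variable (a) in
theorem card_add_one_ne_zero : (Fintype.card a + 1 : ℂ) ≠ 0 := Nat.cast_add_one_ne_zero _

variable (a) in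
theorem card_add_neg_one_ne_zero [Nontrivial a] : (Fintype.card a + -1 : ℂ) ≠ 0 := by
  rw [← sub_eq_add_neg, sub_ne_zero]
  exact_mod_cast (Fintype.one_lt_card (α := a)).ne'

theorem IsTripleInvariant.exists_tracelessProj_mul [Nontrivial a] {ε : ℂ} (hε : ε = 1 ∨ ε = -1)
    {X : Matrix ((a × a) × a) ((a × a) × a) ℂ} (hX : IsTripleInvariant X) :
    (∃ x : ℂ, X * tracelessProj a ε = x • tracelessProj a ε) ∧
      ∃ x : ℂ, tracelessProj a ε * X = x • tracelessProj a ε := by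
  have hs : star ε = ε := by rcases hε with rfl | rfl <;> simp
  have key : ∀ X, IsTripleInvariant X →
      ∃ x : ℂ, X * tracelessProj a ε = x • tracelessProj a ε := by
    intro X hX
    rcases hε with rfl | rfl
    · exact hX.exists_mul_tracelessProj_one
    · exact hX.exists_mul_tracelessProj_neg_one
  refine ⟨key X hX, ?_⟩
  obtain ⟨x, hx⟩ := key _ hX.conjTranspose
  refine ⟨star x, ?_⟩
  have := congrArg Matrix.conjTranspose hx
  rwa [Matrix.conjTranspose_mul, Matrix.conjTranspose_conjTranspose, Matrix.conjTranspose_smul,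
    conjTranspose_tracelessProj hs] at this

theorem isPrimitiveProj_tracelessProj [Nontrivial a] {ε : ℂ} (hε : ε = 1 ∨ ε = -1) :
    IsPrimitiveProj (tracelessProj a ε) := by
  have hs : star ε = ε := by rcases hε with rfl | rfl <;> simp
  have hε2 : ε * ε = 1 := by rcases hε with rfl | rfl <;> norm_num
  have h0 : (Fintype.card a + ε : ℂ) ≠ 0 := by
    rcases hε with rfl | rfl
    · exact card_add_one_ne_zero a
    · exact card_add_neg_one_ne_zero a
  have h2 := tracelessProj_mul_self (a := a) hε2 h0
  refine ⟨posSemidef_of_isIdempotent (conjTranspose_tracelessProj hs) h2, h2, fun X hX => ?_⟩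
  obtain ⟨x, hx⟩ := (hX.exists_tracelessProj_mul hε).2
  exact ⟨x, by rw [hx, Matrix.smul_mul, h2]⟩

theorem isPrimitiveProj_defProj [Nontrivial a] {ε : ℂ} (hε : ε = 1 ∨ ε = -1) :
    IsPrimitiveProj (defProj a ε) := by
  have hs : star ε = ε := by rcases hε with rfl | rfl <;> simp
  have hε2 : ε * ε = 1 := by rcases hε with rfl | rfl <;> norm_num
  have h0 : (Fintype.card a + ε : ℂ) ≠ 0 := by
    rcases hε with rfl | rfl
    · exact card_add_one_ne_zero a
    · exact card_add_neg_one_ne_zero a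
  have h2 := defProj_mul_self (a := a) hε2 h0
  exact ⟨posSemidef_of_isIdempotent (conjTranspose_defProj hs) h2, h2, fun X hX =>
    hX.exists_defProj_mul_mul_defProj hs⟩

/-- `X` acts as a scalar on both sides of each traceless projection, so their cross blocks vanish.
The two deformed copies of `Ū` are equivalent; their cross block may survive, and they stay
together. -/
theorem IsTripleInvariant.eq_pinched [Nontrivial a]
    {X : Matrix ((a × a) × a) ((a × a) × a) ℂ} (hX : IsTripleInvariant X) :
    X = tracelessProj a 1 * X * tracelessProj a 1 +
      tracelessProj a (-1) * X * tracelessProj a (-1) +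
      (defProj a 1 + defProj a (-1)) * X * (defProj a 1 + defProj a (-1)) := by
  obtain ⟨⟨x, hx⟩, x', hx'⟩ := hX.exists_tracelessProj_mul (Or.inl rfl : (1 : ℂ) = 1 ∨ _)
  obtain ⟨⟨y, hy⟩, y', hy'⟩ := hX.exists_tracelessProj_mul (Or.inr rfl : (-1 : ℂ) = 1 ∨ _)
  have e1 : (1 : ℂ) * 1 = 1 := one_mul 1
  have e2 : (-1 : ℂ) * -1 = 1 := by norm_num
  have d1 := card_add_one_ne_zero a
  have d2 := card_add_neg_one_ne_zero a
  have t : ∀ P Q : Matrix ((a × a) × a) ((a × a) × a) ℂ, Pᵀ = P → Qᵀ = Q → P * Q = 0 →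
      Q * P = 0 := by
    intro P Q hP hQ h
    have := congrArg Matrix.transpose h
    rwa [Matrix.transpose_mul, hP, hQ, Matrix.transpose_zero] at this
  have q12 := tracelessProj_mul_tracelessProj_neg (a := a) e1
  have q1A := tracelessProj_mul_defProj (a := a) e1 d1
  have q1B := tracelessProj_mul_defProj_neg (a := a) e1
  have q2B := tracelessProj_mul_defProj (a := a) e2 d2
  have q2A := tracelessProj_mul_defProj_neg (a := a) e2
  rw [neg_neg] at q2A
  have q21 := t _ _ (transpose_tracelessProj _) (transpose_tracelessProj _) q12
  have qA1 := t _ _ (transpose_tracelessProj _) (transpose_defProj _) q1A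
  have qB1 := t _ _ (transpose_tracelessProj _) (transpose_defProj _) q1B
  have qB2 := t _ _ (transpose_tracelessProj _) (transpose_defProj _) q2B
  have qA2 := t _ _ (transpose_tracelessProj _) (transpose_defProj _) q2A
  have hsum := sum_proj_eq_one (a := a) 1
  set Q₁ := tracelessProj a 1
  set Q₂ := tracelessProj a (-1)
  set A := defProj a 1
  set B := defProj a (-1)
  have c12 : Q₁ * X * Q₂ = 0 := by rw [hx', Matrix.smul_mul, q12, smul_zero]
  have c21 : Q₂ * X * Q₁ = 0 := by rw [hy', Matrix.smul_mul, q21, smul_zero]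
  have c1R : Q₁ * X * (A + B) = 0 := by
    rw [hx', Matrix.smul_mul, Matrix.mul_add, q1A, q1B, add_zero, smul_zero]
  have c2R : Q₂ * X * (A + B) = 0 := by
    rw [hy', Matrix.smul_mul, Matrix.mul_add, q2A, q2B, add_zero, smul_zero]
  have cR1 : (A + B) * X * Q₁ = 0 := by
    rw [Matrix.mul_assoc, hx, Matrix.mul_smul, Matrix.add_mul, qA1, qB1, add_zero, smul_zero]
  have cR2 : (A + B) * X * Q₂ = 0 := by
    rw [Matrix.mul_assoc, hy, Matrix.mul_smul, Matrix.add_mul, qA2, qB2, add_zero, smul_zero]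
  have hsum' : Q₁ + Q₂ + (A + B) = 1 := by rw [← hsum]; abel
  generalize A + B = R at *
  calc X = (Q₁ + Q₂ + R) * X * (Q₁ + Q₂ + R) := by rw [hsum', Matrix.one_mul, Matrix.mul_one]
    _ = _ := by
        simp only [Matrix.mul_add, Matrix.add_mul, c12, c21, c1R, c2R, cR1, cR2, add_zero,
          zero_add]

end Pinching

/-! ### The Haar moment operator and its upper bound. -/

section HaarMoment


variable {a : Type} [Fintype a] [DecidableEq a]

instance compactSpace_unitaryGroup : CompactSpace (Matrix.unitaryGroup a ℂ) := by
  have hK : IsCompact (Set.univ.pi fun _ : a => Set.univ.pi fun _ : a =>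
      Metric.closedBall (0 : ℂ) 1) :=
    isCompact_univ_pi fun _ => isCompact_univ_pi fun _ => isCompact_closedBall _ _
  refine (isCompact_iff_compactSpace (s := (Matrix.unitaryGroup a ℂ : Set (Matrix a a ℂ)))).mp
    (hK.of_isClosed_subset ?_ ?_)
  · have : (Matrix.unitaryGroup a ℂ : Set (Matrix a a ℂ)) = {U | U * star U = 1} := by
      ext U
      exact Matrix.mem_unitaryGroup_iff
    rw [this]
    exact isClosed_eq (by fun_prop) continuous_const
  · intro U hU i _ j _
    rw [mem_closedBall_zero_iff]
    exact entry_norm_bound_of_unitary hU i j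

variable [MeasurableSpace (Matrix.unitaryGroup a ℂ)] [BorelSpace (Matrix.unitaryGroup a ℂ)]
  (μ : Measure (Matrix.unitaryGroup a ℂ)) [IsProbabilityMeasure μ] [μ.IsHaarMeasure]

theorem integrable_of_continuous_unitaryGroup {f : Matrix.unitaryGroup a ℂ → ℂ}
    (hf : Continuous f) : Integrable f μ :=
  hf.integrable_of_hasCompactSupport (HasCompactSupport.of_compactSpace f)

theorem continuous_tripleRep_apply (p q : (a × a) × a) :
    Continuous fun U : Matrix.unitaryGroup a ℂ => tripleRep (U : Matrix a a ℂ) p q := by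
  have h : ∀ i j, Continuous fun U : Matrix.unitaryGroup a ℂ => (U : Matrix a a ℂ) i j :=
    fun i j => (continuous_subtype_val (p := (· ∈ Matrix.unitaryGroup a ℂ))).matrix_elem i j
  simp only [tripleRep_apply]
  exact (((h _ _).star).mul ((h _ _).star)).mul (h _ _)

/-- The moment operator of the representation `Ū ⊗ Ū ⊗ U`. -/
noncomputable def tripleMoment :
    Matrix (((a × a) × a) × ((a × a) × a)) (((a × a) × a) × ((a × a) × a)) ℂ :=
  Matrix.of fun x y => ∫ U : Matrix.unitaryGroup a ℂ,
    tripleRep (U : Matrix a a ℂ) x.1 x.2 * star (tripleRep (U : Matrix a a ℂ) y.1 y.2) ∂μ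

theorem integrable_tripleMoment (x y : ((a × a) × a) × ((a × a) × a)) :
    Integrable (fun U : Matrix.unitaryGroup a ℂ =>
      tripleRep (U : Matrix a a ℂ) x.1 x.2 * star (tripleRep (U : Matrix a a ℂ) y.1 y.2)) μ :=
  integrable_of_continuous_unitaryGroup μ
    ((continuous_tripleRep_apply _ _).mul (continuous_tripleRep_apply _ _).star)

theorem sum_sum_mul_tripleMoment
    (c : ((a × a) × a) × ((a × a) × a) → ((a × a) × a) × ((a × a) × a) → ℂ) :
    ∑ x, ∑ y, c x y * tripleMoment μ x y = ∫ U : Matrix.unitaryGroup a ℂ, ∑ x, ∑ y, c x y *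
      (tripleRep (U : Matrix a a ℂ) x.1 x.2 * star (tripleRep (U : Matrix a a ℂ) y.1 y.2)) ∂μ := by
  rw [integral_finsetSum _ fun x _ => integrable_finsetSum _ fun y _ =>
    (integrable_tripleMoment μ x y).const_mul _]
  refine Finset.sum_congr rfl fun x _ => ?_
  rw [integral_finsetSum _ fun y _ => (integrable_tripleMoment μ x y).const_mul _]
  refine Finset.sum_congr rfl fun y _ => ?_
  rw [integral_const_mul]
  rfl

/-- Its quadratic form is the average of the squared modulus of a linear form in the entries of
`T_U`. -/
theorem posSemidef_tripleMoment : (tripleMoment μ : Matrix _ _ ℂ).PosSemidef := by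
  refine Matrix.PosSemidef.of_dotProduct_mulVec_nonneg ?_ fun v => ?_
  · ext x y
    rw [Matrix.conjTranspose_apply]
    simp only [tripleMoment, Matrix.of_apply]
    refine integral_conj.symm.trans ?_
    refine integral_congr_ae (Filter.Eventually.of_forall fun U => ?_)
    simp [mul_comm]
  · have h : star v ⬝ᵥ (tripleMoment μ *ᵥ v) =
        ∑ x, ∑ y, (star (v x) * v y) * tripleMoment μ x y := by
      simp only [dotProduct, Matrix.mulVec, Finset.mul_sum, Pi.star_apply]
      refine Finset.sum_congr rfl fun x _ => Finset.sum_congr rfl fun y _ => ?_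
      ring
    have h2 : ∀ U : Matrix.unitaryGroup a ℂ, ∑ x, ∑ y, (star (v x) * v y) *
        (tripleRep (U : Matrix a a ℂ) x.1 x.2 * star (tripleRep (U : Matrix a a ℂ) y.1 y.2)) =
        ((Complex.normSq (∑ x, star (v x) * tripleRep (U : Matrix a a ℂ) x.1 x.2) : ℝ) : ℂ) := by
      intro U
      rw [← Complex.mul_conj, map_sum, Finset.sum_mul_sum]
      refine Finset.sum_congr rfl fun x _ => Finset.sum_congr rfl fun y _ => ?_
      simp only [map_mul, Complex.star_def, Complex.conj_conj]
      ring
    rw [h, sum_sum_mul_tripleMoment]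
    simp only [h2]
    rw [integral_complex_ofReal]
    exact_mod_cast integral_nonneg fun U => Complex.normSq_nonneg _

/-- The block of the moment operator at fixed second indices. -/
noncomputable def momentBlock (r r' : (a × a) × a) :
    Matrix ((a × a) × a) ((a × a) × a) ℂ :=
  Matrix.of fun l l' => tripleMoment μ (l, r) (l', r')

theorem momentBlock_eq (r r' l l' : (a × a) × a) : momentBlock μ r r' l l' =
    ∫ U : Matrix.unitaryGroup a ℂ, (tripleRep (U : Matrix a a ℂ) * Matrix.single r r' (1 : ℂ) *
      (tripleRep (U : Matrix a a ℂ))ᴴ) l l' ∂μ := by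
  refine integral_congr_ae (Filter.Eventually.of_forall fun U => ?_)
  dsimp only
  rw [Matrix.mul_apply]
  simp [Matrix.mul_apply, Matrix.single_apply, ite_and]

theorem integrable_conj_tripleRep (X : Matrix ((a × a) × a) ((a × a) × a) ℂ)
    (l l' : (a × a) × a) : Integrable (fun U : Matrix.unitaryGroup a ℂ =>
      (tripleRep (U : Matrix a a ℂ) * X * (tripleRep (U : Matrix a a ℂ))ᴴ) l l') μ := by
  refine integrable_of_continuous_unitaryGroup μ ?_
  simp only [Matrix.mul_apply, Matrix.conjTranspose_apply]
  exact continuous_finsetSum _ fun _ _ => (continuous_finsetSum _ fun _ _ =>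
    (continuous_tripleRep_apply _ _).mul continuous_const).mul (continuous_tripleRep_apply _ _).star

theorem mul_momentBlock_mul_apply (r r' l l' : (a × a) × a)
    (A B : Matrix ((a × a) × a) ((a × a) × a) ℂ) :
    (A * momentBlock μ r r' * B) l l' = ∫ U : Matrix.unitaryGroup a ℂ,
      (A * (tripleRep (U : Matrix a a ℂ) * Matrix.single r r' (1 : ℂ) *
        (tripleRep (U : Matrix a a ℂ))ᴴ) * B) l l' ∂μ := by
  rw [Matrix.mul_apply]
  simp only [Matrix.mul_apply (M := A), Matrix.mul_apply (M := A * _) (N := B)]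
  rw [integral_finsetSum _ fun x _ => (integrable_finsetSum _ fun y _ =>
    (integrable_conj_tripleRep μ _ y x).const_mul _).mul_const _]
  refine Finset.sum_congr rfl fun x _ => ?_
  rw [integral_mul_const, integral_finsetSum _ fun y _ =>
    (integrable_conj_tripleRep μ _ y x).const_mul _]
  congr 1
  refine Finset.sum_congr rfl fun y _ => ?_
  rw [integral_const_mul, momentBlock_eq]

theorem conjTranspose_mul_tripleRep {U : Matrix a a ℂ} (hU : U ∈ Matrix.unitaryGroup a ℂ) :
    (tripleRep U)ᴴ * tripleRep U = 1 := by
  rw [conjTranspose_tripleRep, ← tripleRep_mul, ← tripleRep_one]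
  congr 1
  exact Matrix.mem_unitaryGroup_iff'.mp hU

/-- Each block is a twirl of a matrix unit, so left invariance of Haar measure absorbs conjugation
by `T_V`. -/
theorem isTripleInvariant_momentBlock (r r' : (a × a) × a) :
    IsTripleInvariant (momentBlock μ r r') := by
  intro V hV
  have key : tripleRep V * momentBlock μ r r' * (tripleRep V)ᴴ = momentBlock μ r r' := by
    ext l l'
    rw [mul_momentBlock_mul_apply, momentBlock_eq]
    refine Eq.trans ?_ (integral_mul_left_eq_self _ (⟨V, hV⟩ : Matrix.unitaryGroup a ℂ))
    refine integral_congr_ae (Filter.Eventually.of_forall fun U => ?_)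
    simp only [Submonoid.coe_mul, tripleRep_mul, Matrix.conjTranspose_mul, Matrix.mul_assoc]
  calc tripleRep V * momentBlock μ r r' =
      tripleRep V * momentBlock μ r r' * ((tripleRep V)ᴴ * tripleRep V) := by
        rw [conjTranspose_mul_tripleRep hV, Matrix.mul_one]
    _ = momentBlock μ r r' * tripleRep V := by rw [← Matrix.mul_assoc, key]

theorem trace_mul_momentBlock {Q : Matrix ((a × a) × a) ((a × a) × a) ℂ}
    (hQ : IsTripleInvariant Q) (r r' : (a × a) × a) :
    (Q * momentBlock μ r r').trace = Q r' r := by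
  have h1 : (Q * momentBlock μ r r').trace = ∫ U : Matrix.unitaryGroup a ℂ,
      (Q * (tripleRep (U : Matrix a a ℂ) * Matrix.single r r' (1 : ℂ) *
        (tripleRep (U : Matrix a a ℂ))ᴴ)).trace ∂μ := by
    have h := fun l => mul_momentBlock_mul_apply μ r r' l l Q 1
    simp only [Matrix.mul_one] at h
    simp only [Matrix.trace, Matrix.diag_apply, h]
    rw [integral_finsetSum]
    intro l _
    simp only [Matrix.mul_apply (M := Q)]
    exact integrable_finsetSum _ fun y _ => (integrable_conj_tripleRep μ _ y l).const_mul _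
  have h2 : ∀ U : Matrix.unitaryGroup a ℂ, (Q * (tripleRep (U : Matrix a a ℂ) *
      Matrix.single r r' (1 : ℂ) * (tripleRep (U : Matrix a a ℂ))ᴴ)).trace = Q r' r := by
    intro U
    rw [← Matrix.mul_assoc, ← Matrix.mul_assoc, Matrix.trace_mul_comm, ← Matrix.mul_assoc,
      ← Matrix.mul_assoc, Matrix.mul_assoc _ Q, ← hQ U U.2, ← Matrix.mul_assoc,
      conjTranspose_mul_tripleRep U.2, Matrix.one_mul, Matrix.trace_mul_single]
    simp
  rw [h1]
  simp only [h2, integral_const, probReal_univ, one_smul]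

theorem isTripleInvariant_tracelessProj {ε : ℂ} (hs : star ε = ε) :
    IsTripleInvariant (tracelessProj a ε) := fun _ hU => tripleRep_mul_tracelessProj hU hs

theorem isTripleInvariant_defProj {ε : ℂ} (hs : star ε = ε) :
    IsTripleInvariant (defProj a ε) := fun _ hU => tripleRep_mul_defProj hU hs

variable (a) in
/-- An upper bound of the moment operator. -/
noncomputable def momentBound :
    Matrix (((a × a) × a) × ((a × a) × a)) (((a × a) × a) × ((a × a) × a)) ℂ :=
  (tracelessProj a 1).trace⁻¹ • (tracelessProj a 1 ⊗ₖ tracelessProj a 1) +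
    (tracelessProj a (-1)).trace⁻¹ • (tracelessProj a (-1) ⊗ₖ tracelessProj a (-1)) +
    (2 / Fintype.card a : ℂ) • (defProj a 1 ⊗ₖ defProj a 1 + defProj a (-1) ⊗ₖ defProj a (-1))

/-- On the block of the two copies of `Ū`, `2 (A X A + B X B) - (A + B) X (A + B) = (A - B) X (A -
B)`, and elsewhere the bound is exact. The difference is therefore a congruence of the positive
moment operator by `(A - B) ⊗ 1`. -/
theorem posSemidef_momentBound_sub [Nontrivial a] :
    (momentBound a - tripleMoment μ).PosSemidef := by
  set T := (defProj a 1 - defProj a (-1)) ⊗ₖ (1 : Matrix ((a × a) × a) ((a × a) × a) ℂ)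
  have hs1 : star (1 : ℂ) = 1 := star_one _
  have hs2 : star (-1 : ℂ) = -1 := by simp
  have hT : Tᴴ = T := by
    rw [Matrix.conjTranspose_kronecker, Matrix.conjTranspose_sub, conjTranspose_defProj hs1,
      conjTranspose_defProj hs2, Matrix.conjTranspose_one]
  have key : momentBound a - tripleMoment μ = T * tripleMoment μ * Tᴴ := by
    rw [hT]
    ext ⟨l, r⟩ ⟨l', r'⟩
    have h1 : (T * tripleMoment μ * T) (l, r) (l', r') =
        ((defProj a 1 - defProj a (-1)) * momentBlock μ r r' *
          (defProj a 1 - defProj a (-1))) l l' := by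
      rw [Matrix.mul_apply, Matrix.mul_apply, Fintype.sum_prod_type]
      refine Finset.sum_congr rfl fun x _ => ?_
      rw [Finset.sum_eq_single r']
      · rw [Matrix.mul_apply, Matrix.mul_apply, Fintype.sum_prod_type]
        simp only [T, Matrix.kroneckerMap_apply, Matrix.one_apply_eq, mul_one]
        congr 1
        refine Finset.sum_congr rfl fun y _ => ?_
        rw [Finset.sum_eq_single r]
        · simp [momentBlock]
        · intro z _ hz
          simp [Matrix.one_apply_ne hz.symm]
        · simp
      · intro z _ hz
        simp [T, Matrix.one_apply_ne hz]
      · simp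
    have hX := isTripleInvariant_momentBlock μ r r'
    have h2 : tripleMoment μ (l, r) (l', r') = momentBlock μ r r' l l' := rfl
    have hP := hX.eq_pinched
    have hA := (isPrimitiveProj_defProj (a := a) (Or.inl rfl)).mul_mul hX
    have hB := (isPrimitiveProj_defProj (a := a) (Or.inr rfl)).mul_mul hX
    rw [(isPrimitiveProj_tracelessProj (a := a) (Or.inl rfl)).mul_mul hX,
      (isPrimitiveProj_tracelessProj (a := a) (Or.inr rfl)).mul_mul hX,
      trace_mul_momentBlock μ (isTripleInvariant_tracelessProj hs1),
      trace_mul_momentBlock μ (isTripleInvariant_tracelessProj hs2)] at hP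
    rw [trace_mul_momentBlock μ (isTripleInvariant_defProj hs1),
      trace_defProj (by norm_num) (card_add_one_ne_zero a)] at hA
    rw [trace_mul_momentBlock μ (isTripleInvariant_defProj hs2),
      trace_defProj (by norm_num) (card_add_neg_one_ne_zero a)] at hB
    have hsym : ∀ (Q : Matrix ((a × a) × a) ((a × a) × a) ℂ), Qᵀ = Q → Q r' r = Q r r' := by
      intro Q hQ
      conv_lhs => rw [← hQ, Matrix.transpose_apply]
    have h3 : ∀ A B X : Matrix ((a × a) × a) ((a × a) × a) ℂ, (A - B) * X * (A - B) =
        (2 : ℂ) • (A * X * A) + (2 : ℂ) • (B * X * B) - (A + B) * X * (A + B) := by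
      intro A B X
      simp only [Matrix.sub_mul, Matrix.mul_sub, Matrix.add_mul, Matrix.mul_add, two_smul]
      abel
    rw [h1, Matrix.sub_apply, h2, h3, hA, hB]
    have hP' := congrFun (congrFun hP l) l'
    rw [Matrix.add_apply, Matrix.add_apply] at hP'
    rw [hP']
    simp only [momentBound, Matrix.add_apply, Matrix.sub_apply, Matrix.smul_apply, smul_eq_mul,
      Matrix.kroneckerMap_apply, hsym _ (transpose_defProj _), hsym _ (transpose_tracelessProj _)]
    ring
  rw [key]
  exact (posSemidef_tripleMoment μ).mul_mul_conjTranspose_same T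

end HaarMoment

/-! ### Admissible dual operators and their normalization. -/

section DualBound


variable {a : Type} [Fintype a] [DecidableEq a]

theorem trace_mul_nonneg_of_posSemidef {n : Type} [Fintype n] [DecidableEq n] {J X : Matrix n n ℂ}
    (hJ : J.PosSemidef) (hX : X.PosSemidef) : 0 ≤ (J * X).trace.re := by
  obtain ⟨B, rfl⟩ := exists_conjTranspose_mul_self hJ
  rw [Matrix.mul_assoc, Matrix.trace_mul_comm]
  exact (Complex.le_def.mp (hX.mul_mul_conjTranspose_same B).trace_nonneg).1

theorem choi_conjBy {b c : Type} [Fintype b] [DecidableEq b] [Fintype c] [DecidableEq c]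
    (K : Matrix c b ℂ) (p q : c × b) :
    choi (conjBy K) p q = K p.1 p.2 * star (K q.1 q.2) := by
  simp [choi_apply, conjBy, sandwich_apply, Matrix.mul_apply, Matrix.single_apply, ite_and]

/-- Regrouping indices shows the fidelity as the quadratic form of `superChoi S` at the vectorized
`T_U`. The target `Uᵀ` supplies the factor `U` between `C_i` and `C_o`. -/
theorem trace_choi_forward_mul_choi
    (S : OpMap (a × a) (a × a) →ₗ[ℂ] OpMap a a) (U : Matrix a a ℂ) :
    (choi (forward S (conjBy U) (conjBy U)) * choi (conjBy Uᵀ)).trace =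
      ∑ x, ∑ y, superChoi S x y * (tripleRep U y.1 y.2 * star (tripleRep U x.1 x.2)) := by
  have hsum : ∀ f : ((a × a) × a) × ((a × a) × a) → ℂ,
      ∑ x, f x = ∑ p : a × a, ∑ q : (a × a) × (a × a), f ((q.1, p.2), (q.2, p.1)) := by
    intro f
    rw [← Fintype.sum_prod_type' (f := fun (p : a × a) (q : (a × a) × (a × a)) =>
      f ((q.1, p.2), (q.2, p.1)))]
    exact Fintype.sum_equiv
      ⟨fun x => ((x.2.2, x.1.2), (x.1.1, x.2.1)), fun y => ((y.2.1, y.1.2), (y.2.2, y.1.1)),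
        fun _ => rfl, fun _ => rfl⟩ _ _ fun _ => rfl
  rw [Matrix.trace, hsum]
  simp only [Matrix.diag_apply, Matrix.mul_apply]
  refine Finset.sum_congr rfl fun p _ => ?_
  simp only [hsum]
  rw [Finset.sum_comm (s := (Finset.univ : Finset ((a × a) × (a × a))))]
  refine Finset.sum_congr rfl fun q _ => ?_
  rw [choi_apply, forward, choi_superMap, Finset.sum_mul]
  refine Finset.sum_congr rfl fun u _ => ?_
  rw [Finset.sum_mul]
  refine Finset.sum_congr rfl fun v _ => ?_
  rw [choi_tensorMap]
  simp only [Matrix.submatrix_apply, Matrix.kroneckerMap_apply, choi_conjBy, tripleRep_apply,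
    Matrix.transpose_apply, star_mul', star_star]
  ring

variable {m : ℕ}

/-- Choi operators of a family of two-slot no-signalling maps, controlled by a third input. -/
noncomputable def swapFamily (G : Matrix ((a × a) × Fin m) ((a × a) × Fin m) ℂ) (β : ℂ) :
    Matrix (((a × a) × Fin m) × (a × a)) (((a × a) × Fin m) × (a × a)) ℂ :=
  G ⊗ₖ 1 + β • (((swapOp a - (Fintype.card a : ℂ)⁻¹ • 1) ⊗ₖ 1) ⊗ₖ swapOp a)

theorem trace_swapOp : (swapOp a).trace = Fintype.card a := by
  simp [Matrix.trace, swapOp_apply, Fintype.sum_prod_type, ite_and]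

theorem trace_swapOp_sub [Nonempty a] :
    (swapOp a - (Fintype.card a : ℂ)⁻¹ • 1).trace = 0 := by
  have hd : (Fintype.card a : ℂ) ≠ 0 := Nat.cast_ne_zero.mpr Fintype.card_ne_zero
  rw [Matrix.trace_sub, trace_swapOp, Matrix.trace_smul, Matrix.trace_one, Fintype.card_prod,
    smul_eq_mul]
  push_cast
  rw [inv_mul_cancel_left₀ hd, sub_self]

theorem isChannel_slotMap_swapFamily [Nonempty a]
    {G : Matrix ((a × a) × Fin m) ((a × a) × Fin m) ℂ} {β : ℂ}
    (hN : (swapFamily G β).PosSemidef)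
    (hG : ∀ k l, ∑ i, G (i, k) (i, l) = if k = l then 1 else 0) :
    IsChannel (slotMap (swapFamily G β)) := by
  refine isChannel_slotMap hN fun k l α α' => ?_
  have h : ∑ i, (swapOp a - (Fintype.card a : ℂ)⁻¹ • 1 : Matrix (a × a) (a × a) ℂ) i i = 0 :=
    trace_swapOp_sub
  have h1 : ∑ i, swapFamily G β ((i, k), α) ((i, l), α') =
      (∑ i, G (i, k) (i, l)) * (1 : Matrix (a × a) (a × a) ℂ) α α' +
      β * ((∑ i, (swapOp a - (Fintype.card a : ℂ)⁻¹ • 1 : Matrix (a × a) (a × a) ℂ) i i) *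
        (1 : Matrix (Fin m) (Fin m) ℂ) k l * swapOp a α α') := by
    simp only [swapFamily, Matrix.add_apply, Matrix.smul_apply, Matrix.kroneckerMap_apply,
      smul_eq_mul, Finset.sum_add_distrib, Finset.sum_mul, Finset.mul_sum]
  rw [h1, hG, h, Matrix.one_apply, zero_mul, zero_mul, mul_zero, add_zero, ite_and]
  split_ifs <;> simp

/-- The state `σ` only affects an operator prepared independently of the slot inputs. The other term
is the swap correlation, where `Tr σ = 1`. Both lie in the span of products. -/
theorem isNoSignalling_reduced_slotMap_swapFamily [Nonempty a]
    {G : Matrix ((a × a) × Fin m) ((a × a) × Fin m) ℂ} {β : ℂ}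
    (hN : (swapFamily G β).PosSemidef)
    (hG : ∀ k l, ∑ i, G (i, k) (i, l) = if k = l then 1 else 0)
    {σ : Matrix (Fin m) (Fin m) ℂ} (hσ : IsDensity σ) :
    IsNoSignalling (reduced (slotMap (swapFamily G β)) σ) := by
  refine isNoSignalling_of_mem_productSpan
    (isChannel_reduced (isChannel_slotMap_swapFamily hN hG) hσ) ?_
  have : reduced (slotMap (swapFamily G β)) σ =
      measurePrepare 1 (Matrix.of fun b b' => ∑ k, ∑ l, σ k l * G (b, k) (b', l)) +
        β • measurePrepare (swapOp a) (swapOp a - (Fintype.card a : ℂ)⁻¹ • 1) := by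
    apply ext_choi
    rw [choi_add, choi_smul, choi_measurePrepare, choi_measurePrepare]
    ext ⟨b, α⟩ ⟨b', α'⟩
    have hσ1 : ∑ k, σ k k = 1 := hσ.2
    change ∑ k : Fin 1, slotMap (swapFamily G β) (Matrix.single α α' 1 ⊗ₖ σ) (b, k) (b', k) = _
    have h1 : slotMap (swapFamily G β) (Matrix.single α α' 1 ⊗ₖ σ) (b, 0) (b', 0) =
        ∑ k, ∑ l, σ k l * swapFamily G β ((b, k), α) ((b', l), α') := by
      simp only [slotMap_apply, Fintype.sum_prod_type, Matrix.kroneckerMap_apply,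
        Matrix.single_apply, ite_and, ite_mul, one_mul, zero_mul, Finset.sum_ite_irrel,
        Finset.sum_const_zero, Finset.sum_ite_eq, Finset.mem_univ, if_true]
    simp only [Finset.univ_unique, Fin.default_eq_zero, Finset.sum_singleton, h1]
    simp only [swapFamily, Matrix.add_apply, Matrix.smul_apply, Matrix.kroneckerMap_apply,
      smul_eq_mul, mul_add, Finset.sum_add_distrib, Matrix.transpose_one, transpose_swapOp,
      Matrix.of_apply, Finset.sum_mul, mul_assoc]
    congr 1
    simp only [Matrix.one_apply, ite_mul, one_mul, zero_mul, mul_ite, mul_zero, Finset.sum_ite_eq,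
      Finset.mem_univ, if_true, ← Finset.sum_mul, hσ1]
  rw [this]
  exact Submodule.add_mem _ (measurePrepare_one_mem_productSpan _)
    (Submodule.smul_mem _ _ measurePrepare_swapOp_mem_productSpan)

/-- `sum_superChoi` pairs `N` and `superChoi S` entrywise, which is a trace of the product because
`N` is symmetric. -/
theorem IsSupermap.trace_superChoi_mul [Nonempty a] {Co : Type} [Fintype Co] [DecidableEq Co]
    {S : OpMap (a × a) (a × a) →ₗ[ℂ] OpMap (Fin m) Co} (hS : IsSupermap S)
    {G : Matrix ((a × a) × Fin m) ((a × a) × Fin m) ℂ} {β : ℂ}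
    (hN : (swapFamily G β).PosSemidef) (hGt : Gᵀ = G)
    (hG : ∀ k l, ∑ i, G (i, k) (i, l) = if k = l then 1 else 0) :
    (superChoi S * (swapFamily G β ⊗ₖ (1 : Matrix Co Co ℂ)).submatrix
      (fun x : ((a × a) × Fin m) × ((a × a) × Co) => ((x.1, x.2.1), x.2.2))
      (fun x : ((a × a) × Fin m) × ((a × a) × Co) => ((x.1, x.2.1), x.2.2))).trace = m := by
  rw [← hS.sum_superChoi (isChannel_slotMap_swapFamily hN hG)
    fun σ hσ => isNoSignalling_reduced_slotMap_swapFamily hN hG hσ]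
  have ht : (swapFamily G β)ᵀ = swapFamily G β := by
    simp only [swapFamily, Matrix.transpose_add, Matrix.transpose_smul,
      ← Matrix.kroneckerMap_transpose, hGt, Matrix.transpose_one, Matrix.transpose_sub,
      transpose_swapOp]
  have ht' : ∀ u v, swapFamily G β v u = swapFamily G β u v := fun u v => by
    conv_lhs => rw [← ht, Matrix.transpose_apply]
  have hsum : ∀ f : ((a × a) × Fin m) × ((a × a) × Co) → ℂ,
      ∑ x, f x = ∑ u : ((a × a) × Fin m) × (a × a), ∑ i, f (u.1, (u.2, i)) := by
    intro f
    simp only [Fintype.sum_prod_type]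
  rw [Matrix.trace, hsum]
  simp only [Matrix.diag_apply, Matrix.mul_apply]
  refine Finset.sum_congr rfl fun u _ => ?_
  symm
  rw [Finset.sum_comm]
  refine Finset.sum_congr rfl fun i _ => ?_
  symm
  rw [hsum]
  refine Finset.sum_congr rfl fun v _ => ?_
  rw [Finset.sum_eq_single i]
  · simp [ht', mul_comm]
  · intro j _ hj
    simp [Matrix.one_apply_ne hj]
  · simp

theorem sum_symProj_apply (ε : ℂ) (k l : a) : ∑ i, symProj a ε (i, k) (i, l) =
    if k = l then (Fintype.card a : ℂ) * (Fintype.card a + ε) / 2 else 0 := by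
  have h : ∀ i j, symProj a ε ((i, j), k) ((i, j), l) = (2 : ℂ)⁻¹ *
      ((if k = l then 1 else 0) + ε * (if i = j ∧ k = l then 1 else 0)) := by
    intro i j
    simp only [symProj, Matrix.smul_apply, Matrix.add_apply, smul_eq_mul, Matrix.one_apply,
      swap₁₂_apply, Prod.mk.injEq, true_and, eq_comm (a := j), and_self]
  rw [Fintype.sum_prod_type]
  simp only [h, ← Finset.mul_sum, Finset.sum_add_distrib, ite_and, Finset.sum_ite_eq,
    Finset.mem_univ, if_true, Finset.sum_const, Finset.card_univ, nsmul_eq_mul]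
  split_ifs
  · ring
  · ring

theorem sum_defProj_apply {ε : ℂ} (hε : ε * ε = 1) (h0 : (Fintype.card a + ε : ℂ) ≠ 0) (k l : a) :
    ∑ i, defProj a ε (i, k) (i, l) = if k = l then 1 else 0 := by
  have h : ∀ i j, defProj a ε ((i, j), k) ((i, j), l) = 2 / (Fintype.card a + ε) *
      ∑ m, symEmb a ε ((i, j), k) m * symEmb a ε ((i, j), l) m := by
    intro i j
    rw [defProj, Matrix.smul_apply, Matrix.mul_apply, smul_eq_mul]
    rfl
  rw [Fintype.sum_prod_type]
  simp only [h, ← Finset.mul_sum, symEmb_apply]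
  have h2 : ∑ i, ∑ j, ∑ m, (2 : ℂ)⁻¹ *
      ((if i = k ∧ j = m then 1 else 0) + ε * (if j = k ∧ i = m then 1 else 0)) * ((2 : ℂ)⁻¹ *
      ((if i = l ∧ j = m then 1 else 0) + ε * (if j = l ∧ i = m then 1 else 0))) =
      if k = l then (Fintype.card a + ε) / 2 else 0 := by
    simp only [mul_add, add_mul, Finset.sum_add_distrib, ite_and, mul_ite, mul_one, mul_zero,
      ite_mul, zero_mul, Finset.sum_ite_irrel, Finset.sum_const_zero, Finset.sum_ite_eq,
      Finset.sum_ite_eq', Finset.mem_univ, if_true, Finset.sum_const, Finset.card_univ,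
      nsmul_eq_mul]
    simp only [eq_comm (a := l) (b := k)]
    split_ifs
    · linear_combination (Fintype.card a / 4 : ℂ) * hε
    · ring
  rw [h2]
  split_ifs
  · field_simp
  · rw [mul_zero]

theorem sum_tracelessProj_apply {ε : ℂ} (hε : ε * ε = 1) (h0 : (Fintype.card a + ε : ℂ) ≠ 0)
    (k l : a) : ∑ i, tracelessProj a ε (i, k) (i, l) =
      if k = l then (tracelessProj a ε).trace / Fintype.card a else 0 := by
  by_cases hd : (Fintype.card a : ℂ) = 0
  · have := Fintype.card_eq_zero_iff.mp (Nat.cast_eq_zero.mp hd)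
    exact this.elim k
  simp only [tracelessProj, Matrix.sub_apply, Finset.sum_sub_distrib, sum_symProj_apply,
    sum_defProj_apply hε h0]
  rw [← tracelessProj, trace_tracelessProj hε h0]
  split_ifs
  · field_simp
  · ring

end DualBound

/-! ### Dual certificates for the two ranges of dimension. -/

section AverageFidelity


variable {d : ℕ}

theorem swapFamily_kronecker_one (G : Matrix ((Fin d × Fin d) × Fin d) ((Fin d × Fin d) × Fin d) ℂ)
    (β : ℂ) : (swapFamily G β ⊗ₖ (1 : Matrix (Fin d) (Fin d) ℂ)).submatrix
      (fun x : ((Fin d × Fin d) × Fin d) × ((Fin d × Fin d) × Fin d) => ((x.1, x.2.1), x.2.2))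
      (fun x : ((Fin d × Fin d) × Fin d) × ((Fin d × Fin d) × Fin d) => ((x.1, x.2.1), x.2.2)) =
    G ⊗ₖ 1 + β • ((swap₁₂ (Fin d) - (d : ℂ)⁻¹ • 1) ⊗ₖ swap₁₂ (Fin d)) := by
  have h1 : ∀ (p q : (Fin d × Fin d) × Fin d),
      (1 : Matrix ((Fin d × Fin d) × Fin d) ((Fin d × Fin d) × Fin d) ℂ) p q =
        (1 : Matrix (Fin d × Fin d) (Fin d × Fin d) ℂ) p.1 q.1 *
          (1 : Matrix (Fin d) (Fin d) ℂ) p.2 q.2 := by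
    intro p q
    rw [← Matrix.one_kronecker_one, Matrix.kroneckerMap_apply]
  ext x y
  simp only [swapFamily, swap₁₂, Matrix.submatrix_apply, Matrix.kroneckerMap_apply,
    Matrix.add_apply, Matrix.sub_apply, Matrix.smul_apply, smul_eq_mul, h1, Fintype.card_fin]
  ring

section Haar

variable [MeasurableSpace (Matrix.unitaryGroup (Fin d) ℂ)]
  [BorelSpace (Matrix.unitaryGroup (Fin d) ℂ)]
  (μ : Measure (Matrix.unitaryGroup (Fin d) ℂ)) [IsProbabilityMeasure μ] [μ.IsHaarMeasure]
  (S : OpMap (Fin d × Fin d) (Fin d × Fin d) →ₗ[ℂ] OpMap (Fin d) (Fin d))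

theorem integrable_trace_choi_forward : Integrable (fun U : Matrix.unitaryGroup (Fin d) ℂ =>
    (choi (forward S (conjBy (U : Matrix (Fin d) (Fin d) ℂ)) (conjBy U)) *
      choi (conjBy (U : Matrix (Fin d) (Fin d) ℂ)ᵀ)).trace) μ := by
  simp only [trace_choi_forward_mul_choi]
  exact integrable_finsetSum _ fun x _ => integrable_finsetSum _ fun y _ =>
    (integrable_tripleMoment μ y x).const_mul _

theorem integrable_transposeFidelity : Integrable (fun U : Matrix.unitaryGroup (Fin d) ℂ =>
    transposeFidelity S (U : Matrix (Fin d) (Fin d) ℂ)) μ :=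
  ((integrable_trace_choi_forward μ S).re).div_const _

theorem integral_transposeFidelity : ∫ U : Matrix.unitaryGroup (Fin d) ℂ,
    transposeFidelity S (U : Matrix (Fin d) (Fin d) ℂ) ∂μ =
      (superChoi S * tripleMoment μ).trace.re / (d : ℝ) ^ 2 := by
  have h : (superChoi S * tripleMoment μ).trace = ∫ U : Matrix.unitaryGroup (Fin d) ℂ,
      (choi (forward S (conjBy (U : Matrix (Fin d) (Fin d) ℂ)) (conjBy U)) *
        choi (conjBy (U : Matrix (Fin d) (Fin d) ℂ)ᵀ)).trace ∂μ := by
    simp only [trace_choi_forward_mul_choi]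
    have h1 := sum_sum_mul_tripleMoment μ fun y x => superChoi S x y
    rw [Finset.sum_comm] at h1
    refine Eq.trans ?_ (h1.trans ?_)
    · simp only [Matrix.trace, Matrix.diag_apply, Matrix.mul_apply]
    · refine integral_congr_ae (Filter.Eventually.of_forall fun U => ?_)
      exact Finset.sum_comm
  have h2 := Complex.reCLM.integral_comp_comm (integrable_trace_choi_forward μ S)
  rw [h]
  simp only [transposeFidelity]
  rw [integral_div]
  congr 1

variable {S}

/-- Weak duality: with `Γ = t (N ⊗ 1)`, `Tr[J M] ≤ Tr[J momentBound] ≤ Tr[J Γ] = t d`. -/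
theorem IsSupermap.integral_transposeFidelity_le (hd : 2 ≤ d) (hS : IsSupermap S)
    {G : Matrix ((Fin d × Fin d) × Fin d) ((Fin d × Fin d) × Fin d) ℂ} {β : ℂ} {t : ℝ} (ht : 0 < t)
    (hΓ : ((t : ℂ) • (G ⊗ₖ (1 : Matrix ((Fin d × Fin d) × Fin d) ((Fin d × Fin d) × Fin d) ℂ) +
      β • ((swap₁₂ (Fin d) - (d : ℂ)⁻¹ • 1) ⊗ₖ swap₁₂ (Fin d)))).PosSemidef)
    (hΓ' : ((t : ℂ) • (G ⊗ₖ (1 : Matrix ((Fin d × Fin d) × Fin d) ((Fin d × Fin d) × Fin d) ℂ) +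
      β • ((swap₁₂ (Fin d) - (d : ℂ)⁻¹ • 1) ⊗ₖ swap₁₂ (Fin d))) - momentBound (Fin d)).PosSemidef)
    (hGt : Gᵀ = G) (hG : ∀ k l, ∑ i, G (i, k) (i, l) = if k = l then 1 else 0) :
    ∫ U : Matrix.unitaryGroup (Fin d) ℂ,
      transposeFidelity S (U : Matrix (Fin d) (Fin d) ℂ) ∂μ ≤ t / d := by
  have : Nontrivial (Fin d) := Fin.nontrivial_iff_two_le.mpr hd
  have hd0 : (0 : ℝ) < d := by exact_mod_cast (by omega : 0 < d)
  -- `N` is recovered from `Γ / t` by fixing one basis vector of `C_o`.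
  have hN : (swapFamily G β).PosSemidef := by
    have i₀ : Fin d := ⟨0, by omega⟩
    have h1 := (hΓ.smul (show (0 : ℂ) ≤ (t : ℂ)⁻¹ by
      rw [← Complex.ofReal_inv]; exact_mod_cast (inv_pos.mpr ht).le)).submatrix
      (fun u : ((Fin d × Fin d) × Fin d) × (Fin d × Fin d) => (u.1, (u.2, i₀)))
    rw [inv_smul_smul₀ (by exact_mod_cast ht.ne'), ← swapFamily_kronecker_one] at h1
    convert h1 using 1
    ext u v
    simp
  have htr := hS.trace_superChoi_mul hN hGt hG
  rw [swapFamily_kronecker_one] at htr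
  have hJ := hS.superChoi_posSemidef
  have h2 := trace_mul_nonneg_of_posSemidef hJ (posSemidef_momentBound_sub μ)
  have h3 := trace_mul_nonneg_of_posSemidef hJ hΓ'
  rw [Matrix.mul_sub, Matrix.trace_sub, Complex.sub_re] at h2 h3
  rw [Matrix.mul_smul, Matrix.trace_smul, htr, smul_eq_mul, ← Complex.ofReal_natCast,
    ← Complex.ofReal_mul, Complex.ofReal_re] at h3
  rw [integral_transposeFidelity, div_le_div_iff₀ (by positivity) hd0]
  nlinarith

end Haar

theorem posSemidef_one_sub_of_isPrimitiveProj {a : Type} [Fintype a] [DecidableEq a]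
    {Q : Matrix ((a × a) × a) ((a × a) × a) ℂ}
    (hQ : IsPrimitiveProj Q) : (1 - Q).PosSemidef := by
  refine posSemidef_of_isIdempotent ?_ ?_
  · rw [Matrix.conjTranspose_sub, Matrix.conjTranspose_one, hQ.1.isHermitian.eq]
  · rw [Matrix.mul_sub, Matrix.mul_one, Matrix.sub_mul, Matrix.one_mul, hQ.2.1, sub_self, sub_zero]

theorem IsSupermap.integral_transposeFidelity_le_of_two_lt
    [MeasurableSpace (Matrix.unitaryGroup (Fin d) ℂ)]
    [BorelSpace (Matrix.unitaryGroup (Fin d) ℂ)]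
    (μ : Measure (Matrix.unitaryGroup (Fin d) ℂ)) [IsProbabilityMeasure μ] [μ.IsHaarMeasure]
    {S : OpMap (Fin d × Fin d) (Fin d × Fin d) →ₗ[ℂ] OpMap (Fin d) (Fin d)} (hd : 2 < d)
    (hS : IsSupermap S) : ∫ U : Matrix.unitaryGroup (Fin d) ℂ,
      transposeFidelity S (U : Matrix (Fin d) (Fin d) ℂ) ∂μ ≤ 6 / (d : ℝ) ^ 2 := by
  have : Nontrivial (Fin d) := Fin.nontrivial_iff_two_le.mpr hd.le
  have hdR : (0 : ℝ) < d := by exact_mod_cast (by omega : 0 < d)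
  have hd0 : (d : ℂ) ≠ 0 := by exact_mod_cast hdR.ne'
  have c1 := card_add_one_ne_zero (Fin d)
  have c2 := card_add_neg_one_ne_zero (Fin d)
  have p1 := isPrimitiveProj_tracelessProj (a := Fin d) (ε := 1) (Or.inl rfl)
  have p2 := isPrimitiveProj_tracelessProj (a := Fin d) (ε := -1) (Or.inr rfl)
  have pA := isPrimitiveProj_defProj (a := Fin d) (ε := 1) (Or.inl rfl)
  have pB := isPrimitiveProj_defProj (a := Fin d) (ε := -1) (Or.inr rfl)
  have t1 : (tracelessProj (Fin d) 1).trace ≠ 0 := by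
    rw [trace_tracelessProj (by norm_num) c1, Fintype.card_fin,
      show (d : ℂ) ^ 2 * (d + 1) / 2 - d = d * (d - 1) * (d + 2) / 2 by ring]
    have h1 : (d : ℂ) - 1 ≠ 0 := sub_ne_zero.mpr (by exact_mod_cast (by omega : d ≠ 1))
    have h2 : (d : ℂ) + 2 ≠ 0 := by exact_mod_cast (by omega : d + 2 ≠ 0)
    exact div_ne_zero (mul_ne_zero (mul_ne_zero hd0 h1) h2) two_ne_zero
  have t2 : (tracelessProj (Fin d) (-1)).trace ≠ 0 := by
    rw [trace_tracelessProj (by norm_num) c2, Fintype.card_fin,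
      show (d : ℂ) ^ 2 * (d + -1) / 2 - d = d * (d + 1) * (d - 2) / 2 by ring]
    have h1 : (d : ℂ) - 2 ≠ 0 := sub_ne_zero.mpr (by exact_mod_cast (by omega : d ≠ 2))
    have h2 : (d : ℂ) + 1 ≠ 0 := by exact_mod_cast (by omega : d + 1 ≠ 0)
    exact div_ne_zero (mul_ne_zero (mul_ne_zero hd0 h2) h1) two_ne_zero
  set c := (tracelessProj (Fin d) 1).trace
  set c' := (tracelessProj (Fin d) (-1)).trace
  have hc : 0 ≤ c⁻¹ := inv_nonneg.mpr p1.1.trace_nonneg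
  have hc' : 0 ≤ c'⁻¹ := inv_nonneg.mpr p2.1.trace_nonneg
  have hcd : (0 : ℂ) ≤ 2 / d := by
    rw [← Complex.ofReal_natCast, ← Complex.ofReal_ofNat, ← Complex.ofReal_div]
    exact_mod_cast (by positivity)
  -- `momentBound` with every second tensor factor enlarged to the identity. Its partial trace over
  -- the first two copies is `1/d + 1/d + 2/d + 2/d = 6/d`, which fixes `t`.
  let G₀ := c⁻¹ • tracelessProj (Fin d) 1 + c'⁻¹ • tracelessProj (Fin d) (-1) +
    (2 / d : ℂ) • (defProj (Fin d) 1 + defProj (Fin d) (-1))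
  have hG₀ : G₀.PosSemidef :=
    ((p1.1.smul hc).add (p2.1.smul hc')).add ((pA.1.add pB.1).smul hcd)
  have hG₀t : G₀ᵀ = G₀ := by
    simp only [G₀, Matrix.transpose_add, Matrix.transpose_smul, transpose_tracelessProj,
      transpose_defProj]
  have heq : (((6 / d : ℝ) : ℂ)) • (((d / 6 : ℂ) • G₀) ⊗ₖ
      (1 : Matrix ((Fin d × Fin d) × Fin d) ((Fin d × Fin d) × Fin d) ℂ) +
      (0 : ℂ) • ((swap₁₂ (Fin d) - (d : ℂ)⁻¹ • 1) ⊗ₖ swap₁₂ (Fin d))) = G₀ ⊗ₖ 1 := by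
    rw [zero_smul, add_zero, Matrix.smul_kronecker, smul_smul]
    push_cast
    rw [show (6 / d * (d / 6) : ℂ) = 1 by field_simp, one_smul]
  have hmain := hS.integral_transposeFidelity_le μ hd.le (G := (d / 6 : ℂ) • G₀) (β := 0)
    (t := 6 / d) (by positivity) ?_ ?_ ?_ ?_
  · refine hmain.trans (le_of_eq ?_)
    rw [div_div, sq]
  · rw [heq]
    exact hG₀.kronecker Matrix.PosSemidef.one
  · rw [heq]
    have : G₀ ⊗ₖ 1 - momentBound (Fin d) =
        c⁻¹ • (tracelessProj (Fin d) 1 ⊗ₖ (1 - tracelessProj (Fin d) 1)) +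
        c'⁻¹ • (tracelessProj (Fin d) (-1) ⊗ₖ (1 - tracelessProj (Fin d) (-1))) +
        (2 / d : ℂ) • (defProj (Fin d) 1 ⊗ₖ (1 - defProj (Fin d) 1) +
          defProj (Fin d) (-1) ⊗ₖ (1 - defProj (Fin d) (-1))) := by
      ext x y
      simp only [G₀, momentBound, Matrix.sub_apply, Matrix.add_apply, Matrix.smul_apply,
        Matrix.kroneckerMap_apply, smul_eq_mul, Fintype.card_fin]
      ring
    rw [this]
    have key : ∀ {Q : Matrix ((Fin d × Fin d) × Fin d) ((Fin d × Fin d) × Fin d) ℂ},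
        IsPrimitiveProj Q → (Q ⊗ₖ (1 - Q)).PosSemidef := fun hQ =>
      hQ.1.kronecker (posSemidef_one_sub_of_isPrimitiveProj hQ)
    exact (((key p1).smul hc).add ((key p2).smul hc')).add (((key pA).add (key pB)).smul hcd)
  · rw [Matrix.transpose_smul, hG₀t]
  · intro k l
    simp only [G₀, Matrix.smul_apply, Matrix.add_apply, smul_eq_mul, mul_add,
      Finset.sum_add_distrib, ← Finset.mul_sum]
    rw [sum_tracelessProj_apply (by norm_num) c1, sum_tracelessProj_apply (by norm_num) c2,
      sum_defProj_apply (by norm_num) c1, sum_defProj_apply (by norm_num) c2, Fintype.card_fin]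
    split_ifs
    · field_simp
      simp only [c, c']
      ring
    · simp

theorem IsSupermap.integral_transposeFidelity_le_of_eq_two
    [MeasurableSpace (Matrix.unitaryGroup (Fin 2) ℂ)]
    [BorelSpace (Matrix.unitaryGroup (Fin 2) ℂ)]
    (μ : Measure (Matrix.unitaryGroup (Fin 2) ℂ)) [IsProbabilityMeasure μ] [μ.IsHaarMeasure]
    {S : OpMap (Fin 2 × Fin 2) (Fin 2 × Fin 2) →ₗ[ℂ] OpMap (Fin 2) (Fin 2)}
    (hS : IsSupermap S) : ∫ U : Matrix.unitaryGroup (Fin 2) ℂ,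
      transposeFidelity S (U : Matrix (Fin 2) (Fin 2) ℂ) ∂μ ≤ 5 / 6 := by
  have c1 := card_add_one_ne_zero (Fin 2)
  have c2 := card_add_neg_one_ne_zero (Fin 2)
  have e1 : (1 : ℂ) * 1 = 1 := one_mul 1
  have e2 : (-1 : ℂ) * -1 = 1 := by norm_num
  have p1 := isPrimitiveProj_tracelessProj (a := Fin 2) (ε := 1) (Or.inl rfl)
  have p2 := isPrimitiveProj_tracelessProj (a := Fin 2) (ε := -1) (Or.inr rfl)
  have pA := isPrimitiveProj_defProj (a := Fin 2) (ε := 1) (Or.inl rfl)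
  have pB := isPrimitiveProj_defProj (a := Fin 2) (ε := -1) (Or.inr rfl)
  have t1 : (tracelessProj (Fin 2) 1).trace = 4 := by
    rw [trace_tracelessProj e1 c1, Fintype.card_fin]
    norm_num
  have q2 : tracelessProj (Fin 2) (-1) = 0 := by
    refine p2.1.trace_eq_zero_iff.mp ?_
    rw [trace_tracelessProj e2 c2, Fintype.card_fin]
    norm_num
  have hsum := sum_proj_eq_one (a := Fin 2) 1
  rw [q2, add_zero] at hsum
  have hswap : swap₁₂ (Fin 2) =
      tracelessProj (Fin 2) 1 + defProj (Fin 2) 1 - defProj (Fin 2) (-1) := by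
    have h1 : symProj (Fin 2) (-1) = defProj (Fin 2) (-1) := sub_eq_zero.mp q2
    rw [← h1]
    simp only [tracelessProj, symProj]
    module
  set Q := tracelessProj (Fin 2) 1
  set A := defProj (Fin 2) 1
  set B := defProj (Fin 2) (-1)
  -- The partial traces of `Q`, `A`, `B` are `2`, `1`, `1`, so the weights give total `1`. With the
  -- swap coefficient `1/5` they cancel the terms `Q ⊗ B`, `B ⊗ Q` and `B ⊗ A` of the certificate
  -- and give `A ⊗ A` and `B ⊗ B` exactly the weight `1` they have in `momentBound`.
  let G : Matrix ((Fin 2 × Fin 2) × Fin 2) ((Fin 2 × Fin 2) × Fin 2) ℂ :=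
    (1 / 10 : ℂ) • Q + (1 / 2 : ℂ) • A + (3 / 10 : ℂ) • B
  have hnn : ∀ r : ℝ, 0 ≤ r → (0 : ℂ) ≤ (r : ℂ) := fun r hr => by exact_mod_cast hr
  have n3 : (0 : ℂ) ≤ 1 / 3 := by simp
  have n23 : (0 : ℂ) ≤ 2 / 3 := by simpa using hnn (2 / 3) (by norm_num)
  have n12 : (0 : ℂ) ≤ 1 / 12 := by simp
  have heq : (((5 / 3 : ℝ) : ℂ)) • (G ⊗ₖ
      (1 : Matrix ((Fin 2 × Fin 2) × Fin 2) ((Fin 2 × Fin 2) × Fin 2) ℂ) +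
      (1 / 5 : ℂ) • ((swap₁₂ (Fin 2) - ((2 : ℕ) : ℂ)⁻¹ • 1) ⊗ₖ swap₁₂ (Fin 2))) =
      Q ⊗ₖ ((1 / 3 : ℂ) • (Q + A)) + A ⊗ₖ (Q + A + (2 / 3 : ℂ) • B) + B ⊗ₖ B := by
    rw [hswap, ← hsum]
    ext x y
    simp only [G, Matrix.sub_apply, Matrix.add_apply, Matrix.smul_apply,
      Matrix.kroneckerMap_apply, smul_eq_mul]
    push_cast
    ring
  have hmain := hS.integral_transposeFidelity_le μ le_rfl (G := G) (β := 1 / 5)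
    (t := 5 / 3) (by norm_num) ?_ ?_ ?_ ?_
  · refine hmain.trans (le_of_eq ?_)
    norm_num
  · rw [heq]
    exact ((p1.1.kronecker ((p1.1.add pA.1).smul n3)).add
      (pA.1.kronecker ((p1.1.add pA.1).add (pB.1.smul n23)))).add (pB.1.kronecker pB.1)
  · rw [heq]
    have : Q ⊗ₖ ((1 / 3 : ℂ) • (Q + A)) + A ⊗ₖ (Q + A + (2 / 3 : ℂ) • B) + B ⊗ₖ B -
        momentBound (Fin 2) = Q ⊗ₖ ((1 / 12 : ℂ) • Q + (1 / 3 : ℂ) • A) +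
          A ⊗ₖ (Q + (2 / 3 : ℂ) • B) := by
      rw [momentBound, q2, t1]
      ext x y
      simp only [Matrix.sub_apply, Matrix.add_apply, Matrix.smul_apply, Matrix.zero_apply,
        Matrix.kroneckerMap_apply, smul_eq_mul, Fintype.card_fin]
      push_cast
      ring
    rw [this]
    exact (p1.1.kronecker ((p1.1.smul n12).add (pA.1.smul n3))).add
      (pA.1.kronecker (p1.1.add (pB.1.smul n23)))
  · simp only [G, Q, A, B, Matrix.transpose_add, Matrix.transpose_smul, transpose_tracelessProj,
      transpose_defProj]
  · intro k l
    simp only [G, Matrix.smul_apply, Matrix.add_apply, smul_eq_mul,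
      Finset.sum_add_distrib, ← Finset.mul_sum]
    rw [sum_tracelessProj_apply e1 c1, sum_defProj_apply e1 c1, sum_defProj_apply e2 c2,
      Fintype.card_fin, t1]
    split_ifs
    · norm_num
    · simp

end AverageFidelity

/-! ### Supermaps with fixed pre- and postprocessing. -/

section Compress

variable {Ai Ao Bi Bo Ci Co Ci' Co' Di Do : Type}
  [Fintype Ai] [DecidableEq Ai] [Fintype Ao] [DecidableEq Ao]
  [Fintype Bi] [DecidableEq Bi] [Fintype Bo] [DecidableEq Bo]
  [Fintype Ci] [DecidableEq Ci] [Fintype Co] [DecidableEq Co]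
  [Fintype Ci'] [DecidableEq Ci'] [Fintype Co'] [DecidableEq Co']
  [Fintype Di] [DecidableEq Di] [Fintype Do] [DecidableEq Do]

/-- Precomposition with `pre` and postcomposition with `post`. -/
def compress (pre : OpMap Ci' Ci) (post : OpMap Co Co') : OpMap Ci Co →ₗ[ℂ] OpMap Ci' Co' where
  toFun Φ := post ∘ₗ Φ ∘ₗ pre
  map_add' Φ Ψ := by rw [LinearMap.add_comp, LinearMap.comp_add]
  map_smul' r Φ := by rw [LinearMap.smul_comp, LinearMap.comp_smul, RingHom.id_apply]

theorem compress_apply (pre : OpMap Ci' Ci) (post : OpMap Co Co') (Φ : OpMap Ci Co) :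
    compress pre post Φ = post ∘ₗ Φ ∘ₗ pre := rfl

theorem block_localAction (S : OpMap Ai Ao →ₗ[ℂ] OpMap Ci Co) (M : OpMap (Ai × Di) (Ao × Do))
    (Y : Matrix (Ci × Di) (Ci × Di) ℂ) (k' l' : Do) : block k' l' (localAction S M Y) =
      ∑ k, ∑ l, S (component M k l k' l') (block k l Y) := by
  ext i j
  simp only [block_apply, localAction_apply, Matrix.sum_apply]

theorem localAction_compress_comp (S : OpMap Ai Ao →ₗ[ℂ] OpMap Ci Co) (pre : OpMap Ci' Ci)
    (post : OpMap Co Co') (M : OpMap (Ai × Di) (Ao × Do)) :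
    localAction (compress pre post ∘ₗ S) M =
      tensorMap post (LinearMap.id : OpMap Do Do) ∘ₗ localAction S M ∘ₗ
        tensorMap pre (LinearMap.id : OpMap Di Di) := by
  refine LinearMap.ext fun Y => ?_
  ext p q
  simp only [LinearMap.comp_apply, tensorMap_id_apply, block_localAction, block_tensorMap_id,
    localAction_apply, compress_apply, map_sum, Matrix.sum_apply]

theorem IsSupermap.compress_comp {S : OpMap (Ai × Bi) (Ao × Bo) →ₗ[ℂ] OpMap Ci Co}
    (hS : IsSupermap S) {pre : OpMap Ci' Ci} {post : OpMap Co Co'} (hpre : IsChannel pre)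
    (hpost : IsChannel post) : IsSupermap (compress pre post ∘ₗ S) := by
  refine ⟨fun N hN => hpost.comp ((hS.1 N hN).comp hpre), fun m n M hM hM' => ?_⟩
  rw [localAction_compress_comp]
  exact (isChannel_tensorMap hpost isChannel_id).comp
    ((hS.2 m n M hM hM').comp (isChannel_tensorMap hpre isChannel_id))

end Compress

/-! ### Fidelity with a unitary channel. -/

section Fidelity

variable {a : Type} [Fintype a] [DecidableEq a]

theorem choi_conjBy_mul_self {K : Matrix a a ℂ} (hK : Kᴴ * K = 1) :
    choi (conjBy K) * choi (conjBy K) = (Fintype.card a : ℂ) • choi (conjBy K) := by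
  have h : ∑ r : a × a, star (K r.1 r.2) * K r.1 r.2 = Fintype.card a := by
    rw [Fintype.sum_prod_type_right]
    have : ∀ j, ∑ i, star (K i j) * K i j = 1 := fun j => by
      have := congrFun (congrFun hK j) j
      rwa [Matrix.mul_apply, Matrix.one_apply_eq] at this
    simp only [this]
    simp
  ext p q
  simp only [Matrix.mul_apply, choi_conjBy, Matrix.smul_apply, smul_eq_mul, ← h, Finset.sum_mul]
  refine Finset.sum_congr rfl fun r _ => ?_
  ring

theorem isHermitian_choi_conjBy (K : Matrix a a ℂ) : (choi (conjBy K)).IsHermitian := by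
  ext p q
  simp [choi_conjBy, mul_comm]

theorem IsChannel.trace_choi {Φ : OpMap a a} (h : IsChannel Φ) :
    (choi Φ).trace = Fintype.card a := by
  have : (choi Φ).trace = ∑ m : a, (Φ (Matrix.single m m 1)).trace := by
    simp only [Matrix.trace, Matrix.diag_apply, choi_apply, Fintype.sum_prod_type_right]
  rw [this]
  simp [h.2]

theorem trace_choi_conjBy_mul_self {K : Matrix a a ℂ} (hK : Kᴴ * K = 1) :
    (choi (conjBy K) * choi (conjBy K)).trace = (Fintype.card a : ℂ) ^ 2 := by
  rw [choi_conjBy_mul_self hK, Matrix.trace_smul, (isChannel_conjBy hK).trace_choi, smul_eq_mul, sq]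

/-- The Choi operator of the unitary channel is `d` times a projection, and `choi Φ` is positive
with trace `d`. -/
theorem IsChannel.trace_choi_mul_choi_conjBy_le {Φ : OpMap a a} (h : IsChannel Φ)
    {K : Matrix a a ℂ} (hK : Kᴴ * K = 1) :
    ((choi Φ * choi (conjBy K)).trace).re ≤ (Fintype.card a : ℝ) ^ 2 := by
  cases isEmpty_or_nonempty a
  · simp [Matrix.trace]
  set n : ℂ := (Fintype.card a : ℂ) with hn
  have hn0 : n ≠ 0 := Nat.cast_ne_zero.mpr Fintype.card_ne_zero
  have hP : (1 - n⁻¹ • choi (conjBy K)).PosSemidef := by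
    have hstar : star n⁻¹ = n⁻¹ := by simp [hn]
    have : 1 - n⁻¹ • choi (conjBy K) =
        (1 - n⁻¹ • choi (conjBy K))ᴴ * (1 - n⁻¹ • choi (conjBy K)) := by
      rw [Matrix.conjTranspose_sub, Matrix.conjTranspose_one, Matrix.conjTranspose_smul, hstar,
        (isHermitian_choi_conjBy K).eq, Matrix.mul_sub, Matrix.mul_one, Matrix.sub_mul,
        Matrix.one_mul, Matrix.smul_mul, Matrix.mul_smul, choi_conjBy_mul_self hK, ← hn, smul_smul, smul_smul,
        mul_assoc, inv_mul_cancel₀ hn0, mul_one, sub_self, sub_zero]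
    rw [this]
    exact Matrix.posSemidef_conjTranspose_mul_self _
  have h0 := trace_mul_nonneg_of_posSemidef h.1.choi_posSemidef hP
  rw [Matrix.mul_sub, Matrix.mul_one, Matrix.trace_sub, h.trace_choi, Matrix.mul_smul,
    Matrix.trace_smul, smul_eq_mul, hn, ← Complex.ofReal_natCast, ← Complex.ofReal_inv,
    Complex.sub_re, Complex.re_ofReal_mul, Complex.ofReal_re, sub_nonneg, inv_mul_le_iff₀
      (Nat.cast_pos.mpr Fintype.card_pos)] at h0
  rwa [sq]

end Fidelity

/-! ### Fixing and discarding the control qubit. -/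

section Control

variable {a : Type} [Fintype a] [DecidableEq a]

/-- The operator `A ⊗ |k⟩`. -/
def controlIn (A : Matrix a a ℂ) (k : Fin 2) : Matrix (a × Fin 2) a ℂ :=
  Matrix.of fun p j => if p.2 = k then A p.1 j else 0

/-- The operator `A ⊗ ⟨k|`. -/
def controlOut (A : Matrix a a ℂ) (k : Fin 2) : Matrix a (a × Fin 2) ℂ :=
  Matrix.of fun i q => if q.2 = k then A i q.1 else 0

theorem isChannel_controlIn {A : Matrix a a ℂ} (hA : Aᴴ * A = 1) (k : Fin 2) :
    IsChannel (conjBy (controlIn A k)) := by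
  refine isChannel_conjBy (Eq.trans ?_ hA)
  ext i j
  simp [Matrix.mul_apply, controlIn, Fintype.sum_prod_type, apply_ite]

theorem isChannel_controlOut {A : Matrix a a ℂ} (hA : Aᴴ * A = 1) :
    IsChannel (krausMap (controlOut A)) := by
  refine isChannel_krausMap _ ?_
  ext ⟨i, k⟩ ⟨j, l⟩
  have h := congrFun (congrFun hA i) j
  simp only [Matrix.mul_apply, Matrix.conjTranspose_apply, Matrix.one_apply, ← starRingEnd_apply] at h
  fin_cases k <;> fin_cases l <;>
    simp [Matrix.mul_apply, controlOut, Matrix.one_apply, h]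

theorem controlOut_mul_flipOp_mul_controlIn (W A B U : Matrix a a ℂ) (k l : Fin 2) :
    controlOut B k * flipOp W U * controlIn A l =
      if k = l then (if l = 0 then B * U * A else B * theta W U * A) else 0 := by
  have h : ∀ p q, flipOp W U p q =
      (U ⊗ₖ Matrix.single 0 0 1 + theta W U ⊗ₖ Matrix.single 1 1 1 :
        Matrix (a × Fin 2) (a × Fin 2) ℂ) p q := fun _ _ => rfl
  ext i j
  fin_cases k <;> fin_cases l <;>
    simp [Matrix.mul_apply, controlOut, controlIn, Fintype.sum_prod_type, Matrix.single_apply, h]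

/-- The flipped operator is diagonal in the control, so a control prepared in `|l⟩` and then
discarded leaves a single Kraus operator. -/
theorem compress_control_timeFlip (W A B U : Matrix a a ℂ) (l : Fin 2) :
    compress (conjBy (controlIn A l)) (krausMap (controlOut B)) (timeFlip W (conjBy U)) =
      conjBy (if l = 0 then B * U * A else B * theta W U * A) := by
  rw [timeFlip, liftKraus_conjBy]
  refine LinearMap.ext fun Z => ?_
  have h : ∀ k, controlOut B k *
      (flipOp W U * (controlIn A l * Z * (controlIn A l)ᴴ) * (flipOp W U)ᴴ) *
      (controlOut B k)ᴴ =
        (controlOut B k * flipOp W U * controlIn A l) * Z *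
          (controlOut B k * flipOp W U * controlIn A l)ᴴ := by
    intro k
    simp only [Matrix.conjTranspose_mul, Matrix.mul_assoc]
  simp only [compress_apply, LinearMap.comp_apply, krausMap_apply, conjBy, sandwich_apply, h,
    controlOut_mul_flipOp_mul_controlIn]
  rw [Finset.sum_eq_single l (fun k _ hk => by simp [hk]) (by simp)]
  simp

end Control

/-! ### Impossibility of simulating the time flip. -/

section NoGo

variable {d : ℕ} {S : OpMap (Fin d × Fin d) (Fin d × Fin d) →ₗ[ℂ] OpMap (Fin d) (Fin d)}

/-- Otherwise the average would be `1`, whereas it is at most `6/9` for `d ≥ 3` and `5/6` for `d =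
2`. -/
theorem IsSupermap.exists_transposeFidelity_ne_one (hd : 2 ≤ d) (hS : IsSupermap S) :
    ∃ U ∈ Matrix.unitaryGroup (Fin d) ℂ, transposeFidelity S U ≠ 1 := by
  by_contra! h
  let _ : MeasurableSpace (Matrix.unitaryGroup (Fin d) ℂ) := borel _
  have : BorelSpace (Matrix.unitaryGroup (Fin d) ℂ) := ⟨rfl⟩
  let μ : Measure (Matrix.unitaryGroup (Fin d) ℂ) := Measure.haarMeasure ⊤
  have hμ : IsProbabilityMeasure μ := ⟨by
    simpa using Measure.haarMeasure_self
      (K₀ := (⊤ : TopologicalSpace.PositiveCompacts (Matrix.unitaryGroup (Fin d) ℂ)))⟩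
  have h1 : ∫ U : Matrix.unitaryGroup (Fin d) ℂ,
      transposeFidelity S (U : Matrix (Fin d) (Fin d) ℂ) ∂μ = 1 := by
    simp [h _ (Subtype.prop _)]
  rcases hd.lt_or_eq with hd | rfl
  · have h2 := hS.integral_transposeFidelity_le_of_two_lt μ hd
    rw [h1, le_div_iff₀ (by positivity)] at h2
    have h3 : (3 : ℝ) ≤ d := by exact_mod_cast hd
    nlinarith
  · have h2 := hS.integral_transposeFidelity_le_of_eq_two μ
    rw [h1] at h2
    norm_num at h2

/-- Two numbers at most `d²` have weighted mean `d²`, so the one with positive weight equals `d²`.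
-/
theorem trace_choi_mul_choi_conjBy_of_convex {K : Matrix (Fin d) (Fin d) ℂ} (hK : Kᴴ * K = 1)
    {Φ Ψ : OpMap (Fin d) (Fin d)} (hΦ : IsChannel Φ) (hΨ : IsChannel Ψ) {p : ℝ} (hp : 0 < p)
    (hp1 : p ≤ 1) (h : conjBy K = (p : ℂ) • Φ + ((1 - p : ℝ) : ℂ) • Ψ) :
    ((choi Φ * choi (conjBy K)).trace).re = (d : ℝ) ^ 2 := by
  have h1 := hΦ.trace_choi_mul_choi_conjBy_le hK
  have h2 := hΨ.trace_choi_mul_choi_conjBy_le hK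
  have h3 := congrArg Complex.re (trace_choi_conjBy_mul_self hK)
  have h4 : choi (conjBy K) = (p : ℂ) • choi Φ + ((1 - p : ℝ) : ℂ) • choi Ψ := by
    rw [h]
    rfl
  have h5 : (choi (conjBy K) * choi (conjBy K)).trace =
      (p : ℂ) * (choi Φ * choi (conjBy K)).trace +
        ((1 - p : ℝ) : ℂ) * (choi Ψ * choi (conjBy K)).trace := by
    conv_lhs =>
      enter [1, 1]
      rw [h4]
    rw [Matrix.add_mul, Matrix.trace_add, Matrix.smul_mul, Matrix.smul_mul, Matrix.trace_smul,
      Matrix.trace_smul, smul_eq_mul, smul_eq_mul]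
  rw [h5, Complex.add_re, Complex.re_ofReal_mul, Complex.re_ofReal_mul, Fintype.card_fin,
    ← Complex.ofReal_natCast, ← Complex.ofReal_pow, Complex.ofReal_re] at h3
  rw [Fintype.card_fin] at h1 h2
  refine le_antisymm h1 ?_
  by_contra! hlt
  nlinarith [mul_lt_mul_of_pos_left hlt hp, mul_le_mul_of_nonneg_left h2 (sub_nonneg.mpr hp1)]

theorem conjTranspose_transpose_mul_transpose {a : Type} [Fintype a] [DecidableEq a]
    {U : Matrix a a ℂ} (hU : U * Uᴴ = 1) : Uᵀᴴ * Uᵀ = 1 := by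
  rw [show Uᵀᴴ = Uᴴᵀ from rfl, ← Matrix.transpose_mul, hU, Matrix.transpose_one]

theorem transposeFidelity_eq_one_of_convex (hd : d ≠ 0) {U : Matrix (Fin d) (Fin d) ℂ}
    (hU : U ∈ Matrix.unitaryGroup (Fin d) ℂ) (hS : IsSupermap S) {Ψ : OpMap (Fin d) (Fin d)}
    (hΨ : IsChannel Ψ) {p : ℝ} (hp : 0 < p) (hp1 : p ≤ 1)
    (h : conjBy Uᵀ = (p : ℂ) • forward S (conjBy U) (conjBy U) + ((1 - p : ℝ) : ℂ) • Ψ) :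
    transposeFidelity S U = 1 := by
  have hUc := isChannel_conjBy (Matrix.mem_unitaryGroup_iff'.mp hU)
  have := trace_choi_mul_choi_conjBy_of_convex
    (conjTranspose_transpose_mul_transpose (Matrix.mem_unitaryGroup_iff.mp hU))
    (hS.1 _ (isNoSignalling_tensorMap hUc hUc)) hΨ hp hp1 h
  rw [transposeFidelity, forward, this, div_self]
  exact pow_ne_zero 2 (Nat.cast_ne_zero.mpr hd)

theorem transposeFidelity_eq_one_of_eq (hd : d ≠ 0) {U : Matrix (Fin d) (Fin d) ℂ}
    (hU : U ∈ Matrix.unitaryGroup (Fin d) ℂ) (hS : IsSupermap S)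
    (h : conjBy Uᵀ = forward S (conjBy U) (conjBy U)) : transposeFidelity S U = 1 :=
  transposeFidelity_eq_one_of_convex hd hU hS isChannel_id one_pos le_rfl (by simpa using h)

theorem theta_mem_unitaryGroup {W U : Matrix (Fin d) (Fin d) ℂ}
    (hW : W ∈ Matrix.unitaryGroup (Fin d) ℂ) (hU : U ∈ Matrix.unitaryGroup (Fin d) ℂ) :
    theta W U ∈ Matrix.unitaryGroup (Fin d) ℂ :=
  mul_mem (mul_mem hW (Matrix.transpose_mem_unitaryGroup_iff.mpr hU)) (Unitary.star_mem hW)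

theorem timeFlip_ne_convex (hd : 2 ≤ d) {W : Matrix (Fin d) (Fin d) ℂ}
    (hW : W ∈ Matrix.unitaryGroup (Fin d) ℂ) {p : ℝ} (hp : p ∈ Set.Icc (0 : ℝ) 1)
    {Sf Sb : OpMap (Fin d × Fin d) (Fin d × Fin d) →ₗ[ℂ] OpMap (Fin d × Fin 2) (Fin d × Fin 2)}
    (hSf : IsSupermap Sf) (hSb : IsSupermap Sb) :
    ¬ ∀ U ∈ Matrix.unitaryGroup (Fin d) ℂ, timeFlip W (conjBy U) =
      (p : ℂ) • forward Sf (conjBy U) (conjBy U) +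
        ((1 - p : ℝ) : ℂ) • backward W Sb (conjBy U) (conjBy U) := by
  intro h
  have hd0 : d ≠ 0 := by omega
  have w1 : Wᴴ * W = 1 := Matrix.mem_unitaryGroup_iff'.mp hW
  have w2 : W * Wᴴ = 1 := Matrix.mem_unitaryGroup_iff.mp hW
  have w3 : Wᵀᴴ * Wᵀ = 1 := conjTranspose_transpose_mul_transpose w2
  have w4 : Wᵀ * Wᵀᴴ = 1 := mul_eq_one_comm.mp w3
  -- If `p = 0`, the control is set to `0`, where the flip applies `U` while the backward slots hold
  -- `θ(U)`. If `p > 0`, it is set to `1`, where the flip applies `θ(U)` while the forward slots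
  -- hold `U`.
  rcases hp.1.eq_or_lt with rfl | hp0
  · have hpre := isChannel_controlIn w3 0
    have hpost : IsChannel (krausMap (controlOut Wᵀᴴ)) :=
      isChannel_controlOut (by rwa [Matrix.conjTranspose_conjTranspose])
    have hS := hSb.compress_comp hpre hpost
    obtain ⟨V, hV, hne⟩ := hS.exists_transposeFidelity_ne_one hd
    refine hne (transposeFidelity_eq_one_of_eq hd0 hV hS ?_)
    have hWt := Matrix.transpose_mem_unitaryGroup_iff.mpr hW
    -- This is the preimage of `V` under `θ`, so that the backward slots receive `V`. Conjugation by
    -- `Wᵀ` then turns it into `Vᵀ`.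
    have hU : Wᵀ * Vᵀ * Wᵀᴴ ∈ Matrix.unitaryGroup (Fin d) ℂ := theta_mem_unitaryGroup hWt hV
    have hθ : theta W (Wᵀ * Vᵀ * Wᵀᴴ) = V := by
      change W * (Wᵀ * Vᵀ * Wᵀᴴ)ᵀ * Wᴴ = V
      rw [Matrix.transpose_mul, Matrix.transpose_mul, Matrix.transpose_transpose,
        Matrix.transpose_transpose, show Wᵀᴴᵀ = Wᴴ from rfl, ← Matrix.mul_assoc, w2,
        Matrix.one_mul, Matrix.mul_assoc, w2, Matrix.mul_one]
    have key := congrArg (compress (conjBy (controlIn Wᵀ 0)) (krausMap (controlOut Wᵀᴴ)))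
      (h _ hU)
    rw [compress_control_timeFlip, if_pos rfl] at key
    rw [show Wᵀᴴ * (Wᵀ * Vᵀ * Wᵀᴴ) * Wᵀ = (Wᵀᴴ * Wᵀ) * Vᵀ * (Wᵀᴴ * Wᵀ) by
      simp only [Matrix.mul_assoc], w3, Matrix.one_mul, Matrix.mul_one] at key
    rw [key]
    simp only [backward, forward, inversion, liftKraus_conjBy, hθ, sub_zero, Complex.ofReal_zero,
      Complex.ofReal_one, zero_smul, one_smul, zero_add, LinearMap.comp_apply]
  · have hpre := isChannel_controlIn w1 1
    have hpost : IsChannel (krausMap (controlOut Wᴴ)) :=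
      isChannel_controlOut (by rwa [Matrix.conjTranspose_conjTranspose])
    have hS := hSf.compress_comp hpre hpost
    obtain ⟨U, hU, hne⟩ := hS.exists_transposeFidelity_ne_one hd
    have hθ := isChannel_conjBy (Matrix.mem_unitaryGroup_iff'.mp (theta_mem_unitaryGroup hW hU))
    -- The backward term only has to be a channel, since its fidelity is then at most one.
    have hback := (hSb.compress_comp hpre hpost).1 _ (isNoSignalling_tensorMap hθ hθ)
    refine hne (transposeFidelity_eq_one_of_convex hd0 hU hS hback hp0 hp.2 ?_)
    have key := congrArg (compress (conjBy (controlIn W 1)) (krausMap (controlOut Wᴴ))) (h U hU)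
    rw [compress_control_timeFlip, if_neg one_ne_zero,
      show theta W U = W * Uᵀ * Wᴴ from rfl,
      show Wᴴ * (W * Uᵀ * Wᴴ) * W = (Wᴴ * W) * Uᵀ * (Wᴴ * W) by
        simp only [Matrix.mul_assoc], w1, Matrix.one_mul, Matrix.mul_one, map_add, map_smul,
      map_smul] at key
    rw [key]
    simp only [backward, forward, inversion, liftKraus_conjBy, LinearMap.comp_apply]

end NoGo

end TimeFlip

theorem theorem3 (d : ℕ) (hd : 2 ≤ d) :
    (∀ W ∈ Matrix.unitaryGroup (Fin d) ℂ,
      ¬ ∃ p ∈ Set.Icc (0 : ℝ) 1,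
        ∃ Sf Sb : TimeFlip.OpMap (Fin d × Fin d) (Fin d × Fin d) →ₗ[ℂ]
            TimeFlip.OpMap (Fin d × Fin 2) (Fin d × Fin 2),
          TimeFlip.IsSupermap Sf ∧ TimeFlip.IsSupermap Sb ∧
          ∀ U ∈ Matrix.unitaryGroup (Fin d) ℂ,
            TimeFlip.timeFlip W (TimeFlip.conjBy U) =
              (p : ℂ) • TimeFlip.forward Sf (TimeFlip.conjBy U) (TimeFlip.conjBy U) +
              ((1 - p : ℝ) : ℂ) •
                TimeFlip.backward W Sb (TimeFlip.conjBy U) (TimeFlip.conjBy U)) ∧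
    (∀ [MeasurableSpace (Matrix.unitaryGroup (Fin d) ℂ)]
        [BorelSpace (Matrix.unitaryGroup (Fin d) ℂ)]
        (μ : Measure (Matrix.unitaryGroup (Fin d) ℂ)) [IsProbabilityMeasure μ] [μ.IsHaarMeasure]
        (S : TimeFlip.OpMap (Fin d × Fin d) (Fin d × Fin d) →ₗ[ℂ]
          TimeFlip.OpMap (Fin d) (Fin d)), TimeFlip.IsSupermap S →
      Integrable (fun U : Matrix.unitaryGroup (Fin d) ℂ =>
        TimeFlip.transposeFidelity S (U : Matrix (Fin d) (Fin d) ℂ)) μ ∧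
      (2 < d → ∫ U : Matrix.unitaryGroup (Fin d) ℂ,
        TimeFlip.transposeFidelity S (U : Matrix (Fin d) (Fin d) ℂ) ∂μ ≤ 6 / (d : ℝ) ^ 2) ∧
      (d = 2 → ∫ U : Matrix.unitaryGroup (Fin d) ℂ,
        TimeFlip.transposeFidelity S (U : Matrix (Fin d) (Fin d) ℂ) ∂μ ≤ 5 / 6)) := by
  refine ⟨fun W hW ⟨p, hp, Sf, Sb, hSf, hSb, h⟩ => TimeFlip.timeFlip_ne_convex hd hW hp hSf hSb h,
    fun {_} {_} μ _ _ S hS => ⟨TimeFlip.integrable_transposeFidelity μ S, fun h =>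
      hS.integral_transposeFidelity_le_of_two_lt μ h, fun h => ?_⟩⟩
  subst h
  exact hS.integral_transposeFidelity_le_of_eq_two μ
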